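/- \textbf{Theorem (Uniqueness).} Let $T_-,T_+$ be orthogonal projectors in $\mathbb{C}^N$ and put $T_\pm^\perp=I-T_\pm$. For $V=V^*\in L^1([0,1];\mathbb{C}^{N\times N})$ and self-adjoint operators $a=T_-^\perp aT_-^\perp$, $b=T_+^\perp bT_+^\perp$ on $\mathbb{C}^N$, let $L$ be the self-adjoint operator $L\psi=-\psi''+V\psi$ in $L^2([0,1];\mathbb{C}^N)$ with the separated boundary conditions $\Gamma_-\psi=\Gamma_+\psi=0$, where \[ \Gamma_-\psi=T_-^\perp(\psi'(0)-a\psi(0))-T_-\psi(0),\qquad \Gamma_+\psi=T_+^\perp(\psi'(1)+b\psi(1))-T_+\psi(1). \] Let $\lambda_0<\lambda_1<\dots$ be the eigenvalues of $L$, counted without multiplicity, and let $F_-(x,\lambda)$ be the $N\times N$ matrix solution of $-F''+VF=\lambda F$ on $[0,1]$ with $\Gamma_-F_-=0$ and $T_-^\perp F_-(0,\lambda)+T_-F_-'(0,\lambda)=I$. For each $\alpha\ge 0$ let $P_\alpha$ be the orthogonal projector of $\mathbb{C}^N$ onto $\mathcal{E}_\alpha=\operatorname{Ker}(\Gamma_+F_-)(\lambda_\alpha)$,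 and let \[ g_\alpha=\bigl(P_\alpha S_\alpha P_\alpha\bigr)\big|_{\mathcal{E}_\alpha}\colon\mathcal{E}_\alpha\to\mathcal{E}_\alpha,\qquad S_\alpha=\int_0^1 F_-(x,\lambda_\alpha)^*F_-(x,\lambda_\alpha)\,dx . \] The set of triples $\{(\lambda_\alpha,P_\alpha,g_\alpha)\}_{\alpha\ge0}$ is called the spectral data of $L$. For fixed $T_\pm$, the spectral data determine $V$, $a$ and $b$ uniquely: if the spectral data corresponding to $(V;a,b)$ and to $(\tilde V;\tilde a,\tilde b)$, both of the above kind and with the same $T_\pm$, coincide, then $V=\tilde V$ almost everywhere on $[0,1]$, $a=\tilde a$ and $b=\tilde b$. -/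

import Mathlib

open MeasureTheory

/-- Lebesgue measure on `[0,1]`. -/
noncomputable abbrev unitMeasure : Measure ℝ := volume.restrict (Set.Icc (0 : ℝ) 1)

/-- `ψ` is differentiable on `[0,1]` (one-sidedly at the end points) with derivative `ψ₁`, and `ψ₁`
is absolutely continuous with almost everywhere derivative `ψ₂ ∈ L¹`, i.e. it is the indefinite
integral of `ψ₂`. -/
structure HasACDerivs {M : Type*} [NormedAddCommGroup M] [NormedSpace ℝ M]
    (ψ ψ₁ ψ₂ : ℝ → M) : Prop where
  hasDeriv : ∀ x ∈ Set.Icc (0 : ℝ) 1, HasDerivWithinAt ψ (ψ₁ x) (Set.Icc (0 : ℝ) 1) x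
  integrable : Integrable ψ₂ unitMeasure
  eq_integral : ∀ x ∈ Set.Icc (0 : ℝ) 1, ψ₁ x = ψ₁ 0 + ∫ t in (0 : ℝ)..x, ψ₂ t

section SturmLiouville

/-! Throughout, `E` stands for `ℂ^N` with its Hermitian inner product, and the `N × N` complex
matrices are the operators `E →L[ℂ] E`: the product is composition, `star` is the adjoint (the
conjugate transpose), and the norm is the operator norm. -/

variable {E : Type*} [NormedAddCommGroup E] [InnerProductSpace ℂ E] [FiniteDimensional ℂ E]
  [CompleteSpace E]

/-! The boundary operators. They act on vector-valued functions (`M = E`, where `A • v` is `A v`)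
and on matrix-valued functions (`M = E →L[ℂ] E`, where `A • B` is the product `A * B`). -/

/-- `Γ₋ψ = T₋^⊥ (ψ'(0) - a ψ(0)) - T₋ ψ(0)`, for the values `ψ0 = ψ(0)` and `dψ0 = ψ'(0)`. -/
noncomputable def bdryMinus {M : Type*} [AddCommGroup M] [Module (E →L[ℂ] E) M]
    (Tm a : E →L[ℂ] E) (ψ0 dψ0 : M) : M :=
  (1 - Tm) • (dψ0 - a • ψ0) - Tm • ψ0

/-- `Γ₋^⊥ψ = T₋^⊥ ψ(0) + T₋ ψ'(0)`, for the values `ψ0 = ψ(0)` and `dψ0 = ψ'(0)`. -/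
noncomputable def bdryMinusPerp {M : Type*} [AddCommGroup M] [Module (E →L[ℂ] E) M]
    (Tm : E →L[ℂ] E) (ψ0 dψ0 : M) : M :=
  (1 - Tm) • ψ0 + Tm • dψ0

/-- `Γ₊ψ = T₊^⊥ (ψ'(1) + b ψ(1)) - T₊ ψ(1)`, for the values `ψ1 = ψ(1)` and `dψ1 = ψ'(1)`. -/
noncomputable def bdryPlus {M : Type*} [AddCommGroup M] [Module (E →L[ℂ] E) M]
    (Tp b : E →L[ℂ] E) (ψ1 dψ1 : M) : M :=
  (1 - Tp) • (dψ1 + b • ψ1) - Tp • ψ1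

/-- The admissible parameters `(V; a, b)`: `V = V* ∈ L¹([0,1])`, `a = a* = T₋^⊥ a T₋^⊥` and
`b = b* = T₊^⊥ b T₊^⊥`. -/
structure IsSLParam (Tm Tp : E →L[ℂ] E) (V : ℝ → E →L[ℂ] E) (a b : E →L[ℂ] E) : Prop where
  integrable : Integrable V unitMeasure
  selfAdjoint : ∀ᵐ x ∂unitMeasure, IsSelfAdjoint (V x)
  a_selfAdjoint : IsSelfAdjoint a
  a_compress : (1 - Tm) * a * (1 - Tm) = a
  b_selfAdjoint : IsSelfAdjoint b
  b_compress : (1 - Tp) * b * (1 - Tp) = b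

/-- The graph of the Sturm-Liouville operator `L` in `L²([0,1]; ℂ^N)`: the function `ψ` lies in the
domain of `L` and `Lψ = f`. The domain consists of all `ψ` such that `ψ, ψ'` are absolutely
continuous, `-ψ'' + Vψ ∈ L²` and `Γ₋ψ = Γ₊ψ = 0`, and `Lψ = -ψ'' + Vψ`. -/
def SLMaps (Tm Tp : E →L[ℂ] E) (V : ℝ → E →L[ℂ] E) (a b : E →L[ℂ] E) (ψ f : ℝ → E) : Prop :=
  ∃ ψ₁ ψ₂ : ℝ → E, HasACDerivs ψ ψ₁ ψ₂ ∧
    bdryMinus Tm a (ψ 0) (ψ₁ 0) = 0 ∧ bdryPlus Tp b (ψ 1) (ψ₁ 1) = 0 ∧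
    MemLp f 2 unitMeasure ∧ ∀ᵐ x ∂unitMeasure, f x = -ψ₂ x + V x (ψ x)

/-- `lam` is an eigenvalue of `L` (which is self-adjoint, so its eigenvalues are real). -/
def IsSLEigenvalue (Tm Tp : E →L[ℂ] E) (V : ℝ → E →L[ℂ] E) (a b : E →L[ℂ] E) (lam : ℝ) : Prop :=
  ∃ ψ : ℝ → E, ¬ (ψ =ᵐ[unitMeasure] 0) ∧ SLMaps Tm Tp V a b ψ (fun x => (lam : ℂ) • ψ x)

/-- `F = F₋(·, lam)` on `[0,1]`, with derivative `F₁`: the matrix-valued solution of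
`-F'' + V F = lam F` with `Γ₋F = 0` and `Γ₋^⊥F = I`. -/
def IsFundMinus (Tm : E →L[ℂ] E) (V : ℝ → E →L[ℂ] E) (a : E →L[ℂ] E) (lam : ℂ)
    (F F₁ : ℝ → E →L[ℂ] E) : Prop :=
  ∃ F₂ : ℝ → E →L[ℂ] E, HasACDerivs F F₁ F₂ ∧
    (∀ᵐ x ∂unitMeasure, -F₂ x + V x * F x = lam • F x) ∧
    bdryMinus Tm a (F 0) (F₁ 0) = 0 ∧ bdryMinusPerp Tm (F 0) (F₁ 0) = 1

variable (E) in
/-- The type of the triples `(λ, P, g)`, where `g` is an operator acting in the range of `P`. -/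
structure SpectralTriple where
  eigenvalue : ℝ
  P : E →L[ℂ] E
  g : LinearMap.range P.toLinearMap →ₗ[ℂ] LinearMap.range P.toLinearMap

/-- The orthogonal projector of `ℂ^N` onto the kernel of `W`. -/
noncomputable def kerProj (W : E →L[ℂ] E) : E →L[ℂ] E :=
  (LinearMap.ker W.toLinearMap).starProjection

/-- The restriction of `P S P` to an operator acting in the range of `P`. -/
noncomputable def compressTo (P S : E →L[ℂ] E) :
    LinearMap.range P.toLinearMap →ₗ[ℂ] LinearMap.range P.toLinearMap :=
  (P * S * P).toLinearMap.restrict (fun x _ => ⟨S (P x), rfl⟩)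

/-- The triple `(lam, P, g)` built from `F = F₋(·, lam)` and its derivative `F₁`: `P` is the
orthogonal projector onto `Ker (Γ₊F₋)(lam)` and `g` is the restriction of `P S P` to this kernel,
where `S = ∫₀¹ F(x)* F(x) dx`. -/
noncomputable def spectralTriple (Tp b : E →L[ℂ] E) (lam : ℝ) (F F₁ : ℝ → E →L[ℂ] E) :
    SpectralTriple E where
  eigenvalue := lam
  P := kerProj (bdryPlus Tp b (F 1) (F₁ 1))
  g := compressTo (kerProj (bdryPlus Tp b (F 1) (F₁ 1))) (∫ x in (0 : ℝ)..1, star (F x) * F x)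

/-- The spectral data of `L`: the set of all triples `(λ, P, g)`, one for each eigenvalue `λ`. -/
def spectralData (Tm Tp : E →L[ℂ] E) (V : ℝ → E →L[ℂ] E) (a b : E →L[ℂ] E) :
    Set (SpectralTriple E) :=
  {t | ∃ lam : ℝ, IsSLEigenvalue Tm Tp V a b lam ∧
    ∃ F F₁ : ℝ → E →L[ℂ] E, IsFundMinus Tm V a (lam : ℂ) F F₁ ∧ t = spectralTriple Tp b lam F F₁}

end SturmLiouville

/-! Sending a sum of eigenfunctions of `L` to the sum of the eigenfunctions of `L̃` with the same
parameters is isometric, because the spectral data fix the Gram matrices and eigenspaces are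
orthogonal; by completeness of the eigenfunctions it extends to a unitary `W` of `L²([0,1])`.
Writing `u` and `ũ` for two corresponding sums, a transformation-operator argument (Duhamel's
formula for the wave equation `∂ₓ² - ∂ₜ²`, whose right-hand side vanishes outside a triangle of
dependence) yields `‖ũ - u‖(x) ≤ K ∫₀ˣ ‖u‖`. Thus `W` and, by symmetry, `W⁻¹ = W*` are causal
perturbations of the identity. But the adjoint of a causal operator is anticausal, which leaves
only `W = 1`. Hence corresponding eigenfunctions agree, so `V = Ṽ` and `a = ã`. Finally
`(b - b̃) u(1) = 0` for every eigenfunction `u`, and the values `u(1)` span `Ker T₊`. -/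

open Set Filter Topology

section AbsoluteContinuity

variable {M M' M'' : Type*} [NormedAddCommGroup M] [NormedSpace ℝ M] [NormedAddCommGroup M']
  [NormedSpace ℝ M'] [NormedAddCommGroup M''] [NormedSpace ℝ M'']

theorem intervalIntegrable_of_integrable_unit {M : Type*} [NormedAddCommGroup M] {f : ℝ → M}
    (hf : Integrable f unitMeasure) {x y : ℝ} (hx : x ∈ Icc (0 : ℝ) 1) (hy : y ∈ Icc (0 : ℝ) 1) :
    IntervalIntegrable f volume x y :=
  intervalIntegrable_iff.2
    (IntegrableOn.mono_set hf (uIoc_subset_uIcc.trans (uIcc_subset_Icc hx hy)))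

theorem integrable_unit_of_continuousOn {M : Type*} [NormedAddCommGroup M] {f : ℝ → M}
    (hf : ContinuousOn f (Icc 0 1)) : Integrable f unitMeasure :=
  hf.integrableOn_compact isCompact_Icc

theorem intervalIntegral_congr_ae_unit {f g : ℝ → M} (h : f =ᵐ[unitMeasure] g) {x y : ℝ}
    (hx : x ∈ Icc (0 : ℝ) 1) (hy : y ∈ Icc (0 : ℝ) 1) :
    ∫ t in x..y, f t = ∫ t in x..y, g t :=
  intervalIntegral.integral_congr_ae_restrict <| ae_restrict_of_ae_restrict_of_subset
    (uIoc_subset_uIcc.trans (uIcc_subset_Icc hx hy)) h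

theorem integrable_clm_apply_of_continuousOn {Q : ℝ → M →L[ℝ] M'} (hQ : Integrable Q unitMeasure)
    {u : ℝ → M} (hu : ContinuousOn u (Icc 0 1)) :
    Integrable (fun t => Q t (u t)) unitMeasure := by
  obtain ⟨C, hC⟩ := isCompact_Icc.exists_bound_of_continuousOn hu
  exact (ContinuousLinearMap.id ℝ (M →L[ℝ] M')).integrable_of_bilin_of_bdd_right C hQ
    (integrable_unit_of_continuousOn hu).aestronglyMeasurable
    ((ae_restrict_mem measurableSet_Icc).mono hC)

theorem integrable_continuousOn_clm_apply {Q : ℝ → M →L[ℝ] M'} (hQ : ContinuousOn Q (Icc 0 1))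
    {u : ℝ → M} (hu : Integrable u unitMeasure) :
    Integrable (fun t => Q t (u t)) unitMeasure := by
  obtain ⟨C, hC⟩ := isCompact_Icc.exists_bound_of_continuousOn hQ
  exact (ContinuousLinearMap.id ℝ (M →L[ℝ] M')).integrable_of_bilin_of_bdd_left C
    (integrable_unit_of_continuousOn hQ).aestronglyMeasurable
    ((ae_restrict_mem measurableSet_Icc).mono hC) hu

/-- `f` is absolutely continuous on `[0,1]` with almost everywhere derivative `f' ∈ L¹`, i.e. it is
the indefinite integral of `f'`. -/
structure HasACDeriv (f f' : ℝ → M) : Prop where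
  integrable : Integrable f' unitMeasure
  eq_integral : ∀ x ∈ Icc (0 : ℝ) 1, f x = f 0 + ∫ t in (0 : ℝ)..x, f' t

theorem hasACDeriv_integral {f' : ℝ → M} (hf' : Integrable f' unitMeasure) :
    HasACDeriv (fun x => ∫ t in (0 : ℝ)..x, f' t) f' :=
  ⟨hf', fun x _ => by simp only [intervalIntegral.integral_same, zero_add]⟩

namespace HasACDeriv

variable {f f' g g' : ℝ → M}

theorem integral_eq_sub (hf : HasACDeriv f f') {x y : ℝ} (hx : x ∈ Icc (0 : ℝ) 1)
    (hy : y ∈ Icc (0 : ℝ) 1) : ∫ t in x..y, f' t = f y - f x := by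
  rw [hf.eq_integral y hy, hf.eq_integral x hx, add_sub_add_left_eq_sub,
    intervalIntegral.integral_interval_sub_left
      (intervalIntegrable_of_integrable_unit hf.integrable unitInterval.zero_mem hy)
      (intervalIntegrable_of_integrable_unit hf.integrable unitInterval.zero_mem hx)]

theorem continuousOn (hf : HasACDeriv f f') : ContinuousOn f (Icc 0 1) := by
  have h := intervalIntegral.continuousOn_primitive_interval'
    (intervalIntegrable_of_integrable_unit hf.integrable unitInterval.zero_mem
      unitInterval.one_mem) left_mem_uIcc
  rw [uIcc_of_le zero_le_one] at h
  exact (continuousOn_const.add h).congr hf.eq_integral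

theorem congr_deriv (hf : HasACDeriv f f') (h : f' =ᵐ[unitMeasure] g') : HasACDeriv f g' :=
  ⟨hf.integrable.congr h, fun x hx => by
    rw [hf.eq_integral x hx, intervalIntegral_congr_ae_unit h unitInterval.zero_mem hx]⟩

theorem add (hf : HasACDeriv f f') (hg : HasACDeriv g g') :
    HasACDeriv (fun x => f x + g x) (fun x => f' x + g' x) :=
  ⟨hf.integrable.add hg.integrable, fun x hx => by
    rw [hf.eq_integral x hx, hg.eq_integral x hx, intervalIntegral.integral_add
      (intervalIntegrable_of_integrable_unit hf.integrable unitInterval.zero_mem hx)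
      (intervalIntegrable_of_integrable_unit hg.integrable unitInterval.zero_mem hx)]
    abel⟩

theorem const_smul {𝕜 : Type*} [RCLike 𝕜] [NormedSpace 𝕜 M] [SMulCommClass ℝ 𝕜 M]
    (hf : HasACDeriv f f') (c : 𝕜) : HasACDeriv (fun x => c • f x) (fun x => c • f' x) :=
  ⟨hf.integrable.smul c, fun x hx => by
    rw [hf.eq_integral x hx, smul_add, intervalIntegral.integral_smul]⟩

theorem sub (hf : HasACDeriv f f') (hg : HasACDeriv g g') :
    HasACDeriv (fun x => f x - g x) (fun x => f' x - g' x) := by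
  simpa only [neg_one_smul, sub_eq_add_neg] using hf.add (hg.const_smul (-1 : ℝ))

theorem clm_comp [CompleteSpace M] [CompleteSpace M'] (hf : HasACDeriv f f') (B : M →L[ℝ] M') :
    HasACDeriv (fun x => B (f x)) (fun x => B (f' x)) :=
  ⟨B.integrable_comp hf.integrable, fun x hx => by
    rw [hf.eq_integral x hx, map_add, B.intervalIntegral_comp_comm
      (intervalIntegrable_of_integrable_unit hf.integrable unitInterval.zero_mem hx)]⟩

theorem prodMk [CompleteSpace M] [CompleteSpace M'] (hf : HasACDeriv f f') {φ φ' : ℝ → M'}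
    (hφ : HasACDeriv φ φ') : HasACDeriv (fun x => (f x, φ x)) (fun x => (f' x, φ' x)) := by
  simpa using (hf.clm_comp (.inl ℝ M M')).add (hφ.clm_comp (.inr ℝ M M'))

theorem absolutelyContinuousOnInterval (hf : HasACDeriv f f') :
    AbsolutelyContinuousOnInterval f 0 1 := by
  have h_norm := (intervalIntegrable_of_integrable_unit hf.integrable.norm unitInterval.zero_mem
    unitInterval.one_mem).absolutelyContinuousOnInterval_intervalIntegral left_mem_uIcc
  have h_dist : ∀ x ∈ uIcc (0 : ℝ) 1, ∀ y ∈ uIcc (0 : ℝ) 1, dist (f x) (f y) ≤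
      dist (∫ t in (0 : ℝ)..x, ‖f' t‖) (∫ t in (0 : ℝ)..y, ‖f' t‖) := by
    rw [uIcc_of_le zero_le_one]
    intro x hx y hy
    rw [dist_comm, dist_comm (∫ t in (0 : ℝ)..x, ‖f' t‖), dist_eq_norm, Real.dist_eq,
      ← hf.integral_eq_sub hx hy, ← (hasACDeriv_integral hf.integrable.norm).integral_eq_sub hx hy]
    exact intervalIntegral.norm_integral_le_abs_integral_norm
  rw [absolutelyContinuousOnInterval_iff] at h_norm ⊢
  intro ε hε
  obtain ⟨δ, hδ, H⟩ := h_norm ε hε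
  exact ⟨δ, hδ, fun I hI hlen => (Finset.sum_le_sum fun i hi =>
    h_dist _ (hI.1 i hi).1 _ (hI.1 i hi).2).trans_lt (H I hI hlen)⟩

variable [CompleteSpace M]

theorem ae_hasDerivAt (hf : HasACDeriv f f') : ∀ᵐ x ∂unitMeasure, HasDerivAt f (f' x) x := by
  have h_deriv := (intervalIntegrable_of_integrable_unit hf.integrable unitInterval.zero_mem
    unitInterval.one_mem).ae_hasDerivAt_integral
  rw [uIcc_of_le zero_le_one] at h_deriv
  rw [unitMeasure, ← Measure.restrict_congr_set Ioo_ae_eq_Icc]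
  filter_upwards [ae_restrict_of_ae h_deriv, ae_restrict_mem measurableSet_Ioo] with x hx hx_mem
  refine ((hx (Ioo_subset_Icc_self hx_mem) 0 unitInterval.zero_mem).const_add
    (f 0)).congr_of_eventuallyEq ?_
  filter_upwards [Icc_mem_nhds hx_mem.1 hx_mem.2] with y hy using hf.eq_integral y hy

theorem of_ae_hasDerivAt (hg : AbsolutelyContinuousOnInterval g 0 1)
    (hg' : ∀ᵐ x ∂unitMeasure, HasDerivAt g (g' x) x) (h_int : Integrable g' unitMeasure) :
    HasACDeriv g g' := by
  have h_prim := hasACDeriv_integral h_int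
  have h_zero : ∀ᵐ x, x ∈ uIcc (0 : ℝ) 1 →
      HasDerivAt (fun x => g x - ∫ t in (0 : ℝ)..x, g' t) 0 x := by
    rw [uIcc_of_le zero_le_one]
    refine (ae_restrict_iff' measurableSet_Icc).1 ?_
    filter_upwards [hg', h_prim.ae_hasDerivAt] with x hx hx'
    exact (hx.sub hx').congr_deriv (sub_self _)
  obtain ⟨C, hC⟩ :=
    (hg.sub h_prim.absolutelyContinuousOnInterval).const_of_ae_hasDerivAt_zero h_zero
  rw [uIcc_of_le zero_le_one] at hC
  refine ⟨h_int, fun x hx => ?_⟩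
  have h0 := hC 0 unitInterval.zero_mem
  simp only [Pi.sub_apply, intervalIntegral.integral_same, sub_zero] at h0
  rw [h0]
  exact sub_eq_iff_eq_add.1 (hC x hx)

theorem comp_contDiff (hf : HasACDeriv f f') [CompleteSpace M'] {Φ : M → M'}
    (hΦ : ContDiff ℝ 1 Φ) :
    HasACDeriv (fun x => Φ (f x)) (fun x => fderiv ℝ Φ (f x) (f' x)) := by
  obtain ⟨K, hK⟩ := hΦ.locallyLipschitz.locallyLipschitzOn.exists_lipschitzOnWith_of_compact
    (isCompact_Icc.image_of_continuousOn hf.continuousOn)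
  refine of_ae_hasDerivAt ?_ ?_ ?_
  · have h_ac := hf.absolutelyContinuousOnInterval.const_smul (K : ℝ)
    rw [absolutelyContinuousOnInterval_iff] at h_ac ⊢
    intro ε hε
    obtain ⟨δ, hδ, H⟩ := h_ac ε hε
    refine ⟨δ, hδ, fun I hI hlen => (Finset.sum_le_sum fun i hi => ?_).trans_lt (H I hI hlen)⟩
    have hI_mem := hI.1 i hi
    rw [uIcc_of_le zero_le_one] at hI_mem
    simpa only [Pi.smul_apply, dist_smul₀, NNReal.norm_eq] using
      hK.dist_le_mul _ (mem_image_of_mem f hI_mem.1) _ (mem_image_of_mem f hI_mem.2)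
  · filter_upwards [hf.ae_hasDerivAt] with x hx
    exact (hΦ.differentiable one_ne_zero (f x)).hasFDerivAt.comp_hasDerivAt x hx
  · exact integrable_continuousOn_clm_apply
      ((hΦ.continuous_fderiv one_ne_zero).comp_continuousOn hf.continuousOn) hf.integrable

theorem bilinear_apply [CompleteSpace M'] [CompleteSpace M''] (hf : HasACDeriv f f')
    {φ φ' : ℝ → M'} (hφ : HasACDeriv φ φ') (B : M →L[ℝ] M' →L[ℝ] M'') :
    HasACDeriv (fun x => B (f x) (φ x)) (fun x => B (f x) (φ' x) + B (f' x) (φ x)) := by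
  have hB := B.isBoundedBilinearMap
  simpa only [hB.fderiv, IsBoundedBilinearMap.deriv_apply] using
    (hf.prodMk hφ).comp_contDiff hB.contDiff

end HasACDeriv

theorem hasACDeriv_of_hasDerivAt [CompleteSpace M] {f f' : ℝ → M}
    (hf : ∀ x, HasDerivAt f (f' x) x) (hf' : Continuous f') : HasACDeriv f f' :=
  ⟨integrable_unit_of_continuousOn hf'.continuousOn, fun x _ => by
    rw [intervalIntegral.integral_eq_sub_of_hasDerivAt (fun t _ => hf t)
      (hf'.intervalIntegrable _ _), add_sub_cancel]⟩

namespace HasACDerivs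

variable {ψ ψ₁ ψ₂ φ φ₁ φ₂ : ℝ → M}

theorem continuousOn (h : HasACDerivs ψ ψ₁ ψ₂) : ContinuousOn ψ (Icc 0 1) :=
  fun x hx => (h.hasDeriv x hx).continuousWithinAt

theorem hasACDeriv_deriv (h : HasACDerivs ψ ψ₁ ψ₂) : HasACDeriv ψ₁ ψ₂ :=
  ⟨h.integrable, h.eq_integral⟩

theorem continuousOn_deriv (h : HasACDerivs ψ ψ₁ ψ₂) : ContinuousOn ψ₁ (Icc 0 1) :=
  h.hasACDeriv_deriv.continuousOn

theorem congr_ae (h : HasACDerivs ψ ψ₁ ψ₂) (h₂ : ψ₂ =ᵐ[unitMeasure] φ₂) :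
    HasACDerivs ψ ψ₁ φ₂ :=
  have h_deriv := h.hasACDeriv_deriv.congr_deriv h₂
  ⟨h.hasDeriv, h_deriv.integrable, h_deriv.eq_integral⟩

theorem clm_comp [CompleteSpace M] [CompleteSpace M'] (h : HasACDerivs ψ ψ₁ ψ₂)
    (B : M →L[ℝ] M') :
    HasACDerivs (fun x => B (ψ x)) (fun x => B (ψ₁ x)) (fun x => B (ψ₂ x)) :=
  have h_deriv := h.hasACDeriv_deriv.clm_comp B
  ⟨fun x hx => B.hasFDerivAt.comp_hasDerivWithinAt x (h.hasDeriv x hx), h_deriv.integrable,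
    h_deriv.eq_integral⟩

theorem add (h : HasACDerivs ψ ψ₁ ψ₂) (h' : HasACDerivs φ φ₁ φ₂) :
    HasACDerivs (fun x => ψ x + φ x) (fun x => ψ₁ x + φ₁ x) (fun x => ψ₂ x + φ₂ x) :=
  have h_deriv := h.hasACDeriv_deriv.add h'.hasACDeriv_deriv
  ⟨fun x hx => (h.hasDeriv x hx).add (h'.hasDeriv x hx), h_deriv.integrable, h_deriv.eq_integral⟩

theorem sub (h : HasACDerivs ψ ψ₁ ψ₂) (h' : HasACDerivs φ φ₁ φ₂) :
    HasACDerivs (fun x => ψ x - φ x) (fun x => ψ₁ x - φ₁ x) (fun x => ψ₂ x - φ₂ x) :=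
  have h_deriv := h.hasACDeriv_deriv.sub h'.hasACDeriv_deriv
  ⟨fun x hx => (h.hasDeriv x hx).sub (h'.hasDeriv x hx), h_deriv.integrable, h_deriv.eq_integral⟩

theorem const_smul {𝕜 : Type*} [RCLike 𝕜] [NormedSpace 𝕜 M] [SMulCommClass ℝ 𝕜 M]
    (h : HasACDerivs ψ ψ₁ ψ₂) (c : 𝕜) :
    HasACDerivs (fun x => c • ψ x) (fun x => c • ψ₁ x) (fun x => c • ψ₂ x) :=
  have h_deriv := h.hasACDeriv_deriv.const_smul c
  ⟨fun x hx => (h.hasDeriv x hx).const_smul c, h_deriv.integrable, h_deriv.eq_integral⟩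

variable [CompleteSpace M]

theorem hasACDeriv (h : HasACDerivs ψ ψ₁ ψ₂) : HasACDeriv ψ ψ₁ := by
  have h_int := integrable_unit_of_continuousOn h.continuousOn_deriv
  refine ⟨h_int, fun x hx => ?_⟩
  rw [intervalIntegral.integral_eq_sub_of_hasDeriv_right_of_le hx.1
    (h.continuousOn.mono (Icc_subset_Icc_right hx.2)) (fun t ht => ?_)
    (intervalIntegrable_of_integrable_unit h_int unitInterval.zero_mem hx), add_sub_cancel]
  exact ((h.hasDeriv t ⟨ht.1.le, ht.2.le.trans hx.2⟩).hasDerivAt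
    (Icc_mem_nhds ht.1 (ht.2.trans_le hx.2))).hasDerivWithinAt

theorem of_hasACDeriv (h : HasACDeriv ψ ψ₁) (h₁ : HasACDeriv ψ₁ ψ₂) : HasACDerivs ψ ψ₁ ψ₂ := by
  refine ⟨fun x hx => ?_, h₁.integrable, h₁.eq_integral⟩
  have : Fact (x ∈ Icc (0 : ℝ) 1) := ⟨hx⟩
  exact ((intervalIntegral.integral_hasDerivWithinAt_right
    (intervalIntegrable_of_integrable_unit h.integrable unitInterval.zero_mem hx)
    (h₁.continuousOn.stronglyMeasurableAtFilter_nhdsWithin measurableSet_Icc x)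
    (h₁.continuousOn x hx)).const_add (ψ 0)).congr h.eq_integral (h.eq_integral x hx)

end HasACDerivs

end AbsoluteContinuity

section Gronwall

theorem intervalIntegral_le_integral_unit {f : ℝ → ℝ} (hf : Integrable f unitMeasure)
    (hf0 : ∀ x, 0 ≤ f x) {x : ℝ} (hx : x ∈ Icc (0 : ℝ) 1) :
    ∫ t in (0 : ℝ)..x, f t ≤ ∫ t, f t ∂unitMeasure := by
  rw [intervalIntegral.integral_of_le hx.1]
  exact setIntegral_mono_set hf (.of_forall hf0)
    (Ioc_subset_Icc_self.trans (Icc_subset_Icc_right hx.2)).eventuallyLE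

/-- The solution `w` of `w' = 2kw`, `w(0) = 1`. Measured against `w`, the operator
`v ↦ ∫₀ˣ k v` has norm at most `1/2`. -/
noncomputable def expWeight (k : ℝ → ℝ) (x : ℝ) : ℝ := Real.exp (2 * ∫ t in (0 : ℝ)..x, k t)

variable {k : ℝ → ℝ}

theorem expWeight_pos (k : ℝ → ℝ) (x : ℝ) : 0 < expWeight k x := Real.exp_pos _

theorem hasACDeriv_expWeight (hk : Integrable k unitMeasure) :
    HasACDeriv (expWeight k) (fun x => 2 * (k x * expWeight k x)) := by
  have h := ((hasACDeriv_integral hk).const_smul (2 : ℝ)).comp_contDiff Real.contDiff_exp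
  simp only [fderiv_eq_smul_deriv, Real.deriv_exp, smul_eq_mul, mul_assoc] at h
  exact h

theorem continuousOn_expWeight (hk : Integrable k unitMeasure) :
    ContinuousOn (expWeight k) (Icc 0 1) :=
  (hasACDeriv_expWeight hk).continuousOn

theorem integral_mul_expWeight_le (hk : Integrable k unitMeasure) {x : ℝ}
    (hx : x ∈ Icc (0 : ℝ) 1) :
    ∫ t in (0 : ℝ)..x, k t * expWeight k t ≤ expWeight k x / 2 := by
  have h := (hasACDeriv_expWeight hk).integral_eq_sub unitInterval.zero_mem hx
  rw [intervalIntegral.integral_const_mul] at h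
  linarith [expWeight_pos k 0]

theorem one_le_expWeight (hk : ∀ x, 0 ≤ k x) {x : ℝ} (hx : 0 ≤ x) : 1 ≤ expWeight k x :=
  Real.one_le_exp (mul_nonneg zero_le_two (intervalIntegral.integral_nonneg hx fun t _ => hk t))

theorem expWeight_le (hk : Integrable k unitMeasure) (hk0 : ∀ x, 0 ≤ k x) {x : ℝ}
    (hx : x ∈ Icc (0 : ℝ) 1) : expWeight k x ≤ Real.exp (2 * ∫ t, k t ∂unitMeasure) :=
  Real.exp_le_exp.2
    (mul_le_mul_of_nonneg_left (intervalIntegral_le_integral_unit hk hk0 hx) zero_le_two)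

theorem le_of_weighted_bootstrap {X : Type*} [TopologicalSpace X] {S : Set X} (hS : IsCompact S)
    {v w : X → ℝ} (hv : ContinuousOn v S) (hw : ContinuousOn w S) (hw1 : ∀ p ∈ S, 1 ≤ w p)
    {c : ℝ} (hc : 0 ≤ c)
    (h : ∀ Q, 0 ≤ Q → (∀ q ∈ S, v q ≤ Q * w q) → ∀ p ∈ S, v p ≤ c + Q * (w p / 2)) :
    ∀ p ∈ S, v p ≤ 2 * c * w p := by
  intro p hp
  have hw0 : ∀ q ∈ S, 0 < w q := fun q hq => one_pos.trans_le (hw1 q hq)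
  obtain ⟨y, hy, hmax⟩ := hS.exists_isMaxOn ⟨p, hp⟩ (hv.div hw fun q hq => (hw0 q hq).ne')
  have hv_le : ∀ q ∈ S, v q ≤ v y / w y * w q := fun q hq => (div_le_iff₀ (hw0 q hq)).1 (hmax hq)
  suffices v y / w y ≤ 2 * c from
    (hv_le p hp).trans (mul_le_mul_of_nonneg_right this (hw0 p hp).le)
  rcases le_total (v y / w y) 0 with h_neg | h_pos
  · exact h_neg.trans (by positivity)
  · have hvy := h _ h_pos hv_le y hy
    rw [mul_div_assoc', div_mul_cancel₀ _ (hw0 y hy).ne'] at hvy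
    rw [div_le_iff₀ (hw0 y hy)]
    nlinarith [hw1 y hy]

theorem integral_mul_le_of_le_expWeight (hk : Integrable k unitMeasure) (hk0 : ∀ x, 0 ≤ k x)
    {v : ℝ → ℝ} {Q x : ℝ} (hQ : 0 ≤ Q) (hx : x ∈ Icc (0 : ℝ) 1)
    (h_int : IntervalIntegrable (fun t => k t * v t) volume 0 x)
    (hv : ∀ t ∈ Icc (0 : ℝ) x, v t ≤ Q * expWeight k t) :
    ∫ t in (0 : ℝ)..x, k t * v t ≤ Q * (expWeight k x / 2) := by
  have hkw : Integrable (fun t => Q * (k t * expWeight k t)) unitMeasure :=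
    ((hasACDeriv_expWeight hk).integrable.const_mul (Q / 2)).congr
      (.of_forall fun t => by ring)
  calc ∫ t in (0 : ℝ)..x, k t * v t ≤ ∫ t in (0 : ℝ)..x, Q * (k t * expWeight k t) :=
        intervalIntegral.integral_mono_on hx.1 h_int
          (intervalIntegrable_of_integrable_unit hkw unitInterval.zero_mem hx)
          fun t ht => (mul_le_mul_of_nonneg_left (hv t ht) (hk0 t)).trans_eq (mul_left_comm _ _ _)
    _ ≤ _ := by
        rw [intervalIntegral.integral_const_mul]
        exact mul_le_mul_of_nonneg_left (integral_mul_expWeight_le hk hx) hQ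

theorem gronwall_integrable (hk : Integrable k unitMeasure) (hk0 : ∀ x, 0 ≤ k x) {v : ℝ → ℝ}
    {c : ℝ} (hc : 0 ≤ c) (hv : ContinuousOn v (Icc 0 1))
    (h : ∀ x ∈ Icc (0 : ℝ) 1, v x ≤ c + ∫ t in (0 : ℝ)..x, k t * v t) :
    ∀ x ∈ Icc (0 : ℝ) 1, v x ≤ 2 * c * expWeight k x := by
  refine le_of_weighted_bootstrap isCompact_Icc hv (continuousOn_expWeight hk)
    (fun x hx => one_le_expWeight hk0 hx.1) hc fun Q hQ hvQ x hx => (h x hx).trans ?_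
  refine (add_le_add_iff_left c).2 (integral_mul_le_of_le_expWeight hk hk0 hQ hx ?_
    fun t ht => hvQ t ⟨ht.1, ht.2.trans hx.2⟩)
  refine (intervalIntegrable_of_integrable_unit hk unitInterval.zero_mem hx).mul_continuousOn ?_
  exact hv.mono (uIcc_subset_Icc unitInterval.zero_mem hx)

end Gronwall

section LinearODE

variable {M : Type*} [NormedAddCommGroup M] [NormedSpace ℝ M]

theorem continuousOn_expWeight_smul_IccExtend {k : ℝ → ℝ} (hk : Integrable k unitMeasure)
    (z : C(Icc (0 : ℝ) 1, M)) :
    ContinuousOn (fun t => expWeight k t • IccExtend zero_le_one z t) (Icc 0 1) :=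
  (continuousOn_expWeight hk).smul z.continuous.Icc_extend'.continuousOn

/-- The Volterra operator `z ↦ h + ∫₀ˣ A z`, conjugated by the weight `expWeight ‖A‖` which turns
it into a contraction of `C([0,1])`. -/
noncomputable def volterraMap {A : ℝ → M →L[ℝ] M} (hA : Integrable A unitMeasure) {h : ℝ → M}
    (hh : ContinuousOn h (Icc 0 1)) (z : C(Icc (0 : ℝ) 1, M)) : C(Icc (0 : ℝ) 1, M) where
  toFun x := (expWeight (‖A ·‖) x)⁻¹ •
    (h x + ∫ t in (0 : ℝ)..x, A t (expWeight (‖A ·‖) t • IccExtend zero_le_one z t))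
  continuous_toFun := by
    have h_int := hasACDeriv_integral (integrable_clm_apply_of_continuousOn hA
      (continuousOn_expWeight_smul_IccExtend hA.norm z))
    exact (((continuousOn_expWeight hA.norm).inv₀ fun x _ => (expWeight_pos _ x).ne').smul
      (hh.add h_int.continuousOn)).domRestrict

theorem contractingWith_volterraMap {A : ℝ → M →L[ℝ] M} (hA : Integrable A unitMeasure)
    {h : ℝ → M} (hh : ContinuousOn h (Icc 0 1)) :
    ContractingWith (1 / 2) (volterraMap hA hh) := by
  refine ⟨by norm_num, LipschitzWith.of_dist_le_mul fun z z' => ?_⟩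
  rw [ContinuousMap.dist_le (by positivity)]
  intro x
  set w := expWeight (‖A ·‖)
  have h_int (y : C(Icc (0 : ℝ) 1, M)) :=
    intervalIntegrable_of_integrable_unit (integrable_clm_apply_of_continuousOn hA
      (continuousOn_expWeight_smul_IccExtend hA.norm y)) unitInterval.zero_mem x.2
  have hwA : IntervalIntegrable (fun t => ‖A t‖ * (w t * dist z z')) volume 0 x :=
    (intervalIntegrable_of_integrable_unit hA.norm unitInterval.zero_mem x.2).mul_continuousOn
      (((continuousOn_expWeight hA.norm).mul continuousOn_const).mono
        (uIcc_subset_Icc unitInterval.zero_mem x.2))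
  have h_bound : ‖∫ t in (0 : ℝ)..x, (A t (w t • IccExtend zero_le_one z t) -
      A t (w t • IccExtend zero_le_one z' t))‖ ≤ dist z z' * (w x / 2) := by
    refine (intervalIntegral.norm_integral_le_of_norm_le x.2.1 (.of_forall fun t _ => ?_)
      hwA).trans (integral_mul_le_of_le_expWeight hA.norm (fun _ => norm_nonneg _) dist_nonneg
        x.2 hwA fun t _ => (mul_comm _ _).le)
    rw [← map_sub, ← smul_sub]
    refine ((A t).le_opNorm _).trans (mul_le_mul_of_nonneg_left ?_ (norm_nonneg _))
    rw [norm_smul, Real.norm_of_nonneg (expWeight_pos _ t).le, ← dist_eq_norm]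
    exact mul_le_mul_of_nonneg_left (ContinuousMap.dist_apply_le_dist _) (expWeight_pos _ t).le
  rw [dist_eq_norm]
  change ‖(w x)⁻¹ • (h x + ∫ t in (0 : ℝ)..x, A t (w t • IccExtend zero_le_one z t)) -
    (w x)⁻¹ • (h x + ∫ t in (0 : ℝ)..x, A t (w t • IccExtend zero_le_one z' t))‖ ≤ _
  rw [← smul_sub, add_sub_add_left_eq_sub, ← intervalIntegral.integral_sub (h_int z) (h_int z'),
    norm_smul, norm_inv, Real.norm_of_nonneg (expWeight_pos _ x).le,
    inv_mul_le_iff₀ (expWeight_pos _ x)]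
  exact h_bound.trans_eq (by simp; ring)

theorem HasACDeriv.norm_le_of_linear {A : ℝ → M →L[ℝ] M} (hA : Integrable A unitMeasure)
    {g y : ℝ → M} (hg : Integrable g unitMeasure)
    (hy : HasACDeriv y (fun x => A x (y x) + g x)) {x : ℝ} (hx : x ∈ Icc (0 : ℝ) 1) :
    ‖y x‖ ≤ 2 * (‖y 0‖ + ∫ t, ‖g t‖ ∂unitMeasure) * Real.exp (2 * ∫ t, ‖A t‖ ∂unitMeasure) := by
  have h_le : ∀ x ∈ Icc (0 : ℝ) 1,
      ‖y x‖ ≤ ‖y 0‖ + (∫ t, ‖g t‖ ∂unitMeasure) + ∫ t in (0 : ℝ)..x, ‖A t‖ * ‖y t‖ := by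
    intro x hx
    have hAy : IntervalIntegrable (fun t => ‖A t‖ * ‖y t‖) volume 0 x :=
      (intervalIntegrable_of_integrable_unit hA.norm unitInterval.zero_mem hx).mul_continuousOn
        (hy.continuousOn.norm.mono (uIcc_subset_Icc unitInterval.zero_mem hx))
    have hg_x := intervalIntegrable_of_integrable_unit hg.norm unitInterval.zero_mem hx
    have h_deriv : ‖∫ t in (0 : ℝ)..x, (A t (y t) + g t)‖ ≤
        ∫ t in (0 : ℝ)..x, (‖A t‖ * ‖y t‖ + ‖g t‖) :=
      intervalIntegral.norm_integral_le_of_norm_le hx.1 (.of_forall fun t _ =>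
        norm_add_le_of_le ((A t).le_opNorm _) le_rfl) (hAy.add hg_x)
    rw [intervalIntegral.integral_add hAy hg_x] at h_deriv
    rw [hy.eq_integral x hx]
    linarith [norm_add_le (y 0) (∫ t in (0 : ℝ)..x, (A t (y t) + g t)),
      intervalIntegral_le_integral_unit hg.norm (fun _ => norm_nonneg _) hx]
  exact (gronwall_integrable hA.norm (fun _ => norm_nonneg _) (by positivity)
    hy.continuousOn.norm h_le x hx).trans (mul_le_mul_of_nonneg_left
      (expWeight_le hA.norm (fun _ => norm_nonneg _) hx) (by positivity))

/-- The coefficient of the first order system for `(u, u')` equivalent to `u'' = Q u`. -/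
def companion (Q : M →L[ℝ] M) : M × M →L[ℝ] M × M :=
  (ContinuousLinearMap.snd ℝ M M).prod (Q.comp (ContinuousLinearMap.fst ℝ M M))

theorem integrable_companion {Q : ℝ → M →L[ℝ] M} (hQ : Integrable Q unitMeasure) :
    Integrable (fun x => companion (Q x)) unitMeasure := by
  let B : (M →L[ℝ] M) →L[ℝ] M × M →L[ℝ] M × M :=
    (ContinuousLinearMap.compL ℝ (M × M) M (M × M) (.inr ℝ M M)).comp
      ((ContinuousLinearMap.compL ℝ (M × M) M M).flip (.fst ℝ M M))
  refine ((integrable_const (companion (0 : M →L[ℝ] M))).add (B.integrable_comp hQ)).congr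
    (.of_forall fun x => ?_)
  ext <;> simp [companion, B]

variable [CompleteSpace M]

theorem exists_volterra_solution {A : ℝ → M →L[ℝ] M} (hA : Integrable A unitMeasure) {h : ℝ → M}
    (hh : ContinuousOn h (Icc 0 1)) :
    ∃ y : ℝ → M, ContinuousOn y (Icc 0 1) ∧
      ∀ x ∈ Icc (0 : ℝ) 1, y x = h x + ∫ t in (0 : ℝ)..x, A t (y t) := by
  obtain ⟨z, hz, -⟩ := (contractingWith_volterraMap hA hh).exists_fixedPoint 0 (edist_ne_top _ _)
  refine ⟨fun t => expWeight (‖A ·‖) t • IccExtend zero_le_one z t,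
    continuousOn_expWeight_smul_IccExtend hA.norm z, fun x hx => ?_⟩
  have hz_x : z ⟨x, hx⟩ = volterraMap hA hh z ⟨x, hx⟩ := congrArg (fun y => y ⟨x, hx⟩) hz.symm
  beta_reduce
  rw [IccExtend_of_mem _ _ hx, hz_x]
  exact smul_inv_smul₀ (expWeight_pos _ x).ne' _

theorem exists_hasACDeriv {A : ℝ → M →L[ℝ] M} (hA : Integrable A unitMeasure) {g : ℝ → M}
    (hg : Integrable g unitMeasure) (p : M) :
    ∃ y : ℝ → M, HasACDeriv y (fun x => A x (y x) + g x) ∧ y 0 = p := by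
  obtain ⟨y, hy, hy_eq⟩ := exists_volterra_solution hA
    (h := fun x => p + ∫ t in (0 : ℝ)..x, g t)
    (continuousOn_const.add (hasACDeriv_integral hg).continuousOn)
  have hAy := integrable_clm_apply_of_continuousOn hA hy
  have hy0 : y 0 = p := by simpa using hy_eq 0 unitInterval.zero_mem
  refine ⟨y, ⟨hAy.add hg, fun x hx => ?_⟩, hy0⟩
  rw [hy_eq x hx, hy0, intervalIntegral.integral_add
    (intervalIntegrable_of_integrable_unit hAy unitInterval.zero_mem hx)
    (intervalIntegrable_of_integrable_unit hg unitInterval.zero_mem hx)]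
  abel

theorem hasACDerivs_iff_hasACDeriv_prodMk {u u₁ u₂ : ℝ → M} :
    HasACDerivs u u₁ u₂ ↔ HasACDeriv (fun x => (u x, u₁ x)) (fun x => (u₁ x, u₂ x)) :=
  ⟨fun h => h.hasACDeriv.prodMk h.hasACDeriv_deriv, fun h => .of_hasACDeriv
    (h.clm_comp (ContinuousLinearMap.fst ℝ M M)) (h.clm_comp (ContinuousLinearMap.snd ℝ M M))⟩

theorem exists_hasACDerivs {Q : ℝ → M →L[ℝ] M} (hQ : Integrable Q unitMeasure) {g : ℝ → M}
    (hg : Integrable g unitMeasure) (p q : M) :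
    ∃ u u₁ : ℝ → M, HasACDerivs u u₁ (fun x => Q x (u x) + g x) ∧ u 0 = p ∧ u₁ 0 = q := by
  obtain ⟨y, hy, hy0⟩ := exists_hasACDeriv (integrable_companion hQ)
    ((ContinuousLinearMap.inr ℝ M M).integrable_comp hg) (p, q)
  refine ⟨fun x => (y x).1, fun x => (y x).2, ?_, congrArg Prod.fst hy0, congrArg Prod.snd hy0⟩
  rw [hasACDerivs_iff_hasACDeriv_prodMk]
  convert hy using 2 with x
  simp [companion]

theorem HasACDerivs.norm_le_of_linear {Q : ℝ → M →L[ℝ] M} (hQ : Integrable Q unitMeasure)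
    {u u₁ g : ℝ → M} (hg : Integrable g unitMeasure)
    (hu : HasACDerivs u u₁ (fun x => Q x (u x) + g x)) {x : ℝ} (hx : x ∈ Icc (0 : ℝ) 1) :
    ‖(u x, u₁ x)‖ ≤ 2 * (‖(u 0, u₁ 0)‖ + ∫ t, ‖g t‖ ∂unitMeasure) *
      Real.exp (2 * ∫ t, ‖companion (Q t)‖ ∂unitMeasure) := by
  have hy : HasACDeriv (fun x => (u x, u₁ x))
      (fun x => companion (Q x) (u x, u₁ x) + ContinuousLinearMap.inr ℝ M M (g x)) := by
    convert hasACDerivs_iff_hasACDeriv_prodMk.1 hu using 2 with x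
    simp [companion]
  simpa using hy.norm_le_of_linear (integrable_companion hQ)
    ((ContinuousLinearMap.inr ℝ M M).integrable_comp hg) hx

theorem HasACDerivs.eq_zero_of_initial {Q : ℝ → M →L[ℝ] M} (hQ : Integrable Q unitMeasure)
    {u u₁ u₂ : ℝ → M} (hu : HasACDerivs u u₁ u₂) (h : ∀ᵐ x ∂unitMeasure, u₂ x = Q x (u x))
    (h0 : u 0 = 0) (h1 : u₁ 0 = 0) {x : ℝ} (hx : x ∈ Icc (0 : ℝ) 1) : u x = 0 ∧ u₁ x = 0 := by
  have hu' : HasACDerivs u u₁ (fun x => Q x (u x) + 0) := by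
    simpa only [add_zero] using hu.congr_ae h
  have h_norm := hu'.norm_le_of_linear hQ (integrable_zero ℝ M unitMeasure) hx
  rw [h0, h1, Prod.mk_zero_zero] at h_norm
  simpa using h_norm

end LinearODE

section Transformation

/-- `cos (k x)` for a complex frequency `k`. -/
noncomputable def cosFn (k : ℂ) (x : ℝ) : ℂ := Complex.cos (k * x)

/-- `sin (k x) / k`, with value `x` for `k = 0`. -/
noncomputable def sinFn (k : ℂ) (x : ℝ) : ℂ := ∫ t in (0 : ℝ)..x, cosFn k t

@[fun_prop]
theorem continuous_cosFn (k : ℂ) : Continuous (cosFn k) := by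
  unfold cosFn
  fun_prop

theorem hasDerivAt_sinFn (k : ℂ) (x : ℝ) : HasDerivAt (sinFn k) (cosFn k x) x :=
  (continuous_cosFn k).integral_hasStrictDerivAt 0 x |>.hasDerivAt

@[fun_prop]
theorem continuous_sinFn (k : ℂ) : Continuous (sinFn k) :=
  continuous_iff_continuousAt.2 fun x => (hasDerivAt_sinFn k x).continuousAt

@[simp] theorem cosFn_zero (k : ℂ) : cosFn k 0 = 1 := by simp [cosFn]

@[simp] theorem sinFn_zero (k : ℂ) : sinFn k 0 = 0 := by simp [sinFn]

theorem mul_sinFn (k : ℂ) (x : ℝ) : k * sinFn k x = Complex.sin (k * x) := by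
  have h : ∀ t ∈ uIcc 0 x, HasDerivAt (fun t : ℝ => Complex.sin (k * t)) (k * cosFn k t) t := by
    intro t _
    have h1 : HasDerivAt (fun t : ℝ => k * (t : ℂ)) k t := by
      simpa using (Complex.ofRealCLM.hasDerivAt (x := t)).const_mul k
    refine ((Complex.hasDerivAt_sin (k * t)).comp t h1).congr_deriv ?_
    rw [cosFn, mul_comm]
  rw [sinFn, ← intervalIntegral.integral_const_mul,
    intervalIntegral.integral_eq_sub_of_hasDerivAt h
      ((by fun_prop : Continuous fun t => k * cosFn k t).intervalIntegrable _ _)]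
  simp

theorem hasDerivAt_cosFn (k : ℂ) (x : ℝ) : HasDerivAt (cosFn k) (-(k ^ 2 * sinFn k x)) x := by
  have h1 : HasDerivAt (fun t : ℝ => k * (t : ℂ)) k x := by
    simpa using (Complex.ofRealCLM.hasDerivAt (x := x)).const_mul k
  refine ((Complex.hasDerivAt_cos (k * x)).comp x h1).congr_deriv ?_
  rw [← mul_sinFn]
  ring

@[simp] theorem cosFn_neg (k : ℂ) (x : ℝ) : cosFn k (-x) = cosFn k x := by
  simp [cosFn]

@[simp] theorem sinFn_neg (k : ℂ) (x : ℝ) : sinFn k (-x) = -sinFn k x := by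
  have h := intervalIntegral.integral_comp_neg (a := 0) (b := x) (fun t => cosFn k t)
  simp only [cosFn_neg, neg_zero] at h
  rw [sinFn, sinFn, h, intervalIntegral.integral_symm]

theorem cosFn_mul_cosFn (k : ℂ) (t x : ℝ) :
    cosFn k t * cosFn k x = (cosFn k (x + t) + cosFn k (x - t)) / 2 := by
  simp only [cosFn]
  push_cast
  rw [mul_add, mul_sub, Complex.cos_add, Complex.cos_sub]
  ring

theorem cosFn_mul_sinFn_eq_integral (k : ℂ) (t r : ℝ) :
    cosFn k t * sinFn k r = (1 / 2 : ℂ) * ∫ s in (t - r)..(t + r), cosFn k s := by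
  have h1 : ∫ s in (0 : ℝ)..r, cosFn k (t + s) = ∫ s in t..(t + r), cosFn k s := by
    simp
  have h2 : ∫ s in (0 : ℝ)..r, cosFn k (t - s) = ∫ s in (t - r)..t, cosFn k s := by
    simp
  rw [sinFn, ← intervalIntegral.integral_const_mul,
    ← intervalIntegral.integral_add_adjacent_intervals
    ((continuous_cosFn k).intervalIntegrable (t - r) t)
    ((continuous_cosFn k).intervalIntegrable t (t + r)), ← h1, ← h2,
    ← intervalIntegral.integral_add
    ((by fun_prop : Continuous fun s => cosFn k (t - s)).intervalIntegrable _ _)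
    ((by fun_prop : Continuous fun s => cosFn k (t + s)).intervalIntegrable _ _),
    ← intervalIntegral.integral_const_mul]
  refine intervalIntegral.integral_congr fun s _ => ?_
  rw [cosFn_mul_cosFn, add_comm t s]
  have : cosFn k (t - s) = cosFn k (s - t) := by rw [← cosFn_neg]; congr 1; ring
  rw [add_comm s t, this, ← cosFn_neg k (s - t)]
  have e : -(s - t) = t - s := by ring
  rw [e]
  ring

theorem cosFn_mul_sinFn (k : ℂ) (t x : ℝ) :
    cosFn k t * sinFn k x = (sinFn k (x + t) + sinFn k (x - t)) / 2 := by
  have h : ∫ s in (t - x)..(t + x), cosFn k s = sinFn k (t + x) - sinFn k (t - x) :=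
    intervalIntegral.integral_eq_sub_of_hasDerivAt (fun s _ => hasDerivAt_sinFn k s)
      ((continuous_cosFn k).intervalIntegrable _ _)
  have e : t - x = -(x - t) := by ring
  rw [cosFn_mul_sinFn_eq_integral, h, e, sinFn_neg, add_comm t x]
  ring

variable {E : Type*} [NormedAddCommGroup E] [NormedSpace ℂ E]

/-- `u` solves `-u'' + V u = z u` on `[0,1]`, with derivative `u₁`. -/
def IsSLSolution (V : ℝ → E →L[ℂ] E) (z : ℂ) (u u₁ : ℝ → E) : Prop :=
  ∃ u₂ : ℝ → E, HasACDerivs u u₁ u₂ ∧ ∀ᵐ x ∂unitMeasure, -u₂ x + V x (u x) = z • u x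

theorem integrable_complex_clm_apply_of_continuousOn {V : ℝ → E →L[ℂ] E}
    (hV : Integrable V unitMeasure) {u : ℝ → E} (hu : ContinuousOn u (Icc 0 1)) :
    Integrable (fun t => V t (u t)) unitMeasure :=
  integrable_clm_apply_of_continuousOn
    ((ContinuousLinearMap.restrictScalarsL ℂ E E ℝ ℝ).integrable_comp hV) hu

theorem IsSLSolution.variation_of_constants [CompleteSpace E] {V : ℝ → E →L[ℂ] E}
    {k : ℂ} {u u₁ : ℝ → E} (hu : IsSLSolution V (k ^ 2) u u₁) {x : ℝ} (hx : x ∈ Icc (0 : ℝ) 1) :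
    u x = cosFn k x • u 0 + sinFn k x • u₁ 0 +
      ∫ t in (0 : ℝ)..x, sinFn k (x - t) • V t (u t) := by
  obtain ⟨u₂, hac, heq⟩ := hu
  have h_cos : HasACDeriv (fun t => cosFn k (x - t)) (fun t => k ^ 2 * sinFn k (x - t)) :=
    hasACDeriv_of_hasDerivAt
      (fun t => by simpa using (hasDerivAt_cosFn k (x - t)).comp_const_sub x t) (by fun_prop)
  have h_sin : HasACDeriv (fun t => sinFn k (x - t)) (fun t => -cosFn k (x - t)) :=
    hasACDeriv_of_hasDerivAt (fun t => (hasDerivAt_sinFn k (x - t)).comp_const_sub x t)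
      (by fun_prop)
  have h_deriv : HasACDeriv (fun t => cosFn k (x - t) • u t + sinFn k (x - t) • u₁ t)
      (fun t => sinFn k (x - t) • V t (u t)) := by
    refine ((h_cos.bilinear_apply hac.hasACDeriv (.lsmul ℝ ℂ)).add
      (h_sin.bilinear_apply hac.hasACDeriv_deriv (.lsmul ℝ ℂ))).congr_deriv ?_
    filter_upwards [heq] with t ht
    rw [neg_add_eq_iff_eq_add.1 ht]
    simp only [ContinuousLinearMap.lsmul_apply]
    module
  rw [h_deriv.integral_eq_sub unitInterval.zero_mem hx]
  simp

variable {ι : Type*}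

/-- The solution of `-u'' = k² u` with Cauchy data `(1 - T) c` and `T c`. -/
noncomputable def freeSol (T : E →L[ℂ] E) (k : ℂ) (c : E) (t : ℝ) : E :=
  cosFn k t • (c - T c) + sinFn k t • T c

@[fun_prop]
theorem continuous_freeSol (T : E →L[ℂ] E) (k : ℂ) (c : E) : Continuous (freeSol T k c) := by
  unfold freeSol
  fun_prop

theorem cosFn_smul_freeSol (T : E →L[ℂ] E) (k : ℂ) (c : E) (t s : ℝ) :
    cosFn k s • freeSol T k c t =
      (1 / 2 : ℂ) • (freeSol T k c (t + s) + freeSol T k c (t - s)) := by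
  simp only [freeSol, smul_add, smul_smul, cosFn_mul_cosFn, cosFn_mul_sinFn]
  have e (p q : ℂ) (v : E) : ((p + q) / 2) • v = (1 / 2 * p) • v + (1 / 2 * q) • v := by
    rw [← add_smul]; congr 1; ring
  rw [e, e]
  abel

theorem freeSol_neg {T : E →L[ℂ] E} (hT : T * T = T) (k : ℂ) (c : E) (t : ℝ) :
    freeSol T k c (-t) = (1 - (2 : ℂ) • T) (freeSol T k c t) := by
  have h (v : E) : T (T v) = T v := DFunLike.congr_fun hT v
  have e (v : E) : (1 - (2 : ℂ) • T) v = v - (2 : ℂ) • T v := rfl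
  simp only [e, freeSol, cosFn_neg, sinFn_neg, map_add, map_smul, map_sub, h]
  module

theorem clm_freeSol {a T : E →L[ℂ] E} (haT : a * T = 0) (k : ℂ) (c : E) (t : ℝ) :
    a (freeSol T k c t) = cosFn k t • a c := by
  have h (v : E) : a (T v) = 0 := DFunLike.congr_fun haT v
  simp [freeSol, h]

theorem sum_cosFn_mul_sinFn_smul [CompleteSpace E] (s : Finset ι) (k : ι → ℂ) (w : ι → E)
    (t r : ℝ) :
    ∑ i ∈ s, (cosFn (k i) t * sinFn (k i) r) • w i =
      (1 / 2 : ℂ) • ∫ y in (t - r)..(t + r), ∑ i ∈ s, cosFn (k i) y • w i := by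
  rw [intervalIntegral.integral_finsetSum fun i _ =>
    (by fun_prop : Continuous fun y => cosFn (k i) y • w i).intervalIntegrable _ _,
    Finset.smul_sum]
  refine Finset.sum_congr rfl fun i _ => ?_
  rw [cosFn_mul_sinFn_eq_integral, intervalIntegral.integral_smul_const, smul_smul]

theorem intervalIntegral_norm_le_of_subset {M : Type*} [NormedAddCommGroup M] {f : ℝ → M}
    (hf : Continuous f) {a b c d : ℝ} (hab : a ≤ b) (hca : c ≤ a) (hbd : b ≤ d) :
    ∫ y in a..b, ‖f y‖ ≤ ∫ y in c..d, ‖f y‖ :=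
  intervalIntegral.integral_mono_interval hca hab hbd
    (Eventually.of_forall fun _ => norm_nonneg _) (hf.norm.intervalIntegrable _ _)

end Transformation

section TransformationBound

variable {E : Type*} [NormedAddCommGroup E] [NormedSpace ℂ E] {ι : Type*}

/-- `u` solves `-u'' + V u = z u` on `[0,1]` with Cauchy data `u(0) = (1 - T) c` and
`u'(0) = T c + a c`; when `a = a (1 - T)`, this is the solution with `Γ₋u = 0` and `Γ₋^⊥u = c`. -/
structure IsRegularSLSolution (V : ℝ → E →L[ℂ] E) (a T : E →L[ℂ] E) (z : ℂ) (c : E)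
    (u u₁ : ℝ → E) : Prop where
  isSLSolution : IsSLSolution V z u u₁
  apply_zero : u 0 = c - T c
  deriv_zero : u₁ 0 = T c + a c

theorem IsRegularSLSolution.continuousOn {V : ℝ → E →L[ℂ] E} {a T : E →L[ℂ] E} {z : ℂ} {c : E}
    {u u₁ : ℝ → E} (hu : IsRegularSLSolution V a T z c u u₁) : ContinuousOn u (Icc 0 1) :=
  hu.isSLSolution.elim fun _ h => h.1.continuousOn

/-- A finite combination of solutions of the free equation with the frequencies `k i`. -/
noncomputable def freeWave (T : E →L[ℂ] E) (s : Finset ι) (k : ι → ℂ) (c : ι → E) (t : ℝ) : E :=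
  ∑ i ∈ s, freeSol T (k i) (c i) t

@[fun_prop]
theorem continuous_freeWave (T : E →L[ℂ] E) (s : Finset ι) (k : ι → ℂ) (c : ι → E) :
    Continuous (freeWave T s k c) := by
  unfold freeWave
  fun_prop

theorem freeWave_neg {T : E →L[ℂ] E} (hT : T * T = T) (s : Finset ι) (k : ι → ℂ) (c : ι → E)
    (t : ℝ) : freeWave T s k c (-t) = (1 - (2 : ℂ) • T) (freeWave T s k c t) := by
  simp only [freeWave, map_sum, freeSol_neg hT]

theorem integral_norm_freeWave_symm_le {T : E →L[ℂ] E} (hT : T * T = T) (s : Finset ι)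
    (k : ι → ℂ) (c : ι → E) {x : ℝ} (hx : 0 ≤ x) :
    ∫ t in (-x)..x, ‖freeWave T s k c t‖ ≤
      (1 + ‖(1 : E →L[ℂ] E) - (2 : ℂ) • T‖) * ∫ t in (0 : ℝ)..x, ‖freeWave T s k c t‖ := by
  have h_cont : Continuous fun t => ‖freeWave T s k c t‖ := by fun_prop
  have h_neg : ∫ t in (-x)..0, ‖freeWave T s k c t‖ =
      ∫ t in (0 : ℝ)..x, ‖freeWave T s k c (-t)‖ := by
    rw [intervalIntegral.integral_comp_neg (fun t => ‖freeWave T s k c t‖), neg_zero]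
  have h_le : ∫ t in (0 : ℝ)..x, ‖freeWave T s k c (-t)‖ ≤
      ∫ t in (0 : ℝ)..x, ‖(1 : E →L[ℂ] E) - (2 : ℂ) • T‖ * ‖freeWave T s k c t‖ := by
    refine intervalIntegral.integral_mono_on hx
      ((h_cont.comp continuous_neg).intervalIntegrable _ _)
      ((h_cont.const_mul _).intervalIntegrable _ _) fun t _ => ?_
    rw [freeWave_neg hT]
    exact ContinuousLinearMap.le_opNorm _ _
  rw [intervalIntegral.integral_const_mul] at h_le
  rw [← intervalIntegral.integral_add_adjacent_intervals (h_cont.intervalIntegrable (-x) 0)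
    (h_cont.intervalIntegrable 0 x), h_neg]
  linarith

/-- The difference at position `x` and time `τ` of the solutions of the wave equations with and
without potential, both with velocity zero at time `0`, that have the spatial profiles
`∑ u i` and `∑ freeSol T (k i) (c i)` there. -/
noncomputable def waveDefect (T : E →L[ℂ] E) (s : Finset ι) (k : ι → ℂ) (c : ι → E)
    (u : ι → ℝ → E) (p : ℝ × ℝ) : E :=
  ∑ i ∈ s, cosFn (k i) p.2 • (u i p.1 - freeSol T (k i) (c i) p.1)

variable {V : ℝ → E →L[ℂ] E} {a T : E →L[ℂ] E} {s : Finset ι} {k : ι → ℂ} {c : ι → E}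
  {u u₁ : ι → ℝ → E}

theorem sum_cosFn_smul_eq (T : E →L[ℂ] E) (s : Finset ι) (k : ι → ℂ) (c : ι → E) (u : ι → ℝ → E)
    (t y : ℝ) :
    ∑ i ∈ s, cosFn (k i) y • u i t =
      (1 / 2 : ℂ) • (freeWave T s k c (t + y) + freeWave T s k c (t - y)) +
        waveDefect T s k c u (t, y) := by
  simp only [freeWave, waveDefect, ← Finset.sum_add_distrib, Finset.smul_sum]
  refine Finset.sum_congr rfl fun i _ => ?_
  rw [← cosFn_smul_freeSol, smul_sub, add_sub_cancel]

theorem continuousOn_waveDefect (hu : ∀ i ∈ s, ContinuousOn (u i) (Icc 0 1)) :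
    ContinuousOn (waveDefect T s k c u) (Icc 0 1 ×ˢ univ) := by
  refine continuousOn_finsetSum _ fun i hi => ContinuousOn.smul (by fun_prop) (.sub ?_ ?_)
  · exact (hu i hi).comp continuousOn_fst fun p hp => hp.1
  · fun_prop

theorem norm_integral_sum_cosFn_smul_le {x₀ t r τ q : ℝ} (ht : 0 ≤ t) (hr0 : 0 ≤ r) (hr1 : r ≤ 1)
    (hτ : |τ| + r + t ≤ x₀)
    (hq : ∀ y, |y| + t ≤ x₀ → ‖waveDefect T s k c u (t, y)‖ ≤ q) :
    ‖∫ y in (τ - r)..(τ + r), ∑ i ∈ s, cosFn (k i) y • u i t‖ ≤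
      (∫ y in (-x₀)..x₀, ‖freeWave T s k c y‖) + 2 * q := by
  set f := freeWave T s k c
  set J := ∫ y in (-x₀)..x₀, ‖f y‖
  have hf : Continuous f := continuous_freeWave T s k c
  have hτ' := abs_le.1 (le_refl |τ|)
  have hq0 : 0 ≤ q := (norm_nonneg _).trans (hq τ (by linarith))
  have h_add : ∫ y in (τ - r)..(τ + r), ‖f (t + y)‖ ≤ J := by
    rw [intervalIntegral.integral_comp_add_left (fun y => ‖f y‖) t]
    exact intervalIntegral_norm_le_of_subset hf (by linarith) (by linarith) (by linarith)
  have h_sub : ∫ y in (τ - r)..(τ + r), ‖f (t - y)‖ ≤ J := by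
    rw [intervalIntegral.integral_comp_sub_left (fun y => ‖f y‖) t]
    exact intervalIntegral_norm_le_of_subset hf (by linarith) (by linarith) (by linarith)
  have i_add : IntervalIntegrable (fun y => ‖f (t + y)‖) volume (τ - r) (τ + r) :=
    (by fun_prop : Continuous fun y => ‖f (t + y)‖).intervalIntegrable _ _
  have i_sub : IntervalIntegrable (fun y => ‖f (t - y)‖) volume (τ - r) (τ + r) :=
    (by fun_prop : Continuous fun y => ‖f (t - y)‖).intervalIntegrable _ _
  have h_le : ∀ y ∈ Ioc (τ - r) (τ + r), ‖∑ i ∈ s, cosFn (k i) y • u i t‖ ≤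
      1 / 2 * (‖f (t + y)‖ + ‖f (t - y)‖) + q := by
    intro y hy
    have hy' : |y| ≤ x₀ - t := abs_le.2 ⟨by linarith [hy.1], by linarith [hy.2]⟩
    rw [sum_cosFn_smul_eq T s k c]
    refine norm_add_le_of_le ?_ (hq y (by linarith))
    rw [norm_smul, norm_div, norm_one, Complex.norm_two]
    exact mul_le_mul_of_nonneg_left (norm_add_le _ _) one_half_pos.le
  refine (intervalIntegral.norm_integral_le_of_norm_le (by linarith) (.of_forall h_le)
    (((i_add.add i_sub).const_mul _).add intervalIntegrable_const)).trans ?_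
  rw [intervalIntegral.integral_add ((i_add.add i_sub).const_mul _) intervalIntegrable_const,
    intervalIntegral.integral_const_mul, intervalIntegral.integral_add i_add i_sub,
    intervalIntegral.integral_const, smul_eq_mul]
  nlinarith

theorem norm_integral_clm_freeWave_le {x₀ x τ : ℝ} (hx : 0 ≤ x) (hτ : |τ| + x ≤ x₀)
    (a : E →L[ℂ] E) :
    ‖(1 / 2 : ℂ) • ∫ y in (τ - x)..(τ + x), a (freeWave T s k c y)‖ ≤
      ‖a‖ / 2 * ∫ y in (-x₀)..x₀, ‖freeWave T s k c y‖ := by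
  have h_cont := continuous_freeWave T s k c
  have hτ' := abs_le.1 (le_refl |τ|)
  have h_norm : ‖∫ y in (τ - x)..(τ + x), a (freeWave T s k c y)‖ ≤
      ∫ y in (τ - x)..(τ + x), ‖a‖ * ‖freeWave T s k c y‖ :=
    intervalIntegral.norm_integral_le_of_norm_le (by linarith)
      (.of_forall fun y _ => a.le_opNorm _) ((h_cont.norm.const_mul _).intervalIntegrable _ _)
  have h_sub := intervalIntegral_norm_le_of_subset h_cont (a := τ - x) (b := τ + x) (c := -x₀)
    (d := x₀) (by linarith) (by linarith) (by linarith)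
  rw [intervalIntegral.integral_const_mul] at h_norm
  rw [norm_smul, norm_div, norm_one, Complex.norm_two]
  nlinarith [mul_le_mul_of_nonneg_left h_sub (norm_nonneg a)]

variable [CompleteSpace E]

/-- Duhamel's formula with d'Alembert's solution of the wave equation. -/
theorem waveDefect_eq (hV : Integrable V unitMeasure) (haT : a * T = 0)
    (hu : ∀ i ∈ s, IsRegularSLSolution V a T (k i ^ 2) (c i) (u i) (u₁ i))
    {x : ℝ} (hx : x ∈ Icc (0 : ℝ) 1) (τ : ℝ) :
    waveDefect T s k c u (x, τ) =
      (1 / 2 : ℂ) • (∫ y in (τ - x)..(τ + x), a (freeWave T s k c y)) +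
      ∫ t in (0 : ℝ)..x, V t ((1 / 2 : ℂ) • ∫ y in (τ - (x - t))..(τ + (x - t)),
        ∑ i ∈ s, cosFn (k i) y • u i t) := by
  have h_initial : (1 / 2 : ℂ) • ∫ y in (τ - x)..(τ + x), a (freeWave T s k c y) =
      ∑ i ∈ s, (cosFn (k i) τ * sinFn (k i) x) • a (c i) := by
    simp only [freeWave, map_sum, clm_freeSol haT, sum_cosFn_mul_sinFn_smul]
  have h_potential : ∫ t in (0 : ℝ)..x, V t ((1 / 2 : ℂ) •
        ∫ y in (τ - (x - t))..(τ + (x - t)), ∑ i ∈ s, cosFn (k i) y • u i t) =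
      ∑ i ∈ s, cosFn (k i) τ • ∫ t in (0 : ℝ)..x, sinFn (k i) (x - t) • V t (u i t) := by
    simp only [← sum_cosFn_mul_sinFn_smul, map_sum, map_smul]
    rw [intervalIntegral.integral_finsetSum]
    · simp only [← intervalIntegral.integral_smul, smul_smul]
    · exact fun i hi => (intervalIntegrable_of_integrable_unit
        (integrable_complex_clm_apply_of_continuousOn hV (hu i hi).continuousOn)
        unitInterval.zero_mem hx).continuousOn_smul (by fun_prop)
  rw [h_initial, h_potential, ← Finset.sum_add_distrib]
  refine Finset.sum_congr rfl fun i hi => ?_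
  rw [(hu i hi).isSLSolution.variation_of_constants hx, (hu i hi).apply_zero,
    (hu i hi).deriv_zero, freeSol]
  module

theorem norm_waveDefect_le_of_le_expWeight (hV : Integrable V unitMeasure) (haT : a * T = 0)
    (hu : ∀ i ∈ s, IsRegularSLSolution V a T (k i ^ 2) (c i) (u i) (u₁ i))
    {x₀ Q : ℝ} (hx₀ : x₀ ≤ 1) (hQ : 0 ≤ Q)
    (h : ∀ x τ, 0 ≤ x → |τ| + x ≤ x₀ →
      ‖waveDefect T s k c u (x, τ)‖ ≤ Q * expWeight (‖V ·‖) x)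
    {x τ : ℝ} (hx : 0 ≤ x) (hτ : |τ| + x ≤ x₀) :
    ‖waveDefect T s k c u (x, τ)‖ ≤
      (‖a‖ + ∫ t, ‖V t‖ ∂unitMeasure) / 2 * (∫ y in (-x₀)..x₀, ‖freeWave T s k c y‖) +
        Q * (expWeight (‖V ·‖) x / 2) := by
  set J := ∫ y in (-x₀)..x₀, ‖freeWave T s k c y‖
  set w := expWeight (‖V ·‖)
  have hx_mem : x ∈ Icc (0 : ℝ) 1 := ⟨hx, by linarith [abs_nonneg τ]⟩
  have hJ : 0 ≤ J := intervalIntegral.integral_nonneg (by linarith [abs_nonneg τ])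
    fun _ _ => norm_nonneg _
  have h_potential : ∀ t ∈ Ioc (0 : ℝ) x, ‖V t ((1 / 2 : ℂ) •
      ∫ y in (τ - (x - t))..(τ + (x - t)), ∑ i ∈ s, cosFn (k i) y • u i t)‖ ≤
      ‖V t‖ * (J / 2) + Q * (‖V t‖ * w t) := by
    intro t ht
    have h_mean := norm_integral_sum_cosFn_smul_le (T := T) (s := s) (k := k) (c := c) (u := u)
      ht.1.le (sub_nonneg.2 ht.2) (by linarith [ht.1, hx_mem.2])
      (by linarith : |τ| + (x - t) + t ≤ x₀) fun y hy => h t y ht.1.le hy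
    refine ((V t).le_opNorm _).trans ?_
    rw [norm_smul, norm_div, norm_one, Complex.norm_two]
    nlinarith [mul_le_mul_of_nonneg_left h_mean (norm_nonneg (V t))]
  have iV := intervalIntegrable_of_integrable_unit hV.norm unitInterval.zero_mem hx_mem
  have iVw : IntervalIntegrable (fun t => ‖V t‖ * w t) volume 0 x :=
    iV.mul_continuousOn ((continuousOn_expWeight hV.norm).mono
      (uIcc_subset_Icc unitInterval.zero_mem hx_mem))
  rw [waveDefect_eq hV haT hu hx_mem τ]
  refine (norm_add_le_of_le (norm_integral_clm_freeWave_le hx hτ a)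
    (intervalIntegral.norm_integral_le_of_norm_le hx (.of_forall h_potential)
      ((iV.mul_const _).add (iVw.const_mul _)))).trans ?_
  rw [intervalIntegral.integral_add (iV.mul_const _) (iVw.const_mul _),
    intervalIntegral.integral_mul_const, intervalIntegral.integral_const_mul]
  linarith [mul_le_mul_of_nonneg_left (integral_mul_expWeight_le hV.norm hx_mem) hQ,
    mul_le_mul_of_nonneg_right (intervalIntegral_le_integral_unit hV.norm
      (fun _ => norm_nonneg _) hx_mem) (by positivity : 0 ≤ J / 2)]

theorem norm_waveDefect_le (hV : Integrable V unitMeasure) (haT : a * T = 0)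
    (hu : ∀ i ∈ s, IsRegularSLSolution V a T (k i ^ 2) (c i) (u i) (u₁ i))
    {x₀ : ℝ} (hx₀ : x₀ ∈ Icc (0 : ℝ) 1) {x τ : ℝ} (hx : 0 ≤ x) (hτ : |τ| + x ≤ x₀) :
    ‖waveDefect T s k c u (x, τ)‖ ≤
      (‖a‖ + ∫ t, ‖V t‖ ∂unitMeasure) * (∫ y in (-x₀)..x₀, ‖freeWave T s k c y‖) *
        expWeight (‖V ·‖) x := by
  -- The triangle of dependence of the point `(x₀, 0)`.
  let Δ : Set (ℝ × ℝ) := {p | 0 ≤ p.1 ∧ |p.2| + p.1 ≤ x₀}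
  have hΔ : Δ ⊆ Icc 0 x₀ ×ˢ Icc (-x₀) x₀ := fun p hp =>
    ⟨⟨hp.1, by linarith [abs_nonneg p.2, hp.2]⟩, abs_le.1 (by linarith [hp.1, hp.2])⟩
  have hΔ_unit : ∀ p ∈ Δ, p.1 ∈ Icc (0 : ℝ) 1 := fun p hp =>
    ⟨hp.1, (hΔ hp).1.2.trans hx₀.2⟩
  have hΔ_compact : IsCompact Δ := (isCompact_Icc.prod isCompact_Icc).of_isClosed_subset
    ((isClosed_le continuous_const continuous_fst).inter
      (isClosed_le (f := fun p : ℝ × ℝ => |p.2| + p.1) (by fun_prop) continuous_const)) hΔ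
  have hJ : 0 ≤ ∫ y in (-x₀)..x₀, ‖freeWave T s k c y‖ :=
    intervalIntegral.integral_nonneg (by linarith [hx₀.1]) fun _ _ => norm_nonneg _
  have h_le := le_of_weighted_bootstrap hΔ_compact
    (v := fun p => ‖waveDefect T s k c u p‖) (w := fun p => expWeight (‖V ·‖) p.1)
    (((continuousOn_waveDefect fun i hi => (hu i hi).continuousOn).mono
      fun p hp => ⟨hΔ_unit p hp, mem_univ _⟩).norm)
    ((continuousOn_expWeight hV.norm).comp continuousOn_fst hΔ_unit)
    (fun p hp => one_le_expWeight (fun _ => norm_nonneg _) hp.1)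
    (by positivity)
    (fun Q hQ hQ_le p hp => norm_waveDefect_le_of_le_expWeight hV haT hu hx₀.2 hQ
      (fun x τ hx hτ => hQ_le (x, τ) ⟨hx, hτ⟩) hp.1 hp.2) (x, τ) ⟨hx, hτ⟩
  exact h_le.trans_eq (by ring)

theorem exists_transform_bound (ι : Type*) (hV : Integrable V unitMeasure) (hT : T * T = T)
    (haT : a * T = 0) :
    ∃ K : ℝ, 0 ≤ K ∧ ∀ (s : Finset ι) (k : ι → ℂ) (c : ι → E) (u u₁ : ι → ℝ → E),
      (∀ i ∈ s, IsRegularSLSolution V a T (k i ^ 2) (c i) (u i) (u₁ i)) →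
      ∀ x ∈ Icc (0 : ℝ) 1, ‖∑ i ∈ s, u i x - freeWave T s k c x‖ ≤
        K * ∫ t in (0 : ℝ)..x, ‖freeWave T s k c t‖ := by
  set A := ‖a‖ + ∫ t, ‖V t‖ ∂unitMeasure
  set R := 1 + ‖(1 : E →L[ℂ] E) - (2 : ℂ) • T‖
  set κ := Real.exp (2 * ∫ t, ‖V t‖ ∂unitMeasure)
  refine ⟨A * R * κ, by positivity, fun s k c u u₁ hu x hx => ?_⟩
  have h_defect : waveDefect T s k c u (x, 0) = ∑ i ∈ s, u i x - freeWave T s k c x := by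
    simp [waveDefect, freeWave]
  have h_le := norm_waveDefect_le hV haT hu hx hx.1 (τ := 0) (by simp)
  have h_wave : 0 ≤ ∫ t in (0 : ℝ)..x, ‖freeWave T s k c t‖ :=
    intervalIntegral.integral_nonneg hx.1 fun _ _ => norm_nonneg _
  rw [← h_defect]
  calc ‖waveDefect T s k c u (x, 0)‖
      ≤ A * (∫ y in (-x)..x, ‖freeWave T s k c y‖) * expWeight (‖V ·‖) x := h_le
    _ ≤ A * (R * ∫ t in (0 : ℝ)..x, ‖freeWave T s k c t‖) * κ := by
        gcongr
        · exact (expWeight_pos _ x).le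
        · exact integral_norm_freeWave_symm_le hT s k c hx.1
        · exact expWeight_le hV.norm (fun _ => norm_nonneg _) hx
    _ = _ := by ring

end TransformationBound

section Comparison

variable {E : Type*} [NormedAddCommGroup E]

theorem integral_norm_le_of_norm_le_add_integral {K : ℝ} (hK : 0 ≤ K) {f g : ℝ → E}
    (hf : ContinuousOn f (Icc 0 1)) (hg : ContinuousOn g (Icc 0 1))
    (h : ∀ x ∈ Icc (0 : ℝ) 1, ‖f x‖ ≤ ‖g x‖ + K * ∫ t in (0 : ℝ)..x, ‖f t‖)
    {x : ℝ} (hx : x ∈ Icc (0 : ℝ) 1) :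
    ∫ t in (0 : ℝ)..x, ‖f t‖ ≤ 2 * Real.exp (2 * K) * ∫ t in (0 : ℝ)..x, ‖g t‖ := by
  have hK_int : Integrable (fun _ : ℝ => K) unitMeasure := integrable_const K
  have hf_int := integrable_unit_of_continuousOn hf.norm
  have hg_int := integrable_unit_of_continuousOn hg.norm
  have h_prim := hasACDeriv_integral hf_int
  have h_sub : Icc 0 x ⊆ Icc (0 : ℝ) 1 := Icc_subset_Icc_right hx.2
  have hc : 0 ≤ ∫ t in (0 : ℝ)..x, ‖g t‖ :=
    intervalIntegral.integral_nonneg hx.1 fun _ _ => norm_nonneg _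
  have h_le := le_of_weighted_bootstrap isCompact_Icc (h_prim.continuousOn.mono h_sub)
    ((continuousOn_expWeight hK_int).mono h_sub)
    (fun y hy => one_le_expWeight (fun _ => hK) hy.1) hc (fun Q hQ hQ_le y hy => ?_) x
    ⟨hx.1, le_rfl⟩
  · have h_weight := expWeight_le hK_int (fun _ => hK) hx
    simp only [integral_const, measureReal_restrict_apply_univ, Real.volume_real_Icc, sub_zero,
      zero_le_one, sup_of_le_left, one_smul] at h_weight
    exact h_le.trans ((mul_le_mul_of_nonneg_left h_weight (by positivity)).trans_eq (by ring))
  · have hy' := h_sub hy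
    have ig := intervalIntegrable_of_integrable_unit hg_int unitInterval.zero_mem hy'
    have iv := intervalIntegrable_of_integrable_unit
      ((integrable_unit_of_continuousOn h_prim.continuousOn).const_mul K)
      unitInterval.zero_mem hy'
    calc ∫ t in (0 : ℝ)..y, ‖f t‖
        ≤ ∫ t in (0 : ℝ)..y, (‖g t‖ + K * ∫ r in (0 : ℝ)..t, ‖f r‖) :=
          intervalIntegral.integral_mono_on hy.1
            (intervalIntegrable_of_integrable_unit hf_int unitInterval.zero_mem hy')
            (ig.add iv) fun t ht => h t ⟨ht.1, ht.2.trans hy'.2⟩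
      _ = (∫ t in (0 : ℝ)..y, ‖g t‖) + ∫ t in (0 : ℝ)..y, K * ∫ r in (0 : ℝ)..t, ‖f r‖ :=
          intervalIntegral.integral_add ig iv
      _ ≤ _ := add_le_add
          (intervalIntegral.integral_mono_interval le_rfl hy.1 hy.2
            (.of_forall fun _ => norm_nonneg _)
            (intervalIntegrable_of_integrable_unit hg_int unitInterval.zero_mem hx))
          (integral_mul_le_of_le_expWeight hK_int (fun _ => hK) hQ hy' iv
            fun t ht => hQ_le t ⟨ht.1, ht.2.trans hy.2⟩)

theorem exists_comparison_bound [NormedSpace ℂ E] [CompleteSpace E] (ι : Type*)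
    {V V' : ℝ → E →L[ℂ] E} (hV : Integrable V unitMeasure) (hV' : Integrable V' unitMeasure)
    {a a' T : E →L[ℂ] E} (hT : T * T = T) (haT : a * T = 0) (haT' : a' * T = 0) :
    ∃ K : ℝ, 0 ≤ K ∧ ∀ (s : Finset ι) (z : ι → ℂ) (c : ι → E) (u u₁ u' u₁' : ι → ℝ → E),
      (∀ i ∈ s, IsRegularSLSolution V a T (z i) (c i) (u i) (u₁ i)) →
      (∀ i ∈ s, IsRegularSLSolution V' a' T (z i) (c i) (u' i) (u₁' i)) →
      ∀ x ∈ Icc (0 : ℝ) 1, ‖∑ i ∈ s, u' i x - ∑ i ∈ s, u i x‖ ≤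
        K * ∫ t in (0 : ℝ)..x, ‖∑ i ∈ s, u i t‖ := by
  obtain ⟨K, hK, h⟩ := exists_transform_bound ι hV hT haT
  obtain ⟨K', hK', h'⟩ := exists_transform_bound ι hV' hT haT'
  refine ⟨(K + K') * (2 * Real.exp (2 * K)), by positivity,
    fun s z c u u₁ u' u₁' hu hu' x hx => ?_⟩
  choose k hk using fun i => IsAlgClosed.exists_pow_nat_eq (z i) two_pos
  simp only [← hk] at hu hu'
  set f := freeWave T s k c
  have hB := h s k c u u₁ hu
  have hB' := h' s k c u' u₁' hu'
  have h_free : ∫ t in (0 : ℝ)..x, ‖f t‖ ≤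
      2 * Real.exp (2 * K) * ∫ t in (0 : ℝ)..x, ‖∑ i ∈ s, u i t‖ := by
    refine integral_norm_le_of_norm_le_add_integral hK (continuous_freeWave T s k c).continuousOn
      (continuousOn_finsetSum _ fun i hi => (hu i hi).continuousOn) (fun y hy => ?_) hx
    exact (norm_le_norm_add_norm_sub _ _).trans (add_le_add_right (hB y hy) _)
  calc ‖∑ i ∈ s, u' i x - ∑ i ∈ s, u i x‖
      = ‖(∑ i ∈ s, u' i x - f x) - (∑ i ∈ s, u i x - f x)‖ := by rw [sub_sub_sub_cancel_right]
    _ ≤ K' * (∫ t in (0 : ℝ)..x, ‖f t‖) + K * ∫ t in (0 : ℝ)..x, ‖f t‖ :=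
        norm_sub_le_of_le (hB' x hx) (hB x hx)
    _ = (K + K') * ∫ t in (0 : ℝ)..x, ‖f t‖ := by ring
    _ ≤ (K + K') * (2 * Real.exp (2 * K) * ∫ t in (0 : ℝ)..x, ‖∑ i ∈ s, u i t‖) := by gcongr
    _ = _ := by ring

end Comparison

section CausalUnitary

open scoped InnerProductSpace

variable {E : Type*} [NormedAddCommGroup E]

theorem integrable_of_mem_Lp_unit (f : Lp E 2 unitMeasure) : Integrable f unitMeasure :=
  (Lp.memLp f).integrable one_le_two

theorem integral_norm_le_norm_Lp_unit (f : Lp E 2 unitMeasure) :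
    ∫ t, ‖f t‖ ∂unitMeasure ≤ ‖f‖ := by
  rw [integral_norm_eq_lintegral_enorm (Lp.aestronglyMeasurable f),
    ← eLpNorm_one_eq_lintegral_enorm, Lp.norm_def]
  refine ENNReal.toReal_mono (Lp.eLpNorm_ne_top _) ?_
  simpa using eLpNorm_le_eLpNorm_mul_rpow_measure_univ one_le_two (Lp.aestronglyMeasurable f)

theorem lipschitzWith_integral_norm_Lp_unit {x : ℝ} (hx : x ∈ Icc (0 : ℝ) 1) :
    LipschitzWith 1 fun f : Lp E 2 unitMeasure => ∫ t in (0 : ℝ)..x, ‖f t‖ := by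
  refine LipschitzWith.of_dist_le_mul fun f g => ?_
  have h_int (f : Lp E 2 unitMeasure) := (integrable_of_mem_Lp_unit f).norm
  have h_sub : Integrable (fun t => ‖f t - g t‖) unitMeasure :=
    ((integrable_of_mem_Lp_unit f).sub (integrable_of_mem_Lp_unit g)).norm
  rw [NNReal.coe_one, one_mul, dist_eq_norm, dist_eq_norm, ← intervalIntegral.integral_sub
    (intervalIntegrable_of_integrable_unit (h_int f) unitInterval.zero_mem hx)
    (intervalIntegrable_of_integrable_unit (h_int g) unitInterval.zero_mem hx)]
  calc ‖∫ t in (0 : ℝ)..x, (‖f t‖ - ‖g t‖)‖ ≤ ∫ t in (0 : ℝ)..x, ‖f t - g t‖ :=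
        intervalIntegral.norm_integral_le_of_norm_le hx.1
          (.of_forall fun t _ => abs_norm_sub_norm_le _ _)
          (intervalIntegrable_of_integrable_unit h_sub unitInterval.zero_mem hx)
    _ ≤ ∫ t, ‖f t - g t‖ ∂unitMeasure :=
        intervalIntegral_le_integral_unit h_sub (fun _ => norm_nonneg _) hx
    _ = ∫ t, ‖(f - g : Lp E 2 unitMeasure) t‖ ∂unitMeasure := by
        refine integral_congr_ae ?_
        filter_upwards [Lp.coeFn_sub f g] with t ht
        rw [ht, Pi.sub_apply]
    _ ≤ ‖f - g‖ := integral_norm_le_norm_Lp_unit _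

theorem integral_norm_eq_zero_of_ae {f : ℝ → E} {x : ℝ} (hx : x ∈ Icc (0 : ℝ) 1)
    (h : ∀ᵐ t ∂unitMeasure, t ≤ x → f t = 0) : ∫ t in (0 : ℝ)..x, ‖f t‖ = 0 := by
  rw [intervalIntegral.integral_of_le hx.1]
  refine integral_eq_zero_of_ae ?_
  filter_upwards [ae_restrict_of_ae_restrict_of_subset
    (Ioc_subset_Icc_self.trans (Icc_subset_Icc_right hx.2)) h,
    ae_restrict_mem measurableSet_Ioc] with t ht ht_mem
  rw [ht ht_mem.2, norm_zero, Pi.zero_apply]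

/-- `W` differs from the identity of `L²([0,1]; E)` by a Volterra-type operator, one that only looks
at the past: `|Wf - f|(x) ≤ K ∫₀ˣ |f|`. -/
def IsCausalPerturbation (K : ℝ) (W : Lp E 2 unitMeasure → Lp E 2 unitMeasure) : Prop :=
  ∀ f : Lp E 2 unitMeasure, ∀ᵐ x ∂unitMeasure, ‖W f x - f x‖ ≤ K * ∫ t in (0 : ℝ)..x, ‖f t‖

theorem isCausalPerturbation_of_denseRange {X : Type*} {A B : X → Lp E 2 unitMeasure}
    (hA : DenseRange A) {W : Lp E 2 unitMeasure → Lp E 2 unitMeasure} (hW : Continuous W)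
    (hWA : ∀ u, W (A u) = B u) {K : ℝ}
    (h : ∀ u, ∀ᵐ x ∂unitMeasure, ‖B u x - A u x‖ ≤ K * ∫ t in (0 : ℝ)..x, ‖A u t‖) :
    IsCausalPerturbation K W := by
  intro f
  obtain ⟨g, hg, hgf⟩ := mem_closure_iff_seq_limit.1 (hA f)
  choose u hu using hg
  have hf : Tendsto (fun n => A (u n)) atTop (𝓝 f) := by simpa only [hu] using hgf
  have hWf : Tendsto (fun n => B (u n)) atTop (𝓝 (W f)) := by
    simpa only [hWA, Function.comp_def] using (hW.tendsto f).comp hf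
  obtain ⟨ns, hns, h_ns⟩ := (tendstoInMeasure_of_tendsto_Lp hf).exists_seq_tendsto_ae
  obtain ⟨ms, hms, h_ms⟩ := (tendstoInMeasure_of_tendsto_Lp
    (hWf.comp hns.tendsto_atTop)).exists_seq_tendsto_ae
  filter_upwards [h_ns, h_ms, ae_all_iff.2 fun n => h (u n), ae_restrict_mem measurableSet_Icc]
    with x hx_ns hx_ms hx_le hx
  have h_integral := ((lipschitzWith_integral_norm_Lp_unit hx).continuous.tendsto f).comp
    (hf.comp (hns.tendsto_atTop.comp hms.tendsto_atTop))
  exact le_of_tendsto_of_tendsto' (hx_ms.sub (hx_ns.comp hms.tendsto_atTop)).norm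
    (h_integral.const_mul K) fun n => hx_le _

theorem IsCausalPerturbation.ae_eq_zero_of_le {K : ℝ}
    {W : Lp E 2 unitMeasure → Lp E 2 unitMeasure} (hW : IsCausalPerturbation K W) {q : ℝ}
    {f : Lp E 2 unitMeasure} (hf : ∀ᵐ t ∂unitMeasure, t ≤ q → f t = 0) :
    ∀ᵐ t ∂unitMeasure, t ≤ q → W f t = 0 := by
  filter_upwards [hW f, hf, ae_restrict_mem measurableSet_Icc] with x hx hfx hx_mem hxq
  rwa [integral_norm_eq_zero_of_ae hx_mem (hf.mono fun t ht htx => ht (htx.trans hxq)), mul_zero,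
    norm_le_zero_iff, hfx hxq, sub_zero] at hx

/-- The restriction of `f ∈ L²` to `S`, extended by zero. -/
noncomputable def cutoff {S : Set ℝ} (hS : MeasurableSet S) (f : Lp E 2 unitMeasure) :
    Lp E 2 unitMeasure :=
  ((Lp.memLp f).indicator hS).toLp _

theorem coeFn_cutoff {S : Set ℝ} (hS : MeasurableSet S) (f : Lp E 2 unitMeasure) :
    cutoff hS f =ᵐ[unitMeasure] S.indicator f :=
  MemLp.coeFn_toLp _

theorem cutoff_add_cutoff_compl {S : Set ℝ} (hS : MeasurableSet S) (f : Lp E 2 unitMeasure) :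
    cutoff hS f + cutoff hS.compl f = f := by
  refine Lp.ext ?_
  filter_upwards [coeFn_cutoff hS f, coeFn_cutoff hS.compl f,
    Lp.coeFn_add (cutoff hS f) (cutoff hS.compl f)] with t ht ht' ht_add
  rw [ht_add, Pi.add_apply, ht, ht', indicator_self_add_compl_apply]

theorem integral_norm_cutoff_Iic_compl (f : Lp E 2 unitMeasure) {q x : ℝ} (hq : 0 ≤ q)
    (hqx : q ≤ x) (hx : x ≤ 1) :
    ∫ t in (0 : ℝ)..x, ‖cutoff (measurableSet_Iic (a := q)).compl f t‖ =
      ∫ t in q..x, ‖f t‖ := by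
  have hq_mem : q ∈ Icc (0 : ℝ) 1 := ⟨hq, hqx.trans hx⟩
  have hx_mem : x ∈ Icc (0 : ℝ) 1 := ⟨hq.trans hqx, hx⟩
  have h_coe := coeFn_cutoff (measurableSet_Iic (a := q)).compl f
  have h_int := (integrable_of_mem_Lp_unit (cutoff (measurableSet_Iic (a := q)).compl f)).norm
  rw [← intervalIntegral.integral_add_adjacent_intervals
    (intervalIntegrable_of_integrable_unit h_int unitInterval.zero_mem hq_mem)
    (intervalIntegrable_of_integrable_unit h_int hq_mem hx_mem),
    integral_norm_eq_zero_of_ae hq_mem, zero_add]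
  · rw [intervalIntegral.integral_of_le hqx, intervalIntegral.integral_of_le hqx]
    refine integral_congr_ae ?_
    filter_upwards [ae_restrict_of_ae_restrict_of_subset
      (Ioc_subset_Icc_self.trans (Icc_subset_Icc hq hx)) h_coe,
      ae_restrict_mem measurableSet_Ioc] with t ht ht_mem
    rw [ht, indicator_of_mem (notMem_Iic.2 ht_mem.1)]
  · filter_upwards [h_coe] with t ht htq
    rw [ht, indicator_of_notMem (notMem_compl_iff.2 (mem_Iic.2 htq))]

theorem nonpos_of_forall_rat_le_integral {g : ℝ → ℝ} (hg : Integrable g unitMeasure) {x K r : ℝ}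
    (hx : 0 < x) (hx1 : x ≤ 1)
    (h : ∀ q : ℚ, (0 : ℝ) ≤ q → (q : ℝ) < x → r ≤ K * ∫ t in (q : ℝ)..x, g t) : r ≤ 0 := by
  have hx_mem : x ∈ Icc (0 : ℝ) 1 := ⟨hx.le, hx1⟩
  obtain ⟨q, -, hqx, hq⟩ := Real.exists_seq_rat_strictMono_tendsto x
  have hq_pos : ∀ᶠ n in atTop, 0 < (q n : ℝ) := hq.eventually (lt_mem_nhds hx)
  have h_within : Tendsto (fun n => (q n : ℝ)) atTop (𝓝[Icc 0 1] x) :=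
    tendsto_nhdsWithin_iff.2 ⟨hq, hq_pos.mono fun n hn => ⟨hn.le, (hqx n).le.trans hx1⟩⟩
  have h_lim := ((((hasACDeriv_integral hg).continuousOn x hx_mem).tendsto.comp
    h_within).const_sub (∫ t in (0 : ℝ)..x, g t)).const_mul K
  rw [sub_self, mul_zero] at h_lim
  refine ge_of_tendsto h_lim (hq_pos.mono fun n hn => (h (q n) hn.le (hqx n)).trans_eq ?_)
  have hq_mem : (q n : ℝ) ∈ Icc (0 : ℝ) 1 := ⟨hn.le, (hqx n).le.trans hx1⟩
  rw [(hasACDeriv_integral hg).integral_eq_sub hq_mem hx_mem, Function.comp_apply]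

variable [InnerProductSpace ℂ E]

theorem inner_cutoff_right {S : Set ℝ} (hS : MeasurableSet S) (f : Lp E 2 unitMeasure) :
    ⟪f, cutoff hS f⟫_ℂ = ⟪cutoff hS f, cutoff hS f⟫_ℂ := by
  rw [L2.inner_def, L2.inner_def]
  refine integral_congr_ae ?_
  filter_upwards [coeFn_cutoff hS f] with t ht
  rw [ht]
  by_cases h : t ∈ S <;> simp [h]

variable {W W' : Lp E 2 unitMeasure →ₗ[ℂ] Lp E 2 unitMeasure} {K K' : ℝ}

theorem ae_eq_zero_of_lt_of_adjoint_causal (hadj : ∀ f g, ⟪W f, g⟫_ℂ = ⟪f, W' g⟫_ℂ)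
    (hW' : IsCausalPerturbation K' W') {q : ℝ} {f : Lp E 2 unitMeasure}
    (hf : ∀ᵐ t ∂unitMeasure, q < t → f t = 0) :
    ∀ᵐ t ∂unitMeasure, q < t → W f t = 0 := by
  have hS := (measurableSet_Iic (a := q)).compl
  have h_coe := coeFn_cutoff hS (W f)
  have h_past : ∀ᵐ t ∂unitMeasure, t ≤ q → W' (cutoff hS (W f)) t = 0 :=
    hW'.ae_eq_zero_of_le (h_coe.mono fun t ht htq => by
      rw [ht, indicator_of_notMem (notMem_compl_iff.2 (mem_Iic.2 htq))])
  have h_zero : cutoff hS (W f) = 0 := by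
    rw [← inner_self_eq_zero (𝕜 := ℂ), ← inner_cutoff_right, hadj, L2.inner_def]
    refine integral_eq_zero_of_ae ?_
    filter_upwards [h_past, hf] with t ht ht'
    rcases le_or_gt t q with h | h
    · rw [ht h, inner_zero_right, Pi.zero_apply]
    · rw [ht' h, inner_zero_left, Pi.zero_apply]
  rw [h_zero] at h_coe
  filter_upwards [h_coe, Lp.coeFn_zero E 2 unitMeasure] with t ht ht0 htq
  rwa [ht0, indicator_of_mem (notMem_Iic.2 htq), eq_comm] at ht

theorem ae_norm_sub_le_integral_of_adjoint_causal (hadj : ∀ f g, ⟪W f, g⟫_ℂ = ⟪f, W' g⟫_ℂ)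
    (hW : IsCausalPerturbation K W) (hW' : IsCausalPerturbation K' W') (f : Lp E 2 unitMeasure)
    {q : ℝ} (hq : 0 ≤ q) :
    ∀ᵐ x ∂unitMeasure, q < x → ‖W f x - f x‖ ≤ K * ∫ t in q..x, ‖f t‖ := by
  have hS := measurableSet_Iic (a := q)
  -- `W` is the adjoint of a causal operator, so the part of `f` before `q` does not affect `W f`
  -- after `q`.
  have h_past : ∀ᵐ t ∂unitMeasure, q < t → W (cutoff hS f) t = 0 :=
    ae_eq_zero_of_lt_of_adjoint_causal hadj hW' ((coeFn_cutoff hS f).mono fun t ht htq => by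
      rw [ht, indicator_of_notMem (notMem_Iic.2 htq)])
  filter_upwards [h_past, coeFn_cutoff hS.compl f, hW (cutoff hS.compl f),
    Lp.coeFn_add (W (cutoff hS f)) (W (cutoff hS.compl f)), ae_restrict_mem measurableSet_Icc]
    with x hx_past hx_coe hx_le hx_add hx_mem hqx
  have hfx : cutoff hS.compl f x = f x := by
    rw [hx_coe, indicator_of_mem (notMem_Iic.2 hqx)]
  rwa [integral_norm_cutoff_Iic_compl f hq hqx.le hx_mem.2, hfx,
    ← zero_add (W (cutoff hS.compl f) x), ← hx_past hqx, ← Pi.add_apply, ← hx_add, ← map_add,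
    cutoff_add_cutoff_compl] at hx_le

theorem eq_self_of_causal_adjoint (hadj : ∀ f g, ⟪W f, g⟫_ℂ = ⟪f, W' g⟫_ℂ)
    (hW : IsCausalPerturbation K W) (hW' : IsCausalPerturbation K' W')
    (f : Lp E 2 unitMeasure) : W f = f := by
  have h_local : ∀ q : ℚ, ∀ᵐ x ∂unitMeasure, (0 : ℝ) ≤ q → (q : ℝ) < x →
      ‖W f x - f x‖ ≤ K * ∫ t in (q : ℝ)..x, ‖f t‖ := fun q => by
    by_cases hq : (0 : ℝ) ≤ q
    · exact (ae_norm_sub_le_integral_of_adjoint_causal hadj hW hW' f hq).mono fun x hx _ => hx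
    · exact .of_forall fun x h => absurd h hq
  refine Lp.ext ?_
  filter_upwards [ae_all_iff.2 h_local, ae_restrict_mem measurableSet_Icc,
    ae_restrict_of_ae (Measure.ae_ne volume (0 : ℝ))] with x hx hx_mem hx0
  exact sub_eq_zero.1 (norm_le_zero_iff.1 (nonpos_of_forall_rat_le_integral
    (integrable_of_mem_Lp_unit f).norm (hx_mem.1.lt_of_ne' hx0) hx_mem.2 hx))

end CausalUnitary

section BoundaryConditions

open scoped InnerProductSpace

theorem mul_eq_zero_of_compress_eq {R : Type*} [Ring R] {T a : R} (hT : T * T = T)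
    (ha : (1 - T) * a * (1 - T) = a) : a * T = 0 := by
  rw [← ha, mul_assoc, IsIdempotentElem.one_sub_mul_self hT, mul_zero]

theorem idempotent_mul_eq_zero_of_compress_eq {R : Type*} [Ring R] {T a : R} (hT : T * T = T)
    (ha : (1 - T) * a * (1 - T) = a) : T * a = 0 := by
  rw [← ha, ← mul_assoc, ← mul_assoc, IsIdempotentElem.mul_one_sub_self hT, zero_mul, zero_mul]

variable {E : Type*} [NormedAddCommGroup E] [InnerProductSpace ℂ E]

section IsSLParam

variable {Tm Tp : E →L[ℂ] E} {V : ℝ → E →L[ℂ] E} {a b : E →L[ℂ] E}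

theorem IsSLParam.a_mul_eq_zero [CompleteSpace E] (h : IsSLParam Tm Tp V a b)
    (hTm : Tm * Tm = Tm) : a * Tm = 0 :=
  mul_eq_zero_of_compress_eq hTm h.a_compress

theorem IsSLParam.mul_a_eq_zero [CompleteSpace E] (h : IsSLParam Tm Tp V a b)
    (hTm : Tm * Tm = Tm) : Tm * a = 0 :=
  idempotent_mul_eq_zero_of_compress_eq hTm h.a_compress

theorem IsSLParam.mul_b_eq_zero [CompleteSpace E] (h : IsSLParam Tm Tp V a b)
    (hTp : Tp * Tp = Tp) : Tp * b = 0 :=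
  idempotent_mul_eq_zero_of_compress_eq hTp h.b_compress

end IsSLParam

theorem bdryMinus_eq_iff {M : Type*} [AddCommGroup M] [Module (E →L[ℂ] E) M] {T a : E →L[ℂ] E}
    (hT : T * T = T) (hTa : T * a = 0) (p q : M) {e : M} (he : T • e = 0) :
    bdryMinus T a p q = e ↔ T • p = 0 ∧ q - T • q = a • p + e := by
  have h_eq : bdryMinus T a p q = q - T • q - a • p - T • p := by
    rw [bdryMinus, sub_smul, one_smul, smul_sub, smul_smul, hTa, zero_smul, sub_zero,
      sub_right_comm q]
  rw [h_eq]
  constructor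
  · intro h
    have hp := congrArg (T • ·) h
    simp only [smul_sub, smul_smul, hT, hTa, zero_smul, sub_self, zero_sub, he,
      neg_eq_zero] at hp
    rw [hp, sub_zero, sub_eq_iff_eq_add'] at h
    exact ⟨hp, h⟩
  · rintro ⟨hp, hq⟩
    rw [hp, hq, sub_zero, add_sub_cancel_left]

theorem bdryMinus_eq_zero_iff {M : Type*} [AddCommGroup M] [Module (E →L[ℂ] E) M]
    {T a : E →L[ℂ] E} (hT : T * T = T) (hTa : T * a = 0) (p q : M) :
    bdryMinus T a p q = 0 ↔ T • p = 0 ∧ q - T • q = a • p := by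
  rw [bdryMinus_eq_iff hT hTa p q (smul_zero T), add_zero]

theorem bdryPlus_eq_iff {M : Type*} [AddCommGroup M] [Module (E →L[ℂ] E) M] {T b : E →L[ℂ] E}
    (hT : T * T = T) (hTb : T * b = 0) (p q : M) {e : M} (he : T • e = 0) :
    bdryPlus T b p q = e ↔ T • p = 0 ∧ q - T • q = -(b • p) + e := by
  have h_neg : bdryPlus T b p q = bdryMinus T (-b) p q := by
    rw [bdryPlus, bdryMinus, neg_smul, sub_neg_eq_add]
  rw [h_neg, bdryMinus_eq_iff hT (by rw [mul_neg, hTb, neg_zero]) p q he, neg_smul]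

variable [CompleteSpace E]

theorem inner_sub_inner_of_bdry {T α : E →L[ℂ] E} (hT : IsSelfAdjoint T) (hα : IsSelfAdjoint α)
    {u u' v v' e : E} (hu : T u = 0) (hu' : u' - T u' = α u + e) (hv : T v = 0)
    (hv' : v' - T v' = α v) : ⟪u, v'⟫_ℂ - ⟪u', v⟫_ℂ = -⟪e, v⟫_ℂ := by
  have hT_symm : ∀ x y, ⟪T x, y⟫_ℂ = ⟪x, T y⟫_ℂ := hT.isSymmetric
  have hα_symm : ⟪α u, v⟫_ℂ = ⟪u, α v⟫_ℂ := hα.isSymmetric u v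
  have h_left : ⟪u, T v'⟫_ℂ = 0 := by rw [← hT_symm, hu, inner_zero_left]
  have h_right : ⟪T u', v⟫_ℂ = 0 := by rw [hT_symm, hv, inner_zero_right]
  rw [sub_eq_iff_eq_add'] at hu' hv'
  rw [hv', hu', inner_add_right, inner_add_left, inner_add_left, h_left, h_right,
    hα_symm]
  ring

theorem integral_unit_eq_intervalIntegral {M : Type*} [NormedAddCommGroup M] [NormedSpace ℝ M]
    (f : ℝ → M) : ∫ x, f x ∂unitMeasure = ∫ x in (0 : ℝ)..1, f x := by
  rw [intervalIntegral.integral_of_le zero_le_one, integral_Icc_eq_integral_Ioc]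

theorem HasACDerivs.green {u u₁ u₂ v v₁ v₂ : ℝ → E} (hu : HasACDerivs u u₁ u₂)
    (hv : HasACDerivs v v₁ v₂) :
    ∫ x, (⟪u x, v₂ x⟫_ℂ - ⟪u₂ x, v x⟫_ℂ) ∂unitMeasure =
      (⟪u 1, v₁ 1⟫_ℂ - ⟪u₁ 1, v 1⟫_ℂ) - (⟪u 0, v₁ 0⟫_ℂ - ⟪u₁ 0, v 0⟫_ℂ) := by
  let B : E →L[ℝ] E →L[ℝ] ℂ :=
    (isBoundedBilinearMap_inner (𝕜 := ℂ) (E := E)).toContinuousLinearMap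
  have h_wronskian : HasACDeriv (fun x => B (u x) (v₁ x) - B (u₁ x) (v x))
      (fun x => B (u x) (v₂ x) - B (u₂ x) (v x)) :=
    ((hu.hasACDeriv.bilinear_apply hv.hasACDeriv_deriv B).sub
      (hu.hasACDeriv_deriv.bilinear_apply hv.hasACDeriv B)).congr_deriv
      (.of_forall fun x => by ring)
  rw [integral_unit_eq_intervalIntegral]
  exact h_wronskian.integral_eq_sub unitInterval.zero_mem unitInterval.one_mem

variable {Tm Tp : E →L[ℂ] E} {V : ℝ → E →L[ℂ] E} {a b : E →L[ℂ] E}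

theorem IsSLParam.green (h : IsSLParam Tm Tp V a b) (hTm : IsStarProjection Tm)
    (hTp : IsStarProjection Tp) {u u₁ u₂ v v₁ v₂ f g : ℝ → E} {e : E}
    (hu : HasACDerivs u u₁ u₂) (hv : HasACDerivs v v₁ v₂)
    (huf : ∀ᵐ x ∂unitMeasure, -u₂ x + V x (u x) = f x)
    (hvg : ∀ᵐ x ∂unitMeasure, -v₂ x + V x (v x) = g x)
    (hu0 : bdryMinus Tm a (u 0) (u₁ 0) = 0) (hv0 : bdryMinus Tm a (v 0) (v₁ 0) = 0)
    (he : Tp e = 0)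
    (hu1 : bdryPlus Tp b (u 1) (u₁ 1) = e) (hv1 : bdryPlus Tp b (v 1) (v₁ 1) = 0) :
    ∫ x, (⟪f x, v x⟫_ℂ - ⟪u x, g x⟫_ℂ) ∂unitMeasure = -⟪e, v 1⟫_ℂ := by
  have hTm_mul := hTm.isIdempotentElem
  have hTp_mul := hTp.isIdempotentElem
  rw [bdryMinus_eq_zero_iff hTm_mul (h.mul_a_eq_zero hTm_mul)] at hu0 hv0
  rw [bdryPlus_eq_iff hTp_mul (h.mul_b_eq_zero hTp_mul) _ _ he] at hu1
  rw [bdryPlus_eq_iff hTp_mul (h.mul_b_eq_zero hTp_mul) _ _ (map_zero _), add_zero] at hv1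
  have h_left := inner_sub_inner_of_bdry hTm.isSelfAdjoint h.a_selfAdjoint hu0.1
    (hu0.2.trans (add_zero _).symm) hv0.1 hv0.2
  have h_right := inner_sub_inner_of_bdry hTp.isSelfAdjoint h.b_selfAdjoint.neg hu1.1 hu1.2
    hv1.1 hv1.2
  have h_green := hu.green hv
  rw [h_left, h_right, inner_zero_left, neg_zero, sub_zero] at h_green
  rw [← h_green]
  refine integral_congr_ae ?_
  filter_upwards [huf, hvg, h.selfAdjoint] with x hx hx' hVx
  have h_symm : ⟪V x (u x), v x⟫_ℂ = ⟪u x, V x (v x)⟫_ℂ := hVx.isSymmetric (u x) (v x)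
  rw [← hx, ← hx']
  simp only [inner_add_left, inner_add_right, inner_neg_left, inner_neg_right, h_symm]
  ring

end BoundaryConditions

section FundamentalSolution

theorem memLp_unit_of_continuousOn {M : Type*} [NormedAddCommGroup M] {f : ℝ → M}
    (hf : ContinuousOn f (Icc 0 1)) : MemLp f 2 unitMeasure := by
  obtain ⟨B, hB⟩ := isCompact_Icc.exists_bound_of_continuousOn hf
  exact MemLp.of_bound (integrable_unit_of_continuousOn hf).aestronglyMeasurable B
    ((ae_restrict_mem measurableSet_Icc).mono hB)

theorem HasACDerivs.deriv_eq_zero {M : Type*} [NormedAddCommGroup M] [NormedSpace ℝ M]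
    {u u₁ u₂ : ℝ → M} (hu : HasACDerivs u u₁ u₂) (h : ∀ x ∈ Icc (0 : ℝ) 1, u x = 0)
    {x : ℝ} (hx : x ∈ Icc (0 : ℝ) 1) : u₁ x = 0 :=
  (uniqueDiffOn_Icc zero_lt_one x hx).eq_deriv _ (hu.hasDeriv x hx)
    ((hasDerivWithinAt_const x _ (0 : M)).congr h (h x hx))

theorem HasACDerivs.eq_zero_of_ae {M : Type*} [NormedAddCommGroup M] [NormedSpace ℝ M]
    {u u₁ u₂ : ℝ → M} (hu : HasACDerivs u u₁ u₂) (h : u =ᵐ[unitMeasure] 0) {x : ℝ}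
    (hx : x ∈ Icc (0 : ℝ) 1) : u x = 0 ∧ u₁ x = 0 := by
  have h_eqOn : EqOn u 0 (Icc 0 1) :=
    Measure.eqOn_Icc_of_ae_eq volume zero_ne_one h hu.continuousOn continuousOn_const
  exact ⟨h_eqOn hx, hu.deriv_eq_zero h_eqOn hx⟩

theorem integrable_restrictScalars_sub_smul_one {E : Type*} [NormedAddCommGroup E]
    [NormedSpace ℂ E] {V : ℝ → E →L[ℂ] E} (hV : Integrable V unitMeasure) (z : ℂ) :
    Integrable (fun x => (V x - z • (1 : E →L[ℂ] E)).restrictScalars ℝ) unitMeasure :=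
  (ContinuousLinearMap.restrictScalarsL ℂ E E ℝ ℝ).integrable_comp
    (hV.sub (integrable_const (z • (1 : E →L[ℂ] E))))

section InitialValueProblem

variable {E : Type*} [NormedAddCommGroup E] [NormedSpace ℂ E] {V : ℝ → E →L[ℂ] E} {z : ℂ}
  {u u₁ v v₁ : ℝ → E}

theorem IsSLSolution.sub (hu : IsSLSolution V z u u₁) (hv : IsSLSolution V z v v₁) :
    IsSLSolution V z (fun x => u x - v x) (fun x => u₁ x - v₁ x) := by
  obtain ⟨u₂, hu, hu_eq⟩ := hu
  obtain ⟨v₂, hv, hv_eq⟩ := hv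
  refine ⟨_, hu.sub hv, ?_⟩
  filter_upwards [hu_eq, hv_eq] with x hux hvx
  rw [smul_sub, ← hux, ← hvx, map_sub]
  abel

variable [CompleteSpace E]

theorem IsSLSolution.eq_zero_of_initial (hV : Integrable V unitMeasure)
    (hu : IsSLSolution V z u u₁) (h0 : u 0 = 0) (h1 : u₁ 0 = 0) {x : ℝ}
    (hx : x ∈ Icc (0 : ℝ) 1) : u x = 0 ∧ u₁ x = 0 := by
  obtain ⟨u₂, hu, hu_eq⟩ := hu
  refine hu.eq_zero_of_initial (integrable_restrictScalars_sub_smul_one hV z) ?_ h0 h1 hx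
  filter_upwards [hu_eq] with x hx
  change u₂ x = V x (u x) - z • u x
  rw [← hx]
  abel

theorem IsSLSolution.eq_of_initial (hV : Integrable V unitMeasure)
    (hu : IsSLSolution V z u u₁) (hv : IsSLSolution V z v v₁) (h0 : u 0 = v 0)
    (h1 : u₁ 0 = v₁ 0) {x : ℝ} (hx : x ∈ Icc (0 : ℝ) 1) : u x = v x ∧ u₁ x = v₁ x := by
  have h_sub := (hu.sub hv).eq_zero_of_initial hV (sub_eq_zero.2 h0) (sub_eq_zero.2 h1) hx
  exact ⟨sub_eq_zero.1 h_sub.1, sub_eq_zero.1 h_sub.2⟩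

end InitialValueProblem

variable {E : Type*} [NormedAddCommGroup E] [InnerProductSpace ℂ E]
  {Tm Tp : E →L[ℂ] E} {V : ℝ → E →L[ℂ] E} {a b : E →L[ℂ] E}

theorem eq_and_eq_of_bdryMinus_eq_zero (hTm : Tm * Tm = Tm) (haT : a * Tm = 0)
    (hTa : Tm * a = 0) {p q : E} (h : bdryMinus Tm a p q = 0) :
    p = bdryMinusPerp Tm p q - Tm (bdryMinusPerp Tm p q) ∧
      q = Tm (bdryMinusPerp Tm p q) + a (bdryMinusPerp Tm p q) := by
  obtain ⟨hp, hq⟩ := (bdryMinus_eq_zero_iff hTm hTa p q).1 h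
  have hTT : Tm (Tm q) = Tm q := DFunLike.congr_fun hTm q
  have haTq : a (Tm q) = 0 := DFunLike.congr_fun haT q
  have h_perp : bdryMinusPerp Tm p q = p + Tm q := by
    rw [bdryMinusPerp, sub_smul, one_smul, hp, sub_zero]
    rfl
  have hTp : Tm p = 0 := hp
  have hq' : q - Tm q = a p := hq
  rw [h_perp, map_add, map_add, hTp, hTT, haTq, zero_add, add_zero, ← hq']
  exact ⟨(add_sub_cancel_right _ _).symm, (add_sub_cancel _ _).symm⟩

theorem IsRegularSLSolution.bdryMinus_eq_zero {z : ℂ} {u u₁ : ℝ → E} {c : E} (hTm : Tm * Tm = Tm)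
    (haT : a * Tm = 0) (hTa : Tm * a = 0) (hu : IsRegularSLSolution V a Tm z c u u₁) :
    bdryMinus Tm a (u 0) (u₁ 0) = 0 := by
  have hTT : Tm (Tm c) = Tm c := DFunLike.congr_fun hTm c
  have haTc : a (Tm c) = 0 := DFunLike.congr_fun haT c
  have hTac : Tm (a c) = 0 := DFunLike.congr_fun hTa c
  rw [hu.apply_zero, hu.deriv_zero, bdryMinus_eq_zero_iff hTm hTa]
  change Tm (c - Tm c) = 0 ∧ Tm c + a c - Tm (Tm c + a c) = a (c - Tm c)
  rw [map_sub, map_add, map_sub, hTT, haTc, hTac]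
  exact ⟨sub_self _, by abel⟩

theorem IsSLSolution.isRegularSLSolution {z : ℂ} {u u₁ : ℝ → E} (hTm : Tm * Tm = Tm)
    (haT : a * Tm = 0) (hTa : Tm * a = 0) (hu : IsSLSolution V z u u₁)
    (hu0 : bdryMinus Tm a (u 0) (u₁ 0) = 0) :
    IsRegularSLSolution V a Tm z (bdryMinusPerp Tm (u 0) (u₁ 0)) u u₁ :=
  have h_initial := eq_and_eq_of_bdryMinus_eq_zero hTm haT hTa hu0
  ⟨hu, h_initial.1, h_initial.2⟩

theorem IsRegularSLSolution.eq_of_isRegularSLSolution [CompleteSpace E]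
    (hV : Integrable V unitMeasure) {T : E →L[ℂ] E} {z : ℂ} {c : E} {u u₁ v v₁ : ℝ → E}
    (hu : IsRegularSLSolution V a T z c u u₁) (hv : IsRegularSLSolution V a T z c v v₁) {x : ℝ}
    (hx : x ∈ Icc (0 : ℝ) 1) : u x = v x ∧ u₁ x = v₁ x :=
  hu.isSLSolution.eq_of_initial hV hv.isSLSolution (hu.apply_zero.trans hv.apply_zero.symm)
    (hu.deriv_zero.trans hv.deriv_zero.symm) hx

section

variable {z : ℂ} {F F₁ : ℝ → E →L[ℂ] E}

theorem IsFundMinus.bdryMinus_apply (hF : IsFundMinus Tm V a z F F₁) (c : E) :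
    bdryMinus Tm a (F 0 c) (F₁ 0 c) = 0 := by
  obtain ⟨F₂, -, -, h, -⟩ := hF
  exact DFunLike.congr_fun h c

theorem IsFundMinus.bdryMinusPerp_apply (hF : IsFundMinus Tm V a z F F₁) (c : E) :
    bdryMinusPerp Tm (F 0 c) (F₁ 0 c) = c := by
  obtain ⟨F₂, -, -, -, h⟩ := hF
  exact DFunLike.congr_fun h c

theorem bdryPlus_apply (A B : E →L[ℂ] E) (c : E) :
    bdryPlus Tp b (A c) (B c) = bdryPlus Tp b A B c := rfl

variable [CompleteSpace E]

theorem IsFundMinus.isSLSolution_apply (hF : IsFundMinus Tm V a z F F₁) (c : E) :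
    IsSLSolution V z (fun x => F x c) (fun x => F₁ x c) := by
  obtain ⟨F₂, hF, hF_eq, -⟩ := hF
  refine ⟨fun x => F₂ x c,
    hF.clm_comp ((ContinuousLinearMap.apply ℂ E c).restrictScalars ℝ), ?_⟩
  filter_upwards [hF_eq] with x hx using DFunLike.congr_fun hx c

theorem IsFundMinus.isRegularSLSolution_apply (hTm : Tm * Tm = Tm) (haT : a * Tm = 0)
    (hTa : Tm * a = 0) (hF : IsFundMinus Tm V a z F F₁) (c : E) :
    IsRegularSLSolution V a Tm z c (fun x => F x c) (fun x => F₁ x c) := by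
  simpa only [hF.bdryMinusPerp_apply] using
    (hF.isSLSolution_apply c).isRegularSLSolution hTm haT hTa (hF.bdryMinus_apply c)

theorem IsFundMinus.eq_apply (hV : Integrable V unitMeasure) (hTm : Tm * Tm = Tm)
    (haT : a * Tm = 0) (hTa : Tm * a = 0) (hF : IsFundMinus Tm V a z F F₁) {u u₁ : ℝ → E} {c : E}
    (hu : IsRegularSLSolution V a Tm z c u u₁) {x : ℝ} (hx : x ∈ Icc (0 : ℝ) 1) :
    u x = F x c ∧ u₁ x = F₁ x c :=
  hu.eq_of_isRegularSLSolution hV (hF.isRegularSLSolution_apply hTm haT hTa c) hx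

theorem IsFundMinus.eq_zero_of_apply_ae_eq_zero (hF : IsFundMinus Tm V a z F F₁) {c : E}
    (h : (fun x => F x c) =ᵐ[unitMeasure] 0) : c = 0 := by
  obtain ⟨_, hFc, -⟩ := hF.isSLSolution_apply c
  obtain ⟨h0, h1⟩ := hFc.eq_zero_of_ae h unitInterval.zero_mem
  rw [← hF.bdryMinusPerp_apply c, h0, h1, bdryMinusPerp, smul_zero, smul_zero, add_zero]

theorem exists_isFundMinus (hV : Integrable V unitMeasure) (hTm : Tm * Tm = Tm)
    (haT : a * Tm = 0) (hTa : Tm * a = 0) (z : ℂ) : ∃ F F₁, IsFundMinus Tm V a z F F₁ := by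
  let Q (x : ℝ) : (E →L[ℂ] E) →L[ℝ] (E →L[ℂ] E) :=
    (ContinuousLinearMap.mul ℂ (E →L[ℂ] E) (V x - z • (1 : E →L[ℂ] E))).restrictScalars ℝ
  have hQ : Integrable Q unitMeasure :=
    (ContinuousLinearMap.restrictScalarsL ℂ (E →L[ℂ] E) (E →L[ℂ] E) ℝ ℝ).integrable_comp
      ((ContinuousLinearMap.mul ℂ (E →L[ℂ] E)).integrable_comp
        (hV.sub (integrable_const (z • (1 : E →L[ℂ] E)))))
  obtain ⟨F, F₁, hF, h0, h1⟩ := exists_hasACDerivs hQ (integrable_zero _ _ _) (1 - Tm) (Tm + a)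
  refine ⟨F, F₁, _, hF, .of_forall fun x => ?_, ?_, ?_⟩
  · have h_apply : Q x (F x) = V x * F x - z • F x := by
      change (V x - z • (1 : E →L[ℂ] E)) * F x = _
      rw [sub_mul, smul_mul_assoc, one_mul]
    rw [h_apply, Pi.zero_apply, add_zero, neg_sub, sub_add_cancel]
  · rw [h0, h1, bdryMinus_eq_zero_iff hTm hTa]
    simp only [smul_eq_mul, mul_sub, mul_add, mul_one, hTm, hTa, haT]
    exact ⟨sub_self _, by abel⟩
  · rw [h0, h1]
    simp only [bdryMinusPerp, smul_eq_mul, mul_sub, sub_mul, mul_add, one_mul, mul_one, hTm, hTa]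
    abel

end

theorem IsFundMinus.isSLEigenvalue_iff [CompleteSpace E] {lam : ℝ} {F F₁ : ℝ → E →L[ℂ] E}
    (hV : Integrable V unitMeasure) (hTm : Tm * Tm = Tm) (haT : a * Tm = 0) (hTa : Tm * a = 0)
    (hF : IsFundMinus Tm V a (lam : ℂ) F F₁) :
    IsSLEigenvalue Tm Tp V a b lam ↔ ∃ c : E, c ≠ 0 ∧ bdryPlus Tp b (F 1) (F₁ 1) c = 0 := by
  constructor
  · rintro ⟨ψ, hψ, ψ₁, ψ₂, hψ_deriv, hψ0, hψ1, -, hψ_eq⟩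
    have h_sol : IsSLSolution V lam ψ ψ₁ := ⟨ψ₂, hψ_deriv, hψ_eq.mono fun x hx => hx.symm⟩
    have h_apply {x : ℝ} (hx : x ∈ Icc (0 : ℝ) 1) :=
      hF.eq_apply hV hTm haT hTa (h_sol.isRegularSLSolution hTm haT hTa hψ0) hx
    refine ⟨bdryMinusPerp Tm (ψ 0) (ψ₁ 0), fun h0 => hψ ?_, ?_⟩
    · filter_upwards [ae_restrict_mem measurableSet_Icc] with x hx
      rw [(h_apply hx).1, h0, map_zero, Pi.zero_apply]
    · rw [← bdryPlus_apply, ← (h_apply unitInterval.one_mem).1,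
        ← (h_apply unitInterval.one_mem).2, hψ1]
  · rintro ⟨c, hc, h⟩
    obtain ⟨u₂, hu, hu_eq⟩ := hF.isSLSolution_apply c
    exact ⟨fun x => F x c, fun h0 => hc (hF.eq_zero_of_apply_ae_eq_zero h0), fun x => F₁ x c, u₂,
      hu, hF.bdryMinus_apply c, h, memLp_unit_of_continuousOn (hu.continuousOn.const_smul _),
      hu_eq.mono fun x hx => hx.symm⟩

end FundamentalSolution

section SquareIntegrable

open scoped InnerProductSpace

/-- The class in `L²` of a function that is continuous on `[0,1]`. -/
noncomputable def toL2Unit {M : Type*} [NormedAddCommGroup M] {f : ℝ → M}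
    (hf : ContinuousOn f (Icc 0 1)) : Lp M 2 unitMeasure :=
  (memLp_unit_of_continuousOn hf).toLp f

theorem coeFn_toL2Unit {M : Type*} [NormedAddCommGroup M] {f : ℝ → M}
    (hf : ContinuousOn f (Icc 0 1)) : toL2Unit hf =ᵐ[unitMeasure] f :=
  MemLp.coeFn_toLp _

theorem norm_Lp_unit_le_of_ae_bound {M : Type*} [NormedAddCommGroup M] {f : Lp M 2 unitMeasure}
    {C : ℝ} (hC : 0 ≤ C) (h : ∀ᵐ x ∂unitMeasure, ‖f x‖ ≤ C) : ‖f‖ ≤ C := by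
  refine (Lp.norm_le_of_ae_bound hC h).trans ?_
  simp [measureUnivNNReal]

theorem countable_of_pairwise_inner_eq_zero (𝕜 : Type*) [RCLike 𝕜] {H ι : Type*}
    [NormedAddCommGroup H] [InnerProductSpace 𝕜 H] [TopologicalSpace.SeparableSpace H] {φ : ι → H}
    (h0 : ∀ i, φ i ≠ 0) (h : Pairwise fun i j => inner 𝕜 (φ i) (φ j) = 0) : Countable ι := by
  refine Pairwise.countable_of_isOpen_disjoint (s := fun i => Metric.ball (φ i) (‖φ i‖ / 2))
    (fun i j hij => Metric.ball_disjoint_ball ?_) (fun i => Metric.isOpen_ball)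
    (fun i => ⟨φ i, Metric.mem_ball_self (half_pos (norm_pos_iff.2 (h0 i)))⟩)
  have h_pythagoras : ‖φ i - φ j‖ * ‖φ i - φ j‖ = ‖φ i‖ * ‖φ i‖ + ‖φ j‖ * ‖φ j‖ := by
    have h_add := norm_add_sq_eq_norm_sq_add_norm_sq_of_inner_eq_zero (𝕜 := 𝕜) (φ i) (-φ j)
      (by rw [inner_neg_right, h hij, neg_zero])
    rwa [← sub_eq_add_neg, norm_neg] at h_add
  rw [dist_eq_norm]
  nlinarith [norm_nonneg (φ i), norm_nonneg (φ j), norm_nonneg (φ i - φ j),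
    sq_nonneg (‖φ i‖ - ‖φ j‖)]

variable {E : Type*} [NormedAddCommGroup E] [InnerProductSpace ℂ E]

theorem inner_toL2Unit_left {f : ℝ → E} (hf : ContinuousOn f (Icc 0 1))
    (g : Lp E 2 unitMeasure) : ⟪toL2Unit hf, g⟫_ℂ = ∫ x, ⟪f x, g x⟫_ℂ ∂unitMeasure := by
  rw [L2.inner_def]
  exact integral_congr_ae ((coeFn_toL2Unit hf).mono fun x hx => by simp only [hx])

theorem inner_toL2Unit_toL2Unit {f g : ℝ → E} (hf : ContinuousOn f (Icc 0 1))
    (hg : ContinuousOn g (Icc 0 1)) :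
    ⟪toL2Unit hf, toL2Unit hg⟫_ℂ = ∫ x, ⟪f x, g x⟫_ℂ ∂unitMeasure := by
  rw [inner_toL2Unit_left]
  exact integral_congr_ae ((coeFn_toL2Unit hg).mono fun x hx => by simp only [hx])

end SquareIntegrable

section Inhomogeneous

variable {E : Type*} [NormedAddCommGroup E] [NormedSpace ℂ E] {V : ℝ → E →L[ℂ] E} {z : ℂ}

/-- `ψ` solves the inhomogeneous equation `-ψ'' + V ψ = z ψ + f` on `[0,1]`, with derivative
`ψ₁`. -/
def IsInhomSLSolution (V : ℝ → E →L[ℂ] E) (z : ℂ) (f ψ ψ₁ : ℝ → E) : Prop :=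
  ∃ ψ₂ : ℝ → E, HasACDerivs ψ ψ₁ ψ₂ ∧
    ∀ᵐ x ∂unitMeasure, -ψ₂ x + V x (ψ x) = z • ψ x + f x

variable {f g ψ ψ₁ φ φ₁ : ℝ → E}

theorem IsInhomSLSolution.congr (h : IsInhomSLSolution V z f ψ ψ₁) (hfg : f =ᵐ[unitMeasure] g) :
    IsInhomSLSolution V z g ψ ψ₁ := by
  obtain ⟨ψ₂, hψ, hψ_eq⟩ := h
  refine ⟨ψ₂, hψ, ?_⟩
  filter_upwards [hψ_eq, hfg] with x hx hfx
  rw [hx, hfx]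

theorem IsInhomSLSolution.add (h : IsInhomSLSolution V z f ψ ψ₁)
    (h' : IsInhomSLSolution V z g φ φ₁) :
    IsInhomSLSolution V z (fun x => f x + g x) (fun x => ψ x + φ x) (fun x => ψ₁ x + φ₁ x) := by
  obtain ⟨ψ₂, hψ, hψ_eq⟩ := h
  obtain ⟨φ₂, hφ, hφ_eq⟩ := h'
  refine ⟨_, hψ.add hφ, ?_⟩
  filter_upwards [hψ_eq, hφ_eq] with x hx hx'
  rw [map_add, neg_add, add_add_add_comm, hx, hx']
  module

theorem IsInhomSLSolution.const_smul (w : ℂ) (h : IsInhomSLSolution V z f ψ ψ₁) :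
    IsInhomSLSolution V z (fun x => w • f x) (fun x => w • ψ x) (fun x => w • ψ₁ x) := by
  obtain ⟨ψ₂, hψ, hψ_eq⟩ := h
  refine ⟨_, hψ.const_smul w, ?_⟩
  filter_upwards [hψ_eq] with x hx
  rw [map_smul, ← smul_neg, ← smul_add, hx, smul_add, smul_comm]

theorem IsInhomSLSolution.sub_isSLSolution (h : IsInhomSLSolution V z f ψ ψ₁)
    (h' : IsSLSolution V z φ φ₁) :
    IsInhomSLSolution V z f (fun x => ψ x - φ x) (fun x => ψ₁ x - φ₁ x) := by
  obtain ⟨ψ₂, hψ, hψ_eq⟩ := h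
  obtain ⟨φ₂, hφ, hφ_eq⟩ := h'
  refine ⟨_, hψ.sub hφ, ?_⟩
  filter_upwards [hψ_eq, hφ_eq] with x hx hx'
  rw [map_sub, neg_sub', sub_add_sub_comm, hx, hx', smul_sub, sub_add_eq_add_sub]

variable [CompleteSpace E]

theorem exists_isInhomSLSolution (hV : Integrable V unitMeasure) (z : ℂ)
    (hf : Integrable f unitMeasure) :
    ∃ y y₁ : ℝ → E, IsInhomSLSolution V z f y y₁ ∧ y 0 = 0 ∧ y₁ 0 = 0 := by
  obtain ⟨y, y₁, hy, h0, h1⟩ :=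
    exists_hasACDerivs (integrable_restrictScalars_sub_smul_one hV z) hf.neg 0 0
  refine ⟨y, y₁, ⟨_, hy, .of_forall fun x => ?_⟩, h0, h1⟩
  change -((V x (y x) - z • y x) + -f x) + V x (y x) = _
  abel

theorem exists_isInhomSLSolution_bound (hV : Integrable V unitMeasure) (z : ℂ) :
    ∃ C : ℝ, 0 ≤ C ∧ ∀ f y y₁ : ℝ → E, Integrable f unitMeasure →
      IsInhomSLSolution V z f y y₁ → y 0 = 0 → y₁ 0 = 0 →
      ∀ x ∈ Icc (0 : ℝ) 1, ‖(y x, y₁ x)‖ ≤ C * ∫ t, ‖f t‖ ∂unitMeasure := by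
  have hQ := integrable_restrictScalars_sub_smul_one hV z
  refine ⟨2 * Real.exp (2 * ∫ t, ‖companion ((V t - z • (1 : E →L[ℂ] E)).restrictScalars ℝ)‖
    ∂unitMeasure), by positivity, ?_⟩
  rintro f y y₁ hf ⟨y₂, hy, hy_eq⟩ h0 h1 x hx
  have h_ac : HasACDerivs y y₁
      (fun t => (V t - z • (1 : E →L[ℂ] E)).restrictScalars ℝ (y t) + (-f) t) := by
    refine hy.congr_ae ?_
    filter_upwards [hy_eq] with t ht
    change y₂ t = (V t (y t) - z • y t) + -f t
    rw [← add_sub_cancel_left (z • y t) (f t), ← ht]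
    abel
  have h_bound := h_ac.norm_le_of_linear hQ hf.neg hx
  rw [h0, h1, Prod.mk_zero_zero, norm_zero, zero_add, mul_right_comm] at h_bound
  simpa only [Pi.neg_apply, norm_neg] using h_bound

end Inhomogeneous

section Resolvent

open scoped InnerProductSpace

variable {E : Type*} [NormedAddCommGroup E] [InnerProductSpace ℂ E]
  {Tm Tp : E →L[ℂ] E} {V : ℝ → E →L[ℂ] E} {a b : E →L[ℂ] E}

/-- `Γ₋` as a continuous linear map of the Cauchy data `(ψ(0), ψ'(0))`. -/
noncomputable def bdryMinusCLM (T a : E →L[ℂ] E) : E × E →L[ℂ] E :=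
  (1 - T) ∘L (.snd ℂ E E - a ∘L .fst ℂ E E) - T ∘L .fst ℂ E E

theorem bdryMinusCLM_apply (T a : E →L[ℂ] E) (p q : E) :
    bdryMinusCLM T a (p, q) = bdryMinus T a p q := rfl

/-- `Γ₊` as a continuous linear map of the Cauchy data `(ψ(1), ψ'(1))`. -/
noncomputable def bdryPlusCLM (T b : E →L[ℂ] E) : E × E →L[ℂ] E :=
  (1 - T) ∘L (.snd ℂ E E + b ∘L .fst ℂ E E) - T ∘L .fst ℂ E E

theorem bdryPlusCLM_apply (T b : E →L[ℂ] E) (p q : E) :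
    bdryPlusCLM T b (p, q) = bdryPlus T b p q := rfl

/-- `ψ` lies in the domain of `L` and solves `(L - z) ψ = f`, with derivative `ψ₁`. Unlike in
`SLMaps`, `f` only has to be integrable. -/
structure IsResolventSolution (Tm Tp : E →L[ℂ] E) (V : ℝ → E →L[ℂ] E) (a b : E →L[ℂ] E) (z : ℂ)
    (f ψ ψ₁ : ℝ → E) : Prop where
  isInhomSLSolution : IsInhomSLSolution V z f ψ ψ₁
  bdryMinus_eq_zero : bdryMinus Tm a (ψ 0) (ψ₁ 0) = 0
  bdryPlus_eq_zero : bdryPlus Tp b (ψ 1) (ψ₁ 1) = 0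

section Linear

variable {z : ℂ} {f g ψ ψ₁ φ φ₁ : ℝ → E}

theorem IsResolventSolution.congr (h : IsResolventSolution Tm Tp V a b z f ψ ψ₁)
    (hfg : f =ᵐ[unitMeasure] g) : IsResolventSolution Tm Tp V a b z g ψ ψ₁ :=
  ⟨h.isInhomSLSolution.congr hfg, h.bdryMinus_eq_zero, h.bdryPlus_eq_zero⟩

theorem IsResolventSolution.add (h : IsResolventSolution Tm Tp V a b z f ψ ψ₁)
    (h' : IsResolventSolution Tm Tp V a b z g φ φ₁) :
    IsResolventSolution Tm Tp V a b z (fun x => f x + g x) (fun x => ψ x + φ x)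
      (fun x => ψ₁ x + φ₁ x) where
  isInhomSLSolution := h.isInhomSLSolution.add h'.isInhomSLSolution
  bdryMinus_eq_zero := by
    rw [← bdryMinusCLM_apply, ← Prod.mk_add_mk, map_add, bdryMinusCLM_apply, bdryMinusCLM_apply,
      h.bdryMinus_eq_zero, h'.bdryMinus_eq_zero, add_zero]
  bdryPlus_eq_zero := by
    rw [← bdryPlusCLM_apply, ← Prod.mk_add_mk, map_add, bdryPlusCLM_apply, bdryPlusCLM_apply,
      h.bdryPlus_eq_zero, h'.bdryPlus_eq_zero, add_zero]

theorem IsResolventSolution.const_smul (w : ℂ) (h : IsResolventSolution Tm Tp V a b z f ψ ψ₁) :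
    IsResolventSolution Tm Tp V a b z (fun x => w • f x) (fun x => w • ψ x)
      (fun x => w • ψ₁ x) where
  isInhomSLSolution := h.isInhomSLSolution.const_smul w
  bdryMinus_eq_zero := by
    rw [← bdryMinusCLM_apply, ← Prod.smul_mk, map_smul, bdryMinusCLM_apply, h.bdryMinus_eq_zero,
      smul_zero]
  bdryPlus_eq_zero := by
    rw [← bdryPlusCLM_apply, ← Prod.smul_mk, map_smul, bdryPlusCLM_apply, h.bdryPlus_eq_zero,
      smul_zero]

theorem IsResolventSolution.continuousOn (h : IsResolventSolution Tm Tp V a b z f ψ ψ₁) :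
    ContinuousOn ψ (Icc 0 1) :=
  h.isInhomSLSolution.elim fun _ hψ => hψ.1.continuousOn

end Linear

theorem IsFundMinus.exists_norm_prodMk_apply_le {z : ℂ} {F F₁ : ℝ → E →L[ℂ] E}
    (hF : IsFundMinus Tm V a z F F₁) :
    ∃ K : ℝ, 0 ≤ K ∧ ∀ x ∈ Icc (0 : ℝ) 1, ∀ c, ‖(F x c, F₁ x c)‖ ≤ K * ‖c‖ := by
  obtain ⟨F₂, hF, -⟩ := hF
  obtain ⟨K, hK⟩ := isCompact_Icc.exists_bound_of_continuousOn
    (hF.continuousOn.prodMk hF.continuousOn_deriv)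
  refine ⟨K, (norm_nonneg _).trans (hK 0 unitInterval.zero_mem), fun x hx c => ?_⟩
  exact max_le ((F x).le_of_opNorm_le ((norm_fst_le _).trans (hK x hx)) c)
    ((F₁ x).le_of_opNorm_le ((norm_snd_le _).trans (hK x hx)) c)

variable [CompleteSpace E]

theorem IsSLParam.green_isSLSolution (h : IsSLParam Tm Tp V a b) (hTm : IsStarProjection Tm)
    (hTp : IsStarProjection Tp) {u u₁ v v₁ : ℝ → E} {e : E} {lam mu : ℝ}
    (hu : IsSLSolution V lam u u₁) (hv : IsSLSolution V mu v v₁)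
    (hu0 : bdryMinus Tm a (u 0) (u₁ 0) = 0) (hv0 : bdryMinus Tm a (v 0) (v₁ 0) = 0)
    (he : Tp e = 0)
    (hu1 : bdryPlus Tp b (u 1) (u₁ 1) = e) (hv1 : bdryPlus Tp b (v 1) (v₁ 1) = 0) :
    ((lam : ℂ) - mu) * ∫ x, ⟪u x, v x⟫_ℂ ∂unitMeasure = -⟪e, v 1⟫_ℂ := by
  obtain ⟨u₂, hu, hu_eq⟩ := hu
  obtain ⟨v₂, hv, hv_eq⟩ := hv
  rw [← h.green hTm hTp hu hv hu_eq hv_eq hu0 hv0 he hu1 hv1, ← integral_const_mul]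
  refine integral_congr_ae (.of_forall fun x => ?_)
  simp only [inner_smul_left, inner_smul_right, Complex.conj_ofReal]
  ring

theorem IsSLParam.integral_inner_eq_zero_of_ne (h : IsSLParam Tm Tp V a b)
    (hTm : IsStarProjection Tm) (hTp : IsStarProjection Tp) {u u₁ v v₁ : ℝ → E} {lam mu : ℝ}
    (hne : lam ≠ mu) (hu : IsSLSolution V lam u u₁) (hv : IsSLSolution V mu v v₁)
    (hu0 : bdryMinus Tm a (u 0) (u₁ 0) = 0) (hv0 : bdryMinus Tm a (v 0) (v₁ 0) = 0)
    (hu1 : bdryPlus Tp b (u 1) (u₁ 1) = 0) (hv1 : bdryPlus Tp b (v 1) (v₁ 1) = 0) :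
    ∫ x, ⟪u x, v x⟫_ℂ ∂unitMeasure = 0 := by
  have h_green := h.green_isSLSolution hTm hTp hu hv hu0 hv0 (map_zero Tp) hu1 hv1
  rw [inner_zero_left, neg_zero] at h_green
  exact (mul_eq_zero.1 h_green).resolve_left (sub_ne_zero.2 (Complex.ofReal_injective.ne hne))

theorem IsSLParam.exists_not_isSLEigenvalue [TopologicalSpace.SeparableSpace (Lp E 2 unitMeasure)]
    (h : IsSLParam Tm Tp V a b) (hTm : IsStarProjection Tm) (hTp : IsStarProjection Tp) :
    ∃ mu : ℝ, ¬ IsSLEigenvalue Tm Tp V a b mu := by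
  by_contra! h_all
  choose ψ hψ0 ψ₁ ψ₂ hψ h_minus h_plus _ hψ_eq using h_all
  have h_sol (lam : ℝ) : IsSLSolution V lam (ψ lam) (ψ₁ lam) :=
    ⟨ψ₂ lam, hψ lam, (hψ_eq lam).mono fun x hx => hx.symm⟩
  refine not_countable (α := ℝ) (countable_of_pairwise_inner_eq_zero ℂ
    (φ := fun lam => toL2Unit (hψ lam).continuousOn) (fun lam h0 => hψ0 lam ?_) ?_)
  · have h_coe := coeFn_toL2Unit (hψ lam).continuousOn
    rw [h0] at h_coe
    exact h_coe.symm.trans (Lp.coeFn_zero _ _ _)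
  · intro lam mu hne
    change ⟪toL2Unit _, toL2Unit _⟫_ℂ = 0
    rw [inner_toL2Unit_toL2Unit]
    exact h.integral_inner_eq_zero_of_ne hTm hTp hne (h_sol lam) (h_sol mu) (h_minus lam)
      (h_minus mu) (h_plus lam) (h_plus mu)

theorem IsFundMinus.bdryPlus_injective {mu : ℝ} {F F₁ : ℝ → E →L[ℂ] E}
    (h : IsSLParam Tm Tp V a b) (hTm : Tm * Tm = Tm)
    (hF : IsFundMinus Tm V a (mu : ℂ) F F₁) (hmu : ¬ IsSLEigenvalue Tm Tp V a b mu) :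
    Function.Injective (bdryPlus (M := E →L[ℂ] E) Tp b (F 1) (F₁ 1)) := by
  rw [injective_iff_map_eq_zero]
  intro c hc
  by_contra h0
  exact hmu ((hF.isSLEigenvalue_iff h.integrable hTm (h.a_mul_eq_zero hTm)
    (h.mul_a_eq_zero hTm)).2 ⟨c, h0, hc⟩)

variable [FiniteDimensional ℂ E]

theorem IsFundMinus.exists_bdryPlus_apply_eq {mu : ℝ} {F F₁ : ℝ → E →L[ℂ] E}
    (h : IsSLParam Tm Tp V a b) (hTm : Tm * Tm = Tm)
    (hF : IsFundMinus Tm V a (mu : ℂ) F F₁) (hmu : ¬ IsSLEigenvalue Tm Tp V a b mu) (e : E) :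
    ∃ c, bdryPlus Tp b (F 1) (F₁ 1) c = e :=
  LinearMap.injective_iff_surjective (f := (bdryPlus Tp b (F 1) (F₁ 1)).toLinearMap).1
    (hF.bdryPlus_injective h hTm hmu) e

theorem IsFundMinus.exists_norm_le_mul_norm_bdryPlus {mu : ℝ} {F F₁ : ℝ → E →L[ℂ] E}
    (h : IsSLParam Tm Tp V a b) (hTm : Tm * Tm = Tm)
    (hF : IsFundMinus Tm V a (mu : ℂ) F F₁) (hmu : ¬ IsSLEigenvalue Tm Tp V a b mu) :
    ∃ κ : ℝ, 0 ≤ κ ∧ ∀ c, ‖c‖ ≤ κ * ‖bdryPlus Tp b (F 1) (F₁ 1) c‖ := by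
  obtain ⟨κ, -, hκ⟩ := (bdryPlus Tp b (F 1) (F₁ 1)).toLinearMap.exists_antilipschitzWith
    (LinearMap.ker_eq_bot.2 (hF.bdryPlus_injective h hTm hmu))
  exact ⟨κ, κ.2, fun c => by simpa using hκ.le_mul_dist c 0⟩

theorem exists_isResolventSolution (h : IsSLParam Tm Tp V a b) (hTm : Tm * Tm = Tm) {mu : ℝ}
    (hmu : ¬ IsSLEigenvalue Tm Tp V a b mu) {f : ℝ → E} (hf : Integrable f unitMeasure) :
    ∃ ψ ψ₁, IsResolventSolution Tm Tp V a b mu f ψ ψ₁ := by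
  obtain ⟨F, F₁, hF⟩ := exists_isFundMinus h.integrable hTm (h.a_mul_eq_zero hTm)
    (h.mul_a_eq_zero hTm) mu
  obtain ⟨y, y₁, hy, h0, h1⟩ := exists_isInhomSLSolution h.integrable (mu : ℂ) hf
  obtain ⟨c, hc⟩ := hF.exists_bdryPlus_apply_eq h hTm hmu (bdryPlus Tp b (y 1) (y₁ 1))
  refine ⟨_, _, hy.sub_isSLSolution (hF.isSLSolution_apply c), ?_, ?_⟩
  · rw [← bdryMinusCLM_apply, ← Prod.mk_sub_mk, map_sub, h0, h1, Prod.mk_zero_zero, map_zero,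
      bdryMinusCLM_apply, hF.bdryMinus_apply, sub_zero]
  · rw [← bdryPlusCLM_apply, ← Prod.mk_sub_mk, map_sub, bdryPlusCLM_apply, bdryPlusCLM_apply,
      bdryPlus_apply, hc, sub_self]

theorem exists_isResolventSolution_bound (h : IsSLParam Tm Tp V a b) (hTm : Tm * Tm = Tm)
    {mu : ℝ} (hmu : ¬ IsSLEigenvalue Tm Tp V a b mu) :
    ∃ C : ℝ, 0 ≤ C ∧ ∀ f ψ ψ₁ : ℝ → E, Integrable f unitMeasure →
      IsResolventSolution Tm Tp V a b mu f ψ ψ₁ →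
      ∀ x ∈ Icc (0 : ℝ) 1, ‖(ψ x, ψ₁ x)‖ ≤ C * ∫ t, ‖f t‖ ∂unitMeasure := by
  have haT := h.a_mul_eq_zero hTm
  have hTa := h.mul_a_eq_zero hTm
  obtain ⟨F, F₁, hF⟩ := exists_isFundMinus h.integrable hTm haT hTa mu
  obtain ⟨C, hC, h_zero_data⟩ := exists_isInhomSLSolution_bound h.integrable (mu : ℂ)
  obtain ⟨κ, hκ, h_lower⟩ := hF.exists_norm_le_mul_norm_bdryPlus h hTm hmu
  obtain ⟨K, hK, h_upper⟩ := hF.exists_norm_prodMk_apply_le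
  refine ⟨C + K * (κ * (‖bdryPlusCLM Tp b‖ * C)), by positivity, fun f ψ ψ₁ hf hψ x hx => ?_⟩
  set I : ℝ := ∫ t, ‖f t‖ ∂unitMeasure
  set c := bdryMinusPerp Tm (ψ 0) (ψ₁ 0)
  have h_initial := eq_and_eq_of_bdryMinus_eq_zero hTm haT hTa hψ.bdryMinus_eq_zero
  have hFc := hF.isRegularSLSolution_apply hTm haT hTa c
  have h_sub {t : ℝ} (ht : t ∈ Icc (0 : ℝ) 1) : ‖(ψ t, ψ₁ t) - (F t c, F₁ t c)‖ ≤ C * I :=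
    h_zero_data f _ _ hf (hψ.isInhomSLSolution.sub_isSLSolution hFc.isSLSolution)
      (sub_eq_zero.2 (h_initial.1.trans hFc.apply_zero.symm))
      (sub_eq_zero.2 (h_initial.2.trans hFc.deriv_zero.symm)) t ht
  have h_bdry : bdryPlusCLM Tp b ((ψ 1, ψ₁ 1) - (F 1 c, F₁ 1 c)) =
      -bdryPlus Tp b (F 1) (F₁ 1) c := by
    rw [map_sub, bdryPlusCLM_apply, bdryPlusCLM_apply, hψ.bdryPlus_eq_zero, zero_sub,
      bdryPlus_apply]
  have hc : ‖c‖ ≤ κ * (‖bdryPlusCLM Tp b‖ * (C * I)) := by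
    refine (h_lower c).trans (mul_le_mul_of_nonneg_left ?_ hκ)
    rw [← norm_neg, ← h_bdry]
    exact (bdryPlusCLM Tp b).le_opNorm_of_le (h_sub unitInterval.one_mem)
  calc ‖(ψ x, ψ₁ x)‖ ≤ ‖(ψ x, ψ₁ x) - (F x c, F₁ x c)‖ + ‖(F x c, F₁ x c)‖ :=
        norm_le_norm_sub_add _ _
    _ ≤ C * I + K * (κ * (‖bdryPlusCLM Tp b‖ * (C * I))) :=
        add_le_add (h_sub hx) ((h_upper x hx c).trans (mul_le_mul_of_nonneg_left hc hK))
    _ = (C + K * (κ * (‖bdryPlusCLM Tp b‖ * C))) * I := by ring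

theorem IsResolventSolution.eqOn (h : IsSLParam Tm Tp V a b) (hTm : Tm * Tm = Tm)
    {mu : ℝ} (hmu : ¬ IsSLEigenvalue Tm Tp V a b mu) {f ψ ψ₁ φ φ₁ : ℝ → E}
    (hψ : IsResolventSolution Tm Tp V a b mu f ψ ψ₁)
    (hφ : IsResolventSolution Tm Tp V a b mu f φ φ₁) : EqOn ψ φ (Icc 0 1) := by
  obtain ⟨C, -, h_bound⟩ := exists_isResolventSolution_bound h hTm hmu
  intro x hx
  have h_sub := (hψ.add (hφ.const_smul (-1))).congr (g := 0) (.of_forall fun x => by simp)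
  have h_le := (norm_fst_le _).trans (h_bound 0 _ _ (integrable_zero _ _ _) h_sub x hx)
  simp only [Pi.zero_apply, norm_zero, integral_zero, mul_zero, neg_one_smul,
    ← sub_eq_add_neg] at h_le
  exact sub_eq_zero.1 (norm_le_zero_iff.1 h_le)

end Resolvent

section Compactness

open scoped BoundedContinuousFunction

variable {M : Type*} [NormedAddCommGroup M]

theorem continuousOn_IccExtend_bcf (g : Icc (0 : ℝ) 1 →ᵇ M) :
    ContinuousOn (IccExtend zero_le_one g) (Icc 0 1) :=
  (g.continuous.Icc_extend' (h := zero_le_one)).continuousOn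

/-- The inclusion of the continuous functions on `[0,1]` into `L²`. -/
noncomputable def bcfToL2Unit (g : Icc (0 : ℝ) 1 →ᵇ M) : Lp M 2 unitMeasure :=
  toL2Unit (continuousOn_IccExtend_bcf g)

theorem continuous_bcfToL2Unit : Continuous (bcfToL2Unit (M := M)) := by
  refine LipschitzWith.continuous (K := 1) (LipschitzWith.of_dist_le_mul fun g g' => ?_)
  rw [NNReal.coe_one, one_mul, dist_eq_norm (bcfToL2Unit g)]
  refine norm_Lp_unit_le_of_ae_bound dist_nonneg ?_
  filter_upwards [coeFn_toL2Unit (continuousOn_IccExtend_bcf g),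
    coeFn_toL2Unit (continuousOn_IccExtend_bcf g'),
    Lp.coeFn_sub (bcfToL2Unit g) (bcfToL2Unit g')] with x hx hx' hx_sub
  rw [hx_sub, Pi.sub_apply, bcfToL2Unit, hx, bcfToL2Unit, hx', ← dist_eq_norm]
  exact BoundedContinuousFunction.dist_coe_le_dist _

theorem isCompact_closure_bounded_lipschitz {X : Type*} [PseudoMetricSpace X] [CompactSpace X]
    [ProperSpace M] (C : NNReal) :
    IsCompact (closure {g : X →ᵇ M | (∀ x, ‖g x‖ ≤ C) ∧ LipschitzWith C g}) := by
  refine BoundedContinuousFunction.arzela_ascoli (Metric.closedBall 0 C)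
    (isCompact_closedBall 0 (C : ℝ)) _ (fun g x hg => ?_) ?_
  · exact mem_closedBall_zero_iff.2 (hg.1 x)
  · exact (LipschitzWith.uniformEquicontinuous _ C fun g => g.2.2).equicontinuous

theorem isCompactOperator_of_bounded_lipschitz [ProperSpace M]
    {R : Lp M 2 unitMeasure → Lp M 2 unitMeasure} {C : NNReal}
    (h : ∀ f, ‖f‖ ≤ 1 → ∃ ψ : ℝ → M, R f =ᵐ[unitMeasure] ψ ∧ (∀ x ∈ Icc (0 : ℝ) 1, ‖ψ x‖ ≤ C) ∧
      LipschitzOnWith C ψ (Icc 0 1)) : IsCompactOperator R := by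
  rw [isCompactOperator_iff_exists_mem_nhds_image_subset_compact]
  refine ⟨Metric.closedBall 0 1, Metric.closedBall_mem_nhds _ one_pos, _,
    (isCompact_closure_bounded_lipschitz C).image continuous_bcfToL2Unit, ?_⟩
  rintro _ ⟨f, hf, rfl⟩
  obtain ⟨ψ, hRf, h_bound, h_lip⟩ := h f (mem_closedBall_zero_iff.1 hf)
  have h_restrict := h_lip.to_restrict
  let g := BoundedContinuousFunction.mkOfCompact ⟨_, h_restrict.continuous⟩
  refine ⟨g, subset_closure ⟨fun x => h_bound x x.2, h_restrict⟩, Lp.ext ?_⟩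
  filter_upwards [hRf, coeFn_toL2Unit (continuousOn_IccExtend_bcf g),
    ae_restrict_mem measurableSet_Icc] with x hx hxg hx_mem
  rw [hx, bcfToL2Unit, hxg, IccExtend_of_mem _ _ hx_mem]
  rfl

end Compactness

theorem HasACDerivs.deriv_two_ae_eq_zero {M : Type*} [NormedAddCommGroup M] [NormedSpace ℝ M]
    [CompleteSpace M] {u u₁ u₂ : ℝ → M} (hu : HasACDerivs u u₁ u₂)
    (h : ∀ x ∈ Icc (0 : ℝ) 1, u₁ x = 0) : u₂ =ᵐ[unitMeasure] 0 := by
  filter_upwards [hu.hasACDeriv_deriv.ae_hasDerivAt, ae_restrict_mem measurableSet_Icc] with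
    x hx hx_mem
  exact (uniqueDiffOn_Icc zero_lt_one x hx_mem).eq_deriv _ hx.hasDerivWithinAt
    ((hasDerivWithinAt_const x _ (0 : M)).congr h (h x hx_mem))

section Completeness

open scoped InnerProductSpace

variable {E : Type*} [NormedAddCommGroup E] [InnerProductSpace ℂ E] {Tm Tp : E →L[ℂ] E}
  {V : ℝ → E →L[ℂ] E} {a b : E →L[ℂ] E}

/-- `R f = (L - z)⁻¹ f` for all `f ∈ L²`. -/
def IsResolvent (Tm Tp : E →L[ℂ] E) (V : ℝ → E →L[ℂ] E) (a b : E →L[ℂ] E) (z : ℂ)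
    (R : Lp E 2 unitMeasure → Lp E 2 unitMeasure) : Prop :=
  ∀ f, ∃ ψ ψ₁, R f =ᵐ[unitMeasure] ψ ∧ IsResolventSolution Tm Tp V a b z f ψ ψ₁

/-- `u` is an eigenfunction of `L` for the eigenvalue `lam`, with derivative `u₁`, normalised by
`Γ₋^⊥u = c`. The case `u = 0`, `c = 0` is included. -/
structure IsSLEigenfunction (Tm Tp : E →L[ℂ] E) (V : ℝ → E →L[ℂ] E) (a b : E →L[ℂ] E) (lam : ℝ)
    (c : E) (u u₁ : ℝ → E) : Prop extends IsRegularSLSolution V a Tm lam c u u₁ where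
  bdryPlus_eq_zero : bdryPlus Tp b (u 1) (u₁ 1) = 0

variable [CompleteSpace E] {mu : ℝ} {R : Lp E 2 unitMeasure → Lp E 2 unitMeasure}

theorem IsResolvent.inner_apply_left (hR : IsResolvent Tm Tp V a b mu R)
    (h : IsSLParam Tm Tp V a b) (hTm : IsStarProjection Tm) (hTp : IsStarProjection Tp)
    (f g : Lp E 2 unitMeasure) : ⟪R f, g⟫_ℂ = ⟪f, R g⟫_ℂ := by
  obtain ⟨ψ, ψ₁, hRf, ⟨ψ₂, hψ, hψ_eq⟩, hψ0, hψ1⟩ := hR f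
  obtain ⟨φ, φ₁, hRg, ⟨φ₂, hφ, hφ_eq⟩, hφ0, hφ1⟩ := hR g
  have h_green := h.green hTm hTp hψ hφ hψ_eq hφ_eq hψ0 hφ0 (map_zero Tp) hψ1 hφ1
  rw [inner_zero_left, neg_zero] at h_green
  refine (sub_eq_zero.1 ?_).symm
  rw [← h_green, L2.inner_def, L2.inner_def,
    ← integral_sub (L2.integrable_inner _ _) (L2.integrable_inner _ _)]
  refine integral_congr_ae ?_
  filter_upwards [hRf, hRg] with x hx hx'
  rw [hx, hx']
  simp only [inner_add_left, inner_add_right, inner_smul_left, inner_smul_right,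
    Complex.conj_ofReal]
  ring

theorem IsResolvent.eq_zero_of_apply_eq_zero {z : ℂ} (hR : IsResolvent Tm Tp V a b z R)
    {f : Lp E 2 unitMeasure} (hf : R f = 0) : f = 0 := by
  obtain ⟨ψ, ψ₁, hRf, ⟨ψ₂, hψ, hψ_eq⟩, -, -⟩ := hR f
  rw [hf] at hRf
  have h0 : ψ =ᵐ[unitMeasure] 0 := hRf.symm.trans (Lp.coeFn_zero _ _ _)
  have h2 := hψ.deriv_two_ae_eq_zero fun x hx => (hψ.eq_zero_of_ae h0 hx).2
  refine Lp.ext ?_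
  filter_upwards [hψ_eq, h0, h2, Lp.coeFn_zero E 2 unitMeasure] with x hx hx0 hx2 hx_zero
  rw [hx0, hx2, Pi.zero_apply, neg_zero, map_zero, smul_zero, zero_add, zero_add] at hx
  rw [← hx, hx_zero, Pi.zero_apply]

theorem IsResolvent.exists_isSLEigenfunction (hR : IsResolvent Tm Tp V a b mu R)
    (h : IsSLParam Tm Tp V a b) (hTm : Tm * Tm = Tm) {r : ℝ} (hr : r ≠ 0)
    {f : Lp E 2 unitMeasure} (hf : R f = (r : ℂ) • f) :
    ∃ c u u₁, IsSLEigenfunction Tm Tp V a b (mu + r⁻¹) c u u₁ ∧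
      ∀ᵐ x ∂unitMeasure, u x = (r : ℂ) • f x := by
  obtain ⟨ψ, ψ₁, hRf, ⟨ψ₂, hψ, hψ_eq⟩, hψ0, hψ1⟩ := hR f
  have hψf : ∀ᵐ x ∂unitMeasure, ψ x = (r : ℂ) • f x := by
    filter_upwards [hRf, Lp.coeFn_smul (r : ℂ) f] with x hx hx_smul
    rw [← hx, hf, hx_smul, Pi.smul_apply]
  have h_sol : IsSLSolution V ((mu + r⁻¹ : ℝ) : ℂ) ψ ψ₁ := by
    refine ⟨ψ₂, hψ, ?_⟩
    filter_upwards [hψ_eq, hψf] with x hx hxf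
    rw [hx, Complex.ofReal_add, Complex.ofReal_inv, add_smul, hxf, smul_smul (r : ℂ)⁻¹,
      inv_mul_cancel₀ (Complex.ofReal_ne_zero.2 hr), one_smul]
  exact ⟨_, ψ, ψ₁, ⟨h_sol.isRegularSLSolution hTm (h.a_mul_eq_zero hTm) (h.mul_a_eq_zero hTm) hψ0,
    hψ1⟩, hψf⟩

theorem IsResolvent.inner_eq_zero_of_apply_eq_smul (hR : IsResolvent Tm Tp V a b mu R)
    (h : IsSLParam Tm Tp V a b) (hTm : Tm * Tm = Tm) {g : Lp E 2 unitMeasure}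
    (hg : ∀ lam c u u₁, IsSLEigenfunction Tm Tp V a b lam c u u₁ →
      ∫ x, ⟪u x, g x⟫_ℂ ∂unitMeasure = 0) {r : ℝ} (hr : r ≠ 0) {f : Lp E 2 unitMeasure}
    (hf : R f = (r : ℂ) • f) : ⟪f, g⟫_ℂ = 0 := by
  obtain ⟨c, u, u₁, hu, huf⟩ := hR.exists_isSLEigenfunction h hTm hr hf
  have h_mul : (r : ℂ) * ⟪f, g⟫_ℂ = 0 := by
    rw [← hg _ c u u₁ hu, L2.inner_def, ← integral_const_mul]
    refine integral_congr_ae ?_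
    filter_upwards [huf] with x hx
    rw [hx, inner_smul_left, Complex.conj_ofReal]
  exact (mul_eq_zero.1 h_mul).resolve_left (Complex.ofReal_ne_zero.2 hr)

variable [FiniteDimensional ℂ E]

theorem exists_isResolvent (h : IsSLParam Tm Tp V a b) (hTm : Tm * Tm = Tm)
    (hmu : ¬ IsSLEigenvalue Tm Tp V a b mu) : ∃ R, IsResolvent Tm Tp V a b mu R := by
  choose ψ ψ₁ hψ using fun f : Lp E 2 unitMeasure =>
    exists_isResolventSolution h hTm hmu (integrable_of_mem_Lp_unit f)
  exact ⟨fun f => toL2Unit (hψ f).continuousOn,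
    fun f => ⟨ψ f, ψ₁ f, coeFn_toL2Unit (hψ f).continuousOn, hψ f⟩⟩

theorem IsResolvent.ae_eq (hR : IsResolvent Tm Tp V a b mu R) (h : IsSLParam Tm Tp V a b)
    (hTm : Tm * Tm = Tm) (hmu : ¬ IsSLEigenvalue Tm Tp V a b mu) {f : Lp E 2 unitMeasure}
    {φ φ₁ : ℝ → E} (hφ : IsResolventSolution Tm Tp V a b mu f φ φ₁) : R f =ᵐ[unitMeasure] φ := by
  obtain ⟨ψ, ψ₁, hRf, hψ⟩ := hR f
  filter_upwards [hRf, ae_restrict_mem measurableSet_Icc] with x hx hx_mem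
  rw [hx, hψ.eqOn h hTm hmu hφ hx_mem]

theorem IsResolvent.map_add (hR : IsResolvent Tm Tp V a b mu R) (h : IsSLParam Tm Tp V a b)
    (hTm : Tm * Tm = Tm) (hmu : ¬ IsSLEigenvalue Tm Tp V a b mu) (f g : Lp E 2 unitMeasure) :
    R (f + g) = R f + R g := by
  obtain ⟨ψ, ψ₁, hRf, hψ⟩ := hR f
  obtain ⟨φ, φ₁, hRg, hφ⟩ := hR g
  refine Lp.ext ((hR.ae_eq h hTm hmu ((hψ.add hφ).congr (Lp.coeFn_add f g).symm)).trans ?_)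
  filter_upwards [hRf, hRg, Lp.coeFn_add (R f) (R g)] with x hx hx' hx_add
  rw [hx_add, Pi.add_apply, hx, hx']

theorem IsResolvent.map_smul (hR : IsResolvent Tm Tp V a b mu R) (h : IsSLParam Tm Tp V a b)
    (hTm : Tm * Tm = Tm) (hmu : ¬ IsSLEigenvalue Tm Tp V a b mu) (w : ℂ)
    (f : Lp E 2 unitMeasure) : R (w • f) = w • R f := by
  obtain ⟨ψ, ψ₁, hRf, hψ⟩ := hR f
  refine Lp.ext ((hR.ae_eq h hTm hmu
    ((hψ.const_smul w).congr (Lp.coeFn_smul w f).symm)).trans ?_)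
  filter_upwards [hRf, Lp.coeFn_smul w (R f)] with x hx hx_smul
  rw [hx_smul, Pi.smul_apply, hx]

theorem IsResolvent.exists_norm_prodMk_le (hR : IsResolvent Tm Tp V a b mu R)
    (h : IsSLParam Tm Tp V a b) (hTm : Tm * Tm = Tm) (hmu : ¬ IsSLEigenvalue Tm Tp V a b mu) :
    ∃ C : NNReal, ∀ f, ∃ ψ ψ₁ ψ₂ : ℝ → E, R f =ᵐ[unitMeasure] ψ ∧ HasACDerivs ψ ψ₁ ψ₂ ∧
      ∀ x ∈ Icc (0 : ℝ) 1, ‖(ψ x, ψ₁ x)‖ ≤ C * ‖f‖ := by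
  obtain ⟨C, hC, h_bound⟩ := exists_isResolventSolution_bound h hTm hmu
  refine ⟨⟨C, hC⟩, fun f => ?_⟩
  obtain ⟨ψ, ψ₁, hRf, hψ⟩ := hR f
  obtain ⟨ψ₂, hψ_ac, -⟩ := hψ.isInhomSLSolution
  exact ⟨ψ, ψ₁, ψ₂, hRf, hψ_ac, fun x hx =>
    (h_bound f ψ ψ₁ (integrable_of_mem_Lp_unit f) hψ x hx).trans
      (mul_le_mul_of_nonneg_left (integral_norm_le_norm_Lp_unit f) hC)⟩

theorem IsResolvent.exists_norm_apply_le (hR : IsResolvent Tm Tp V a b mu R)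
    (h : IsSLParam Tm Tp V a b) (hTm : Tm * Tm = Tm) (hmu : ¬ IsSLEigenvalue Tm Tp V a b mu) :
    ∃ C : NNReal, ∀ f, ‖R f‖ ≤ C * ‖f‖ := by
  obtain ⟨C, h_bound⟩ := hR.exists_norm_prodMk_le h hTm hmu
  refine ⟨C, fun f => norm_Lp_unit_le_of_ae_bound (by positivity) ?_⟩
  obtain ⟨ψ, ψ₁, -, hRf, -, hψ⟩ := h_bound f
  filter_upwards [hRf, ae_restrict_mem measurableSet_Icc] with x hx hx_mem
  rw [hx]
  exact (norm_fst_le _).trans (hψ x hx_mem)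

theorem IsResolvent.isCompactOperator (hR : IsResolvent Tm Tp V a b mu R)
    (h : IsSLParam Tm Tp V a b) (hTm : Tm * Tm = Tm) (hmu : ¬ IsSLEigenvalue Tm Tp V a b mu) :
    IsCompactOperator R := by
  have := FiniteDimensional.proper ℂ E
  obtain ⟨C, h_bound⟩ := hR.exists_norm_prodMk_le h hTm hmu
  refine isCompactOperator_of_bounded_lipschitz (C := C) fun f hf => ?_
  obtain ⟨ψ, ψ₁, _, hRf, hψ_ac, hψ⟩ := h_bound f
  have hψ_le {x : ℝ} (hx : x ∈ Icc (0 : ℝ) 1) : ‖(ψ x, ψ₁ x)‖ ≤ C :=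
    (hψ x hx).trans (mul_le_of_le_one_right C.2 hf)
  exact ⟨ψ, hRf, fun x hx => (norm_fst_le _).trans (hψ_le hx),
    (convex_Icc (0 : ℝ) 1).lipschitzOnWith_of_nnnorm_hasDerivWithin_le hψ_ac.hasDeriv
      fun x hx => (norm_snd_le _).trans (hψ_le hx)⟩

/-- The resolvent as a continuous linear map on `L²`. -/
noncomputable def IsResolvent.toCLM (hR : IsResolvent Tm Tp V a b mu R)
    (h : IsSLParam Tm Tp V a b) (hTm : Tm * Tm = Tm) (hmu : ¬ IsSLEigenvalue Tm Tp V a b mu) :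
    Lp E 2 unitMeasure →L[ℂ] Lp E 2 unitMeasure :=
  LinearMap.mkContinuousOfExistsBound
    { toFun := R
      map_add' := hR.map_add h hTm hmu
      map_smul' := hR.map_smul h hTm hmu }
    ((hR.exists_norm_apply_le h hTm hmu).elim fun C h_bound => ⟨C, h_bound⟩)

theorem IsSLParam.eq_zero_of_orthogonal (h : IsSLParam Tm Tp V a b) (hTm : IsStarProjection Tm)
    (hTp : IsStarProjection Tp) {g : Lp E 2 unitMeasure}
    (hg : ∀ lam c u u₁, IsSLEigenfunction Tm Tp V a b lam c u u₁ →
      ∫ x, ⟪u x, g x⟫_ℂ ∂unitMeasure = 0) : g = 0 := by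
  have hTm_mul := hTm.isIdempotentElem
  have := FiniteDimensional.proper ℂ E
  have : Fact ((2 : ENNReal) ≠ ⊤) := ⟨ENNReal.ofNat_ne_top⟩
  obtain ⟨mu, hmu⟩ := h.exists_not_isSLEigenvalue hTm hTp
  obtain ⟨R, hR⟩ := exists_isResolvent h hTm_mul hmu
  let S := hR.toCLM h hTm_mul hmu
  have hS_symm : S.toLinearMap.IsSymmetric := hR.inner_apply_left h hTm hTp
  have h_eigenspace (ν : ℂ) : Module.End.eigenspace S.toLinearMap ν ≤ (ℂ ∙ g)ᗮ := by
    intro f hf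
    rw [Submodule.mem_orthogonal_singleton_iff_inner_left]
    by_cases hf0 : f = 0
    · rw [hf0, inner_zero_left]
    have hν : (starRingEnd ℂ) ν = ν :=
      hS_symm.conj_eigenvalue_eq_self (Module.End.hasEigenvalue_of_hasEigenvector ⟨hf, hf0⟩)
    obtain ⟨r, rfl⟩ := Complex.conj_eq_iff_real.1 hν
    have hRf : R f = (r : ℂ) • f := Module.End.mem_eigenspace_iff.1 hf
    refine hR.inner_eq_zero_of_apply_eq_smul h hTm_mul hg (fun hr => hf0 ?_) hRf
    rw [hr, Complex.ofReal_zero, zero_smul] at hRf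
    exact hR.eq_zero_of_apply_eq_zero hRf
  have h_bot := S.orthogonalComplement_iSup_eigenspaces_eq_bot
    (hR.isCompactOperator h hTm_mul hmu) hS_symm
  rw [← Submodule.mem_bot ℂ, ← h_bot, Submodule.mem_orthogonal]
  exact fun f hf => Submodule.mem_orthogonal_singleton_iff_inner_left.1 (iSup_le h_eigenspace hf)

end Completeness

section SpectralData

open scoped InnerProductSpace

variable {E : Type*} [NormedAddCommGroup E] [InnerProductSpace ℂ E]
  {Tm Tp : E →L[ℂ] E} {V V' : ℝ → E →L[ℂ] E} {a a' b b' : E →L[ℂ] E}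
  {lam mu : ℝ} {c d : E} {u u₁ v v₁ u' u₁' v' v₁' : ℝ → E}

theorem IsFundMinus.continuousOn {z : ℂ} {F F₁ : ℝ → E →L[ℂ] E} (hF : IsFundMinus Tm V a z F F₁) :
    ContinuousOn F (Icc 0 1) :=
  hF.elim fun _ h => h.1.continuousOn

variable [CompleteSpace E]

theorem IsFundMinus.eq_of_isFundMinus {z : ℂ} {F F₁ G G₁ : ℝ → E →L[ℂ] E}
    (hV : Integrable V unitMeasure) (hTm : Tm * Tm = Tm) (haT : a * Tm = 0) (hTa : Tm * a = 0)
    (hF : IsFundMinus Tm V a z F F₁) (hG : IsFundMinus Tm V a z G G₁) {x : ℝ}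
    (hx : x ∈ Icc (0 : ℝ) 1) : F x = G x ∧ F₁ x = G₁ x :=
  have h_apply (c : E) :=
    hG.eq_apply hV hTm haT hTa (hF.isRegularSLSolution_apply hTm haT hTa c) hx
  ⟨ContinuousLinearMap.ext fun c => (h_apply c).1, ContinuousLinearMap.ext fun c => (h_apply c).2⟩

theorem IsSLEigenfunction.bdryPlus_fundMinus_apply {F F₁ : ℝ → E →L[ℂ] E}
    (hu : IsSLEigenfunction Tm Tp V a b lam c u u₁)
    (h : IsSLParam Tm Tp V a b) (hTm : Tm * Tm = Tm) (hF : IsFundMinus Tm V a lam F F₁) :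
    bdryPlus (M := E →L[ℂ] E) Tp b (F 1) (F₁ 1) c = 0 := by
  obtain ⟨h_val, h_deriv⟩ := hF.eq_apply h.integrable hTm (h.a_mul_eq_zero hTm)
    (h.mul_a_eq_zero hTm) hu.toIsRegularSLSolution unitInterval.one_mem
  rw [← bdryPlus_apply, ← h_val, ← h_deriv, hu.bdryPlus_eq_zero]

theorem inner_integral_star_mul_self_apply {F : ℝ → E →L[ℂ] E} (hF : ContinuousOn F (Icc 0 1))
    (c d : E) : ⟪c, (∫ x in (0 : ℝ)..1, star (F x) * F x) d⟫_ℂ =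
      ∫ x, ⟪F x c, F x d⟫_ℂ ∂unitMeasure := by
  have h_int : Integrable (fun x => star (F x) * F x) unitMeasure :=
    integrable_unit_of_continuousOn (hF.star.mul hF)
  rw [← integral_unit_eq_intervalIntegral, ContinuousLinearMap.integral_apply h_int,
    ← integral_inner (h_int.apply_continuousLinearMap d)]
  refine integral_congr_ae (.of_forall fun x => ?_)
  exact ContinuousLinearMap.adjoint_inner_right (F x) c (F x d)

theorem IsSLEigenfunction.isSLEigenvalue (hu : IsSLEigenfunction Tm Tp V a b lam c u u₁)
    (h : IsSLParam Tm Tp V a b) (hTm : Tm * Tm = Tm) (hc : c ≠ 0) :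
    IsSLEigenvalue Tm Tp V a b lam := by
  have haT := h.a_mul_eq_zero hTm
  have hTa := h.mul_a_eq_zero hTm
  obtain ⟨F, F₁, hF⟩ := exists_isFundMinus h.integrable hTm haT hTa lam
  exact (hF.isSLEigenvalue_iff h.integrable hTm haT hTa).2
    ⟨c, hc, hu.bdryPlus_fundMinus_apply h hTm hF⟩

theorem IsSLEigenfunction.integral_inner_eq_zero_of_ne
    (hu : IsSLEigenfunction Tm Tp V a b lam c u u₁) (hv : IsSLEigenfunction Tm Tp V a b mu d v v₁)
    (h : IsSLParam Tm Tp V a b) (hTm : IsStarProjection Tm) (hTp : IsStarProjection Tp)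
    (hne : lam ≠ mu) : ∫ x, ⟪u x, v x⟫_ℂ ∂unitMeasure = 0 := by
  have hTm_mul := hTm.isIdempotentElem
  have haT := h.a_mul_eq_zero hTm_mul
  have hTa := h.mul_a_eq_zero hTm_mul
  exact h.integral_inner_eq_zero_of_ne hTm hTp hne hu.isSLSolution hv.isSLSolution
    (hu.bdryMinus_eq_zero hTm_mul haT hTa) (hv.bdryMinus_eq_zero hTm_mul haT hTa)
    hu.bdryPlus_eq_zero hv.bdryPlus_eq_zero

theorem spectralTriple_congr {F F₁ G G₁ : ℝ → E →L[ℂ] E}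
    (h : ∀ x ∈ Icc (0 : ℝ) 1, F x = G x ∧ F₁ x = G₁ x) :
    spectralTriple Tp b lam F F₁ = spectralTriple Tp b lam G G₁ := by
  have h_int : ∫ x in (0 : ℝ)..1, star (F x) * F x = ∫ x in (0 : ℝ)..1, star (G x) * G x := by
    refine intervalIntegral.integral_congr fun x hx => ?_
    rw [uIcc_of_le zero_le_one] at hx
    simp only [(h x hx).1]
  rw [spectralTriple, spectralTriple, h_int, (h 1 unitInterval.one_mem).1,
    (h 1 unitInterval.one_mem).2]

/-- The operator `g P` on the whole space, for the operator `g` of a spectral triple. Its type does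
not depend on `P`, so that it can be compared between different triples. -/
noncomputable def SpectralTriple.extended (t : SpectralTriple E) : E →ₗ[ℂ] E :=
  (LinearMap.range t.P.toLinearMap).subtype ∘ₗ t.g ∘ₗ t.P.toLinearMap.rangeRestrict

theorem spectralTriple_extended_apply (lam : ℝ) (F F₁ : ℝ → E →L[ℂ] E) (c : E) :
    (spectralTriple Tp b lam F F₁).extended c =
      (spectralTriple Tp b lam F F₁).P ((∫ x in (0 : ℝ)..1, star (F x) * F x)
        ((spectralTriple Tp b lam F F₁).P ((spectralTriple Tp b lam F F₁).P c))) := rfl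

theorem spectralTriple_P_apply_eq_self_iff (lam : ℝ) (F F₁ : ℝ → E →L[ℂ] E) (c : E) :
    (spectralTriple Tp b lam F F₁).P c = c ↔
      bdryPlus (M := E →L[ℂ] E) Tp b (F 1) (F₁ 1) c = 0 :=
  Submodule.starProjection_eq_self_iff

theorem spectralTriple_eq_of_spectralData_eq (h' : IsSLParam Tm Tp V' a' b')
    (hTm : Tm * Tm = Tm) (hdata : spectralData Tm Tp V a b = spectralData Tm Tp V' a' b')
    (hlam : IsSLEigenvalue Tm Tp V a b lam) {F F₁ F' F₁' : ℝ → E →L[ℂ] E}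
    (hF : IsFundMinus Tm V a (lam : ℂ) F F₁) (hF' : IsFundMinus Tm V' a' (lam : ℂ) F' F₁') :
    spectralTriple Tp b lam F F₁ = spectralTriple Tp b' lam F' F₁' := by
  have h_mem : spectralTriple Tp b lam F F₁ ∈ spectralData Tm Tp V' a' b' :=
    hdata ▸ ⟨lam, hlam, F, F₁, hF, rfl⟩
  obtain ⟨lam', -, G, G₁, hG, h_eq⟩ := h_mem
  obtain rfl : lam = lam' := congrArg SpectralTriple.eigenvalue h_eq
  rw [h_eq]
  exact spectralTriple_congr fun x hx => hG.eq_of_isFundMinus h'.integrable hTm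
    (h'.a_mul_eq_zero hTm) (h'.mul_a_eq_zero hTm) hF' hx

theorem inner_spectralTriple_extended {F F₁ : ℝ → E →L[ℂ] E} (hF : ContinuousOn F (Icc 0 1))
    (hc : bdryPlus (M := E →L[ℂ] E) Tp b (F 1) (F₁ 1) c = 0)
    (hd : bdryPlus (M := E →L[ℂ] E) Tp b (F 1) (F₁ 1) d = 0) :
    ⟪c, (spectralTriple Tp b lam F F₁).extended d⟫_ℂ =
      ∫ x, ⟪F x c, F x d⟫_ℂ ∂unitMeasure := by
  rw [← spectralTriple_P_apply_eq_self_iff lam] at hc hd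
  have hP (x y : E) : ⟪(spectralTriple Tp b lam F F₁).P x, y⟫_ℂ =
      ⟪x, (spectralTriple Tp b lam F F₁).P y⟫_ℂ :=
    Submodule.inner_starProjection_left_eq_right _ x y
  rw [spectralTriple_extended_apply, hd, hd, ← hP, hc, inner_integral_star_mul_self_apply hF]

theorem IsSLEigenfunction.of_spectralData_eq (hu : IsSLEigenfunction Tm Tp V a b lam c u u₁)
    (h : IsSLParam Tm Tp V a b) (h' : IsSLParam Tm Tp V' a' b') (hTm : Tm * Tm = Tm)
    (hdata : spectralData Tm Tp V a b = spectralData Tm Tp V' a' b')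
    (hu' : IsRegularSLSolution V' a' Tm lam c u' u₁') :
    IsSLEigenfunction Tm Tp V' a' b' lam c u' u₁' := by
  refine ⟨hu', ?_⟩
  have haT' := h'.a_mul_eq_zero hTm
  have hTa' := h'.mul_a_eq_zero hTm
  obtain ⟨F, F₁, hF⟩ := exists_isFundMinus h.integrable hTm (h.a_mul_eq_zero hTm)
    (h.mul_a_eq_zero hTm) lam
  obtain ⟨F', F₁', hF'⟩ := exists_isFundMinus h'.integrable hTm haT' hTa' lam
  obtain ⟨h_val, h_deriv⟩ := hF'.eq_apply h'.integrable hTm haT' hTa' hu' unitInterval.one_mem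
  rw [h_val, h_deriv, bdryPlus_apply]
  obtain rfl | hc := eq_or_ne c 0
  · exact map_zero _
  rw [← spectralTriple_P_apply_eq_self_iff lam, ← spectralTriple_eq_of_spectralData_eq h' hTm hdata
    (hu.isSLEigenvalue h hTm hc) hF hF', spectralTriple_P_apply_eq_self_iff]
  exact hu.bdryPlus_fundMinus_apply h hTm hF

theorem IsSLEigenfunction.integral_inner_eq_inner_extended
    (hu : IsSLEigenfunction Tm Tp V a b lam c u u₁)
    (hv : IsSLEigenfunction Tm Tp V a b lam d v v₁) (h : IsSLParam Tm Tp V a b)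
    (hTm : Tm * Tm = Tm) {F F₁ : ℝ → E →L[ℂ] E} (hF : IsFundMinus Tm V a lam F F₁) :
    ∫ x, ⟪u x, v x⟫_ℂ ∂unitMeasure = ⟪c, (spectralTriple Tp b lam F F₁).extended d⟫_ℂ := by
  have haT := h.a_mul_eq_zero hTm
  have hTa := h.mul_a_eq_zero hTm
  rw [inner_spectralTriple_extended hF.continuousOn (hu.bdryPlus_fundMinus_apply h hTm hF)
    (hv.bdryPlus_fundMinus_apply h hTm hF)]
  refine integral_congr_ae ?_
  filter_upwards [ae_restrict_mem measurableSet_Icc] with x hx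
  rw [(hF.eq_apply h.integrable hTm haT hTa hu.toIsRegularSLSolution hx).1,
    (hF.eq_apply h.integrable hTm haT hTa hv.toIsRegularSLSolution hx).1]

theorem IsSLEigenfunction.integral_inner_eq_of_spectralData_eq_of_eigenvalue_eq
    (hu : IsSLEigenfunction Tm Tp V a b lam c u u₁)
    (hv : IsSLEigenfunction Tm Tp V a b lam d v v₁)
    (hu' : IsSLEigenfunction Tm Tp V' a' b' lam c u' u₁')
    (hv' : IsSLEigenfunction Tm Tp V' a' b' lam d v' v₁')
    (h : IsSLParam Tm Tp V a b) (h' : IsSLParam Tm Tp V' a' b') (hTm : Tm * Tm = Tm)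
    (hdata : spectralData Tm Tp V a b = spectralData Tm Tp V' a' b') :
    ∫ x, ⟪u x, v x⟫_ℂ ∂unitMeasure = ∫ x, ⟪u' x, v' x⟫_ℂ ∂unitMeasure := by
  obtain ⟨F, F₁, hF⟩ := exists_isFundMinus h.integrable hTm (h.a_mul_eq_zero hTm)
    (h.mul_a_eq_zero hTm) lam
  obtain ⟨F', F₁', hF'⟩ := exists_isFundMinus h'.integrable hTm (h'.a_mul_eq_zero hTm)
    (h'.mul_a_eq_zero hTm) lam
  rw [hu.integral_inner_eq_inner_extended hv h hTm hF,
    hu'.integral_inner_eq_inner_extended hv' h' hTm hF']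
  obtain rfl | hc := eq_or_ne c 0
  · rw [inner_zero_left, inner_zero_left]
  · rw [spectralTriple_eq_of_spectralData_eq h' hTm hdata (hu.isSLEigenvalue h hTm hc) hF hF']

theorem IsSLEigenfunction.integral_inner_eq_of_spectralData_eq
    (hu : IsSLEigenfunction Tm Tp V a b lam c u u₁) (hv : IsSLEigenfunction Tm Tp V a b mu d v v₁)
    (h : IsSLParam Tm Tp V a b) (h' : IsSLParam Tm Tp V' a' b') (hTm : IsStarProjection Tm)
    (hTp : IsStarProjection Tp)
    (hdata : spectralData Tm Tp V a b = spectralData Tm Tp V' a' b')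
    (hu' : IsRegularSLSolution V' a' Tm lam c u' u₁')
    (hv' : IsRegularSLSolution V' a' Tm mu d v' v₁') :
    ∫ x, ⟪u x, v x⟫_ℂ ∂unitMeasure = ∫ x, ⟪u' x, v' x⟫_ℂ ∂unitMeasure := by
  have hTm_mul := hTm.isIdempotentElem
  have hu'_eig := hu.of_spectralData_eq h h' hTm_mul hdata hu'
  have hv'_eig := hv.of_spectralData_eq h h' hTm_mul hdata hv'
  obtain rfl | hne := eq_or_ne lam mu
  · exact hu.integral_inner_eq_of_spectralData_eq_of_eigenvalue_eq hv hu'_eig hv'_eig h h' hTm_mul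
      hdata
  · rw [hu.integral_inner_eq_zero_of_ne hv h hTm hTp hne,
      hu'_eig.integral_inner_eq_zero_of_ne hv'_eig h' hTm hTp hne]

end SpectralData

section GramMatrix

open scoped InnerProductSpace

variable {𝕜 ι H H' : Type*} [RCLike 𝕜] [NormedAddCommGroup H] [InnerProductSpace 𝕜 H]
  [NormedAddCommGroup H'] [InnerProductSpace 𝕜 H'] {φ : ι → H} {φ' : ι → H'}

theorem inner_linearCombination_eq_of_gram_eq (h_gram : ∀ i j, ⟪φ i, φ j⟫_𝕜 = ⟪φ' i, φ' j⟫_𝕜)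
    (w w' : ι →₀ 𝕜) :
    ⟪Finsupp.linearCombination 𝕜 φ w, Finsupp.linearCombination 𝕜 φ w'⟫_𝕜 =
      ⟪Finsupp.linearCombination 𝕜 φ' w, Finsupp.linearCombination 𝕜 φ' w'⟫_𝕜 := by
  simp only [Finsupp.linearCombination_apply, Finsupp.sum, sum_inner, inner_sum, inner_smul_left,
    inner_smul_right, h_gram]

theorem norm_linearCombination_eq_of_gram_eq (h_gram : ∀ i j, ⟪φ i, φ j⟫_𝕜 = ⟪φ' i, φ' j⟫_𝕜)
    (w : ι →₀ 𝕜) :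
    ‖Finsupp.linearCombination 𝕜 φ w‖ = ‖Finsupp.linearCombination 𝕜 φ' w‖ := by
  rw [@norm_eq_sqrt_re_inner 𝕜, @norm_eq_sqrt_re_inner 𝕜,
    inner_linearCombination_eq_of_gram_eq h_gram]

theorem exists_adjoint_pair_of_gram_eq [CompleteSpace H] [CompleteSpace H']
    (h_gram : ∀ i j, ⟪φ i, φ j⟫_𝕜 = ⟪φ' i, φ' j⟫_𝕜)
    (hd : DenseRange (Finsupp.linearCombination 𝕜 φ))
    (hd' : DenseRange (Finsupp.linearCombination 𝕜 φ')) :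
    ∃ (W : H →L[𝕜] H') (W' : H' →L[𝕜] H),
      (∀ w, W (Finsupp.linearCombination 𝕜 φ w) = Finsupp.linearCombination 𝕜 φ' w) ∧
      (∀ w, W' (Finsupp.linearCombination 𝕜 φ' w) = Finsupp.linearCombination 𝕜 φ w) ∧
      ∀ f g, ⟪W f, g⟫_𝕜 = ⟪f, W' g⟫_𝕜 := by
  have h_norm := norm_linearCombination_eq_of_gram_eq h_gram
  have hW := LinearMap.extendOfNorm_eq (f := Finsupp.linearCombination 𝕜 φ') hd
    ⟨1, fun w => by rw [one_mul, h_norm]⟩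
  have hW' := LinearMap.extendOfNorm_eq (f := Finsupp.linearCombination 𝕜 φ) hd'
    ⟨1, fun w => by rw [one_mul, h_norm]⟩
  refine ⟨_, _, hW, hW', fun f g => ?_⟩
  refine hd.induction_on (p := fun f => ⟪_, g⟫_𝕜 = ⟪f, _⟫_𝕜) f
    (isClosed_eq (by fun_prop) (by fun_prop)) fun w => ?_
  refine hd'.induction_on (p := fun g => ⟪_, g⟫_𝕜 = ⟪_, _⟫_𝕜) g
    (isClosed_eq (by fun_prop) (by fun_prop)) fun w' => ?_
  rw [hW, hW', inner_linearCombination_eq_of_gram_eq h_gram]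

end GramMatrix

section SpectralTransformation

theorem coeFn_linearCombination_toL2Unit {E ι : Type*} [NormedAddCommGroup E] [NormedSpace ℂ E]
    {u : ι → ℝ → E} (hu : ∀ i, ContinuousOn (u i) (Icc 0 1)) (w : ι →₀ ℂ) :
    Finsupp.linearCombination ℂ (fun i => toL2Unit (hu i)) w =ᵐ[unitMeasure]
      fun x => ∑ i ∈ w.support, w i • u i x := by
  have h_term : ∀ᵐ x ∂unitMeasure, ∀ i ∈ w.support,
      (w i • toL2Unit (hu i)) x = w i • u i x := by
    refine (ae_ball_iff w.support.countable_toSet).2 fun i _ => ?_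
    filter_upwards [Lp.coeFn_smul (w i) (toL2Unit (hu i)), coeFn_toL2Unit (hu i)] with x hx hux
    rw [hx, Pi.smul_apply, hux]
  rw [Finsupp.linearCombination_apply, Finsupp.sum]
  filter_upwards [h_term, Lp.coeFn_finsetSum w.support fun i => w i • toL2Unit (hu i)] with
    x hx h_sum
  rw [h_sum, Finset.sum_apply]
  exact Finset.sum_congr rfl hx

theorem intervalIntegral_norm_le_norm_Lp_unit {E : Type*} [NormedAddCommGroup E]
    (f : Lp E 2 unitMeasure) {x : ℝ} (hx : x ∈ Icc (0 : ℝ) 1) :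
    ∫ t in (0 : ℝ)..x, ‖f t‖ ≤ ‖f‖ := by
  refine le_trans ?_ (integral_norm_le_norm_Lp_unit f)
  rw [intervalIntegral.integral_of_le hx.1]
  exact setIntegral_mono_set (integrable_of_mem_Lp_unit f).norm
    (.of_forall fun _ => norm_nonneg _)
    (Ioc_subset_Icc_self.trans (Icc_subset_Icc_right hx.2)).eventuallyLE

theorem IsRegularSLSolution.const_smul {E : Type*} [NormedAddCommGroup E] [NormedSpace ℂ E]
    {V : ℝ → E →L[ℂ] E} {a T : E →L[ℂ] E} {z : ℂ} {c : E} {u u₁ : ℝ → E} (w : ℂ)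
    (hu : IsRegularSLSolution V a T z c u u₁) :
    IsRegularSLSolution V a T z (w • c) (fun x => w • u x) (fun x => w • u₁ x) := by
  obtain ⟨⟨u₂, hu, hu_eq⟩, h_val, h_deriv⟩ := hu
  refine ⟨⟨_, hu.const_smul w, ?_⟩, ?_, ?_⟩
  · filter_upwards [hu_eq] with x hx
    rw [map_smul, ← smul_neg, ← smul_add, hx, smul_comm]
  · rw [h_val, map_smul, smul_sub]
  · rw [h_deriv, map_smul, map_smul, smul_add]

variable {E ι : Type*} [NormedAddCommGroup E] [InnerProductSpace ℂ E] [CompleteSpace E]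
  {V V' : ℝ → E →L[ℂ] E} {a a' T : E →L[ℂ] E} {z : ι → ℂ} {c : ι → E} {u u₁ u' u₁' : ι → ℝ → E}

theorem exists_ae_norm_linearCombination_sub_le (hV : Integrable V unitMeasure)
    (hV' : Integrable V' unitMeasure) (hT : T * T = T) (haT : a * T = 0) (haT' : a' * T = 0)
    (hu : ∀ i, IsRegularSLSolution V a T (z i) (c i) (u i) (u₁ i))
    (hu' : ∀ i, IsRegularSLSolution V' a' T (z i) (c i) (u' i) (u₁' i)) :
    ∃ K : ℝ, ∀ w : ι →₀ ℂ, ∀ᵐ x ∂unitMeasure,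
      ‖Finsupp.linearCombination ℂ (fun i => toL2Unit (hu' i).continuousOn) w x -
          Finsupp.linearCombination ℂ (fun i => toL2Unit (hu i).continuousOn) w x‖ ≤
        K * ∫ t in (0 : ℝ)..x,
          ‖Finsupp.linearCombination ℂ (fun i => toL2Unit (hu i).continuousOn) w t‖ := by
  obtain ⟨K, -, hK⟩ := exists_comparison_bound ι hV hV' hT haT haT'
  refine ⟨K, fun w => ?_⟩
  have h_coe := coeFn_linearCombination_toL2Unit (fun i => (hu i).continuousOn) w
  filter_upwards [h_coe, coeFn_linearCombination_toL2Unit (fun i => (hu' i).continuousOn) w,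
    ae_restrict_mem measurableSet_Icc] with x hx hx' hx_mem
  rw [hx, hx', intervalIntegral_congr_ae_unit (h_coe.mono fun t ht => congrArg norm ht)
    unitInterval.zero_mem hx_mem]
  exact hK w.support z _ _ _ _ _ (fun i _ => (hu i).const_smul (w i))
    (fun i _ => (hu' i).const_smul (w i)) x hx_mem

open scoped InnerProductSpace in
theorem eqOn_of_gram_eq_of_denseRange (hV : Integrable V unitMeasure)
    (hV' : Integrable V' unitMeasure) (hT : T * T = T) (haT : a * T = 0) (haT' : a' * T = 0)
    (hu : ∀ i, IsRegularSLSolution V a T (z i) (c i) (u i) (u₁ i))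
    (hu' : ∀ i, IsRegularSLSolution V' a' T (z i) (c i) (u' i) (u₁' i))
    (h_gram : ∀ i j, ∫ x, ⟪u i x, u j x⟫_ℂ ∂unitMeasure = ∫ x, ⟪u' i x, u' j x⟫_ℂ ∂unitMeasure)
    (hd : DenseRange (Finsupp.linearCombination ℂ fun i => toL2Unit (hu i).continuousOn))
    (hd' : DenseRange (Finsupp.linearCombination ℂ fun i => toL2Unit (hu' i).continuousOn))
    (i : ι) : EqOn (u i) (u' i) (Icc 0 1) := by
  obtain ⟨W, W', hW, hW', hadj⟩ := exists_adjoint_pair_of_gram_eq (𝕜 := ℂ) (fun i j => by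
    rw [inner_toL2Unit_toL2Unit, inner_toL2Unit_toL2Unit, h_gram]) hd hd'
  obtain ⟨K, hK⟩ := exists_ae_norm_linearCombination_sub_le hV hV' hT haT haT' hu hu'
  obtain ⟨K', hK'⟩ := exists_ae_norm_linearCombination_sub_le hV' hV hT haT' haT hu' hu
  have hW_id := eq_self_of_causal_adjoint (W := W.toLinearMap) (W' := W'.toLinearMap) hadj
    (isCausalPerturbation_of_denseRange hd W.continuous hW hK)
    (isCausalPerturbation_of_denseRange hd' W'.continuous hW' hK')
  have h_eq : toL2Unit (hu i).continuousOn = toL2Unit (hu' i).continuousOn := by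
    simpa only [Finsupp.linearCombination_single, one_smul] using
      (hW_id _).symm.trans (hW (Finsupp.single i 1))
  have h_coe := coeFn_toL2Unit (hu i).continuousOn
  rw [h_eq] at h_coe
  exact Measure.eqOn_Icc_of_ae_eq volume zero_ne_one (h_coe.symm.trans (coeFn_toL2Unit _))
    (hu i).continuousOn (hu' i).continuousOn

variable {ζ : ℂ} {e : E} {v v₁ v' v₁' : ℝ → E}

theorem exists_norm_sub_le_mul_norm_sub_linearCombination (hV : Integrable V unitMeasure)
    (hV' : Integrable V' unitMeasure) (hT : T * T = T) (haT : a * T = 0) (haT' : a' * T = 0)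
    (hu : ∀ i, IsRegularSLSolution V a T (z i) (c i) (u i) (u₁ i))
    (hu' : ∀ i, IsRegularSLSolution V' a' T (z i) (c i) (u' i) (u₁' i))
    (h_eq : ∀ i, EqOn (u i) (u' i) (Icc 0 1)) (hv : IsRegularSLSolution V a T ζ e v v₁)
    (hv' : IsRegularSLSolution V' a' T ζ e v' v₁') :
    ∃ C : ℝ, ∀ w : ι →₀ ℂ, ∀ x ∈ Icc (0 : ℝ) 1, ‖v x - v' x‖ ≤ C * ‖toL2Unit hv.continuousOn -
      Finsupp.linearCombination ℂ (fun i => toL2Unit (hu i).continuousOn) w‖ := by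
  obtain ⟨C, hC, h_bound⟩ := exists_comparison_bound (Option ι) hV hV' hT haT haT'
  refine ⟨C, fun w x hx => ?_⟩
  set f := toL2Unit hv.continuousOn -
    Finsupp.linearCombination ℂ (fun i => toL2Unit (hu i).continuousOn) w with hf
  have hf_coe : f =ᵐ[unitMeasure] fun t => v t + ∑ i ∈ w.support, (-w i) • u i t := by
    filter_upwards [Lp.coeFn_sub (toL2Unit hv.continuousOn)
      (Finsupp.linearCombination ℂ (fun i => toL2Unit (hu i).continuousOn) w),
      coeFn_toL2Unit hv.continuousOn,
      coeFn_linearCombination_toL2Unit (fun i => (hu i).continuousOn) w] with t ht htv htu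
    rw [hf, ht, Pi.sub_apply, htv, htu, sub_eq_add_neg, ← Finset.sum_neg_distrib]
    simp only [neg_smul]
  have h_norm : ∫ t in (0 : ℝ)..x, ‖v t + ∑ i ∈ w.support, (-w i) • u i t‖ ≤ ‖f‖ := by
    rw [← intervalIntegral_congr_ae_unit (hf_coe.mono fun t ht => congrArg norm ht)
      unitInterval.zero_mem hx]
    exact intervalIntegral_norm_le_norm_Lp_unit f hx
  have h_sum := h_bound (Finset.insertNone w.support) (fun o => o.elim ζ z)
    (fun o => o.elim e fun i => (-w i) • c i) (fun o => o.elim v fun i x => (-w i) • u i x)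
    (fun o => o.elim v₁ fun i x => (-w i) • u₁ i x) (fun o => o.elim v' fun i x => (-w i) • u' i x)
    (fun o => o.elim v₁' fun i x => (-w i) • u₁' i x)
    (Option.forall.2 ⟨fun _ => hv, fun i _ => (hu i).const_smul _⟩)
    (Option.forall.2 ⟨fun _ => hv', fun i _ => (hu' i).const_smul _⟩) x hx
  simp only [Finset.sum_insertNone, Option.elim_none, Option.elim_some, ← h_eq _ hx,
    add_sub_add_right_eq_sub] at h_sum
  rw [norm_sub_rev]
  exact h_sum.trans (mul_le_mul_of_nonneg_left h_norm hC)

theorem IsRegularSLSolution.eqOn_of_denseRange (hv : IsRegularSLSolution V a T ζ e v v₁)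
    (hv' : IsRegularSLSolution V' a' T ζ e v' v₁') (hV : Integrable V unitMeasure)
    (hV' : Integrable V' unitMeasure) (hT : T * T = T) (haT : a * T = 0) (haT' : a' * T = 0)
    (hu : ∀ i, IsRegularSLSolution V a T (z i) (c i) (u i) (u₁ i))
    (hu' : ∀ i, IsRegularSLSolution V' a' T (z i) (c i) (u' i) (u₁' i))
    (hd : DenseRange (Finsupp.linearCombination ℂ fun i => toL2Unit (hu i).continuousOn))
    (h_eq : ∀ i, EqOn (u i) (u' i) (Icc 0 1)) : EqOn v v' (Icc 0 1) := by
  intro x hx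
  obtain ⟨C, hC⟩ :=
    exists_norm_sub_le_mul_norm_sub_linearCombination hV hV' hT haT haT' hu hu' h_eq hv hv'
  have h_bound : ‖v x - v' x‖ ≤ C * ‖toL2Unit hv.continuousOn - toL2Unit hv.continuousOn‖ :=
    hd.induction_on (p := fun f => _ ≤ C * ‖toL2Unit hv.continuousOn - f‖) _
      (isClosed_le (by fun_prop) (by fun_prop)) fun w => hC w x hx
  rw [sub_self, norm_zero, mul_zero] at h_bound
  exact sub_eq_zero.1 (norm_le_zero_iff.1 h_bound)

end SpectralTransformation

section Uniqueness

section Potential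

variable {E : Type*} [NormedAddCommGroup E] [NormedSpace ℂ E] {V V' : ℝ → E →L[ℂ] E} {z : ℂ}
  {u u₁ u' u₁' : ℝ → E}

theorem IsSLSolution.eqOn_deriv (hu : IsSLSolution V z u u₁) (hu' : IsSLSolution V' z u' u₁')
    (h : EqOn u u' (Icc 0 1)) : EqOn u₁ u₁' (Icc 0 1) := by
  obtain ⟨u₂, hu, -⟩ := hu
  obtain ⟨u₂', hu', -⟩ := hu'
  exact fun x hx =>
    sub_eq_zero.1 ((hu.sub hu').deriv_eq_zero (fun y hy => sub_eq_zero.2 (h hy)) hx)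

theorem IsSLSolution.ae_potential_apply_eq [CompleteSpace E] (hu : IsSLSolution V z u u₁)
    (hu' : IsSLSolution V' z u' u₁') (h : EqOn u u' (Icc 0 1)) :
    ∀ᵐ x ∂unitMeasure, V x (u x) = V' x (u x) := by
  have h_deriv := hu.eqOn_deriv hu' h
  obtain ⟨u₂, hu, hu_eq⟩ := hu
  obtain ⟨u₂', hu', hu_eq'⟩ := hu'
  filter_upwards [hu_eq, hu_eq', (hu.sub hu').deriv_two_ae_eq_zero fun x hx =>
    sub_eq_zero.2 (h_deriv hx), ae_restrict_mem measurableSet_Icc] with x hx hx' hx₂ hx_mem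
  rw [← h hx_mem, ← hx, ← (sub_eq_zero.1 hx₂ : u₂ x = u₂' x)] at hx'
  exact (add_left_cancel hx').symm

theorem ae_apply_eq_of_denseRange_linearCombination {ι : Type*} {u : ι → ℝ → E}
    (hu : ∀ i, ContinuousOn (u i) (Icc 0 1))
    (hd : DenseRange (Finsupp.linearCombination ℂ fun i => toL2Unit (hu i)))
    (h : ∀ i, ∀ᵐ x ∂unitMeasure, V x (u i x) = V' x (u i x)) (f : Lp E 2 unitMeasure) :
    ∀ᵐ x ∂unitMeasure, V x (f x) = V' x (f x) := by
  obtain ⟨g, hg, hgf⟩ := mem_closure_iff_seq_limit.1 (hd f)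
  choose w hw using hg
  obtain ⟨ns, -, h_lim⟩ := (tendstoInMeasure_of_tendsto_Lp hgf).exists_seq_tendsto_ae
  have h_comb (n : ℕ) : ∀ᵐ x ∂unitMeasure, V x (g (ns n) x) = V' x (g (ns n) x) := by
    rw [← hw]
    filter_upwards [coeFn_linearCombination_toL2Unit hu (w (ns n)),
      (ae_ball_iff (w (ns n)).support.countable_toSet).2 fun i _ => h i] with x hx hx_eq
    simp only [hx, map_sum, map_smul]
    exact Finset.sum_congr rfl fun i hi => by rw [hx_eq i hi]
  filter_upwards [h_lim, ae_all_iff.2 h_comb] with x hx hx_eq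
  exact tendsto_nhds_unique (((V x).continuous.tendsto _).comp hx)
    ((((V' x).continuous.tendsto _).comp hx).congr fun n => (hx_eq n).symm)

theorem ae_eq_of_ae_apply_Lp_eq [TopologicalSpace.SeparableSpace E]
    (h : ∀ f : Lp E 2 unitMeasure, ∀ᵐ x ∂unitMeasure, V x (f x) = V' x (f x)) :
    V =ᵐ[unitMeasure] V' := by
  have h_const (e : E) : ∀ᵐ x ∂unitMeasure, V x e = V' x e := by
    filter_upwards [h (toL2Unit (f := fun _ => e) continuousOn_const),
      coeFn_toL2Unit (f := fun _ => e) continuousOn_const] with x hx hx_coe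
    rwa [hx_coe] at hx
  filter_upwards [ae_all_iff.2 fun n => h_const (TopologicalSpace.denseSeq E n)] with x hx
  exact DFunLike.coe_injective ((TopologicalSpace.denseRange_denseSeq E).equalizer
    (V x).continuous (V' x).continuous (funext hx))

end Potential

open scoped InnerProductSpace

variable {E : Type*} [NormedAddCommGroup E] [InnerProductSpace ℂ E] [CompleteSpace E]
  {Tm Tp : E →L[ℂ] E} {V V' : ℝ → E →L[ℂ] E} {a a' b b' : E →L[ℂ] E}

theorem IsSLParam.exists_isRegularSLSolution (h : IsSLParam Tm Tp V a b) (hTm : Tm * Tm = Tm)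
    (z : ℂ) (c : E) : ∃ u u₁, IsRegularSLSolution V a Tm z c u u₁ :=
  have haT := h.a_mul_eq_zero hTm
  have hTa := h.mul_a_eq_zero hTm
  have ⟨_, _, hF⟩ := exists_isFundMinus h.integrable hTm haT hTa z
  ⟨_, _, hF.isRegularSLSolution_apply hTm haT hTa c⟩

theorem IsSLEigenfunction.eqOn_zero_of_not_isSLEigenvalue {lam : ℝ} {c : E} {u u₁ : ℝ → E}
    (hu : IsSLEigenfunction Tm Tp V a b lam c u u₁) (h : IsSLParam Tm Tp V a b)
    (hTm : Tm * Tm = Tm) (hlam : ¬ IsSLEigenvalue Tm Tp V a b lam) : EqOn u 0 (Icc 0 1) := by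
  have haT := h.a_mul_eq_zero hTm
  have hTa := h.mul_a_eq_zero hTm
  obtain ⟨F, F₁, hF⟩ := exists_isFundMinus h.integrable hTm haT hTa lam
  have hc : c = 0 := by_contra fun hc => hlam (hu.isSLEigenvalue h hTm hc)
  intro x hx
  rw [(hF.eq_apply h.integrable hTm haT hTa hu.toIsRegularSLSolution hx).1, hc, map_zero,
    Pi.zero_apply]

variable [FiniteDimensional ℂ E]

theorem IsSLParam.denseRange_linearCombination_eigenfunctions {ι : Type*} {lam : ι → ℝ} {c : ι → E}
    {u u₁ : ι → ℝ → E} (h : IsSLParam Tm Tp V a b) (hTm : IsStarProjection Tm)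
    (hTp : IsStarProjection Tp)
    (hu : ∀ i, IsSLEigenfunction Tm Tp V a b (lam i) (c i) (u i) (u₁ i))
    (h_exhaust : ∀ mu d v v₁, IsSLEigenfunction Tm Tp V a b mu d v v₁ →
      ∃ i, lam i = mu ∧ c i = d) :
    DenseRange (Finsupp.linearCombination ℂ fun i => toL2Unit (hu i).continuousOn) := by
  set A := Finsupp.linearCombination ℂ fun i => toL2Unit (hu i).continuousOn
  have h_top : (LinearMap.range A).topologicalClosure = ⊤ := by
    rw [Submodule.topologicalClosure_eq_top_iff, Submodule.eq_bot_iff]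
    refine fun g hg => h.eq_zero_of_orthogonal hTm hTp fun mu d v v₁ hv => ?_
    obtain ⟨i, rfl, rfl⟩ := h_exhaust mu d v v₁ hv
    have h_inner := (Submodule.mem_orthogonal _ g).1 hg (A (Finsupp.single i 1)) ⟨_, rfl⟩
    rw [Finsupp.linearCombination_single, one_smul, inner_toL2Unit_left] at h_inner
    rw [← h_inner]
    refine integral_congr_ae ?_
    filter_upwards [ae_restrict_mem measurableSet_Icc] with x hx
    rw [((hu i).eq_of_isRegularSLSolution h.integrable hv.toIsRegularSLSolution hx).1]
  rw [DenseRange, dense_iff_closure_eq, ← LinearMap.coe_range, ← Submodule.topologicalClosure_coe,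
    h_top, Submodule.top_coe]

/-- The pairs `(λ, c)` for which `L` has an eigenfunction `u` with eigenvalue `λ` and `Γ₋^⊥u = c`.
They index the eigenfunctions of `L`. -/
def slEigenpairs (Tm Tp : E →L[ℂ] E) (V : ℝ → E →L[ℂ] E) (a b : E →L[ℂ] E) : Set (ℝ × E) :=
  {q | ∃ u u₁, IsSLEigenfunction Tm Tp V a b q.1 q.2 u u₁}

theorem exists_denseRange_common_eigenfunctions (h : IsSLParam Tm Tp V a b)
    (h' : IsSLParam Tm Tp V' a' b') (hTm : IsStarProjection Tm) (hTp : IsStarProjection Tp)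
    (hdata : spectralData Tm Tp V a b = spectralData Tm Tp V' a' b') :
    ∃ (u u₁ u' u₁' : slEigenpairs Tm Tp V a b → ℝ → E)
      (hu : ∀ q, IsSLEigenfunction Tm Tp V a b q.1.1 q.1.2 (u q) (u₁ q)),
      (∀ q, IsSLEigenfunction Tm Tp V' a' b' q.1.1 q.1.2 (u' q) (u₁' q)) ∧
      DenseRange (Finsupp.linearCombination ℂ fun q => toL2Unit (hu q).continuousOn) ∧
      ∀ q, EqOn (u q) (u' q) (Icc 0 1) := by
  have hTm_mul := hTm.isIdempotentElem
  choose u u₁ hu using fun q : slEigenpairs Tm Tp V a b => q.2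
  choose u' u₁' hu'_reg using fun q : slEigenpairs Tm Tp V a b =>
    h'.exists_isRegularSLSolution hTm_mul q.1.1 q.1.2
  have hu' q := (hu q).of_spectralData_eq h h' hTm_mul hdata (hu'_reg q)
  have hd := h.denseRange_linearCombination_eigenfunctions hTm hTp hu
    fun mu d v v₁ hv => ⟨⟨(mu, d), v, v₁, hv⟩, rfl, rfl⟩
  have hd' := h'.denseRange_linearCombination_eigenfunctions hTm hTp hu' fun mu d v v₁ hv =>
    have ⟨w, w₁, hw⟩ := h.exists_isRegularSLSolution hTm_mul mu d
    ⟨⟨(mu, d), w, w₁, hv.of_spectralData_eq h' h hTm_mul hdata.symm hw⟩, rfl, rfl⟩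
  have h_gram p q : ∫ x, ⟪u p x, u q x⟫_ℂ ∂unitMeasure = ∫ x, ⟪u' p x, u' q x⟫_ℂ ∂unitMeasure :=
    (hu p).integral_inner_eq_of_spectralData_eq (hu q) h h' hTm hTp hdata (hu'_reg p) (hu'_reg q)
  have h_eq := eqOn_of_gram_eq_of_denseRange h.integrable h'.integrable hTm_mul
    (h.a_mul_eq_zero hTm_mul) (h'.a_mul_eq_zero hTm_mul)
    (fun q => (hu q).toIsRegularSLSolution) hu'_reg h_gram hd hd'
  exact ⟨u, u₁, u', u₁', hu, hu', hd, h_eq⟩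

theorem IsRegularSLSolution.eqOn_of_spectralData_eq {z : ℂ} {e : E} {v v₁ v' v₁' : ℝ → E}
    (hv : IsRegularSLSolution V a Tm z e v v₁) (hv' : IsRegularSLSolution V' a' Tm z e v' v₁')
    (h : IsSLParam Tm Tp V a b) (h' : IsSLParam Tm Tp V' a' b') (hTm : IsStarProjection Tm)
    (hTp : IsStarProjection Tp)
    (hdata : spectralData Tm Tp V a b = spectralData Tm Tp V' a' b') : EqOn v v' (Icc 0 1) := by
  have hTm_mul := hTm.isIdempotentElem
  obtain ⟨u, u₁, u', u₁', hu, hu', hd, h_eq⟩ :=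
    exists_denseRange_common_eigenfunctions h h' hTm hTp hdata
  exact hv.eqOn_of_denseRange hv' h.integrable h'.integrable hTm_mul (h.a_mul_eq_zero hTm_mul)
    (h'.a_mul_eq_zero hTm_mul) (fun i => (hu i).toIsRegularSLSolution)
    (fun i => (hu' i).toIsRegularSLSolution) hd h_eq

theorem potential_ae_eq_of_spectralData_eq (h : IsSLParam Tm Tp V a b)
    (h' : IsSLParam Tm Tp V' a' b') (hTm : IsStarProjection Tm) (hTp : IsStarProjection Tp)
    (hdata : spectralData Tm Tp V a b = spectralData Tm Tp V' a' b') : V =ᵐ[unitMeasure] V' := by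
  have := FiniteDimensional.proper ℂ E
  obtain ⟨u, u₁, u', u₁', hu, hu', hd, h_eq⟩ :=
    exists_denseRange_common_eigenfunctions h h' hTm hTp hdata
  exact ae_eq_of_ae_apply_Lp_eq <| ae_apply_eq_of_denseRange_linearCombination _ hd fun i =>
    (hu i).isSLSolution.ae_potential_apply_eq (hu' i).isSLSolution (h_eq i)

theorem bdryLeft_eq_of_spectralData_eq (h : IsSLParam Tm Tp V a b)
    (h' : IsSLParam Tm Tp V' a' b') (hTm : IsStarProjection Tm) (hTp : IsStarProjection Tp)
    (hdata : spectralData Tm Tp V a b = spectralData Tm Tp V' a' b') : a = a' := by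
  ext1 c
  obtain ⟨u, u₁, hu⟩ := h.exists_isRegularSLSolution hTm.isIdempotentElem 0 c
  obtain ⟨u', u₁', hu'⟩ := h'.exists_isRegularSLSolution hTm.isIdempotentElem 0 c
  have h_deriv := hu.isSLSolution.eqOn_deriv hu'.isSLSolution
    (hu.eqOn_of_spectralData_eq hu' h h' hTm hTp hdata) unitInterval.zero_mem
  rw [hu.deriv_zero, hu'.deriv_zero] at h_deriv
  exact add_left_cancel h_deriv

theorem IsSLParam.eq_zero_of_inner_eigenfunction_one_eq_zero (h : IsSLParam Tm Tp V a b)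
    (hTm : IsStarProjection Tm) (hTp : IsStarProjection Tp) {e : E} (he : Tp e = 0)
    (h_orth : ∀ lam c u u₁, IsSLEigenfunction Tm Tp V a b lam c u u₁ → ⟪e, u 1⟫_ℂ = 0) :
    e = 0 := by
  have := FiniteDimensional.proper ℂ E
  have : Fact ((2 : ENNReal) ≠ ⊤) := ⟨ENNReal.ofNat_ne_top⟩
  have hTm_mul := hTm.isIdempotentElem
  have haT := h.a_mul_eq_zero hTm_mul
  have hTa := h.mul_a_eq_zero hTm_mul
  -- Write `e = Γ₊F₋ d` at a non-eigenvalue: by Green's formula, `F₋ d` is orthogonal to all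
  -- eigenfunctions.
  obtain ⟨mu, hmu⟩ := h.exists_not_isSLEigenvalue hTm hTp
  obtain ⟨F, F₁, hF⟩ := exists_isFundMinus h.integrable hTm_mul haT hTa mu
  obtain ⟨d, rfl⟩ := hF.exists_bdryPlus_apply_eq h hTm_mul hmu e
  have hv := hF.isRegularSLSolution_apply hTm_mul haT hTa d
  have h_zero : toL2Unit hv.continuousOn = 0 := by
    refine h.eq_zero_of_orthogonal hTm hTp fun lam c u u₁ hu => ?_
    obtain rfl | hne := eq_or_ne mu lam
    · refine integral_eq_zero_of_ae ?_
      filter_upwards [ae_restrict_mem measurableSet_Icc] with x hx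
      rw [hu.eqOn_zero_of_not_isSLEigenvalue h hTm_mul hmu hx, Pi.zero_apply, inner_zero_left,
        Pi.zero_apply]
    have h_green := h.green_isSLSolution hTm hTp hv.isSLSolution hu.isSLSolution
      (hv.bdryMinus_eq_zero hTm_mul haT hTa) (hu.bdryMinus_eq_zero hTm_mul haT hTa) he
      (bdryPlus_apply _ _ _) hu.bdryPlus_eq_zero
    rw [h_orth _ _ _ _ hu, neg_zero, mul_eq_zero, or_iff_right
      (sub_ne_zero.2 (Complex.ofReal_injective.ne hne))] at h_green
    rw [← inner_toL2Unit_left hu.continuousOn, ← inner_conj_symm, inner_toL2Unit_toL2Unit,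
      h_green, map_zero]
  have hd0 : d = 0 := hF.eq_zero_of_apply_ae_eq_zero <| by
    have h_coe := coeFn_toL2Unit hv.continuousOn
    rw [h_zero] at h_coe
    exact h_coe.symm.trans (Lp.coeFn_zero E 2 unitMeasure)
  rw [hd0, map_zero]

theorem bdryRight_eq_of_spectralData_eq (h : IsSLParam Tm Tp V a b)
    (h' : IsSLParam Tm Tp V' a' b') (hTm : IsStarProjection Tm) (hTp : IsStarProjection Tp)
    (hdata : spectralData Tm Tp V a b = spectralData Tm Tp V' a' b') : b = b' := by
  have hTp_mul := hTp.isIdempotentElem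
  have hTb := h.mul_b_eq_zero hTp_mul
  have hTb' := h'.mul_b_eq_zero hTp_mul
  have h_symm (x y : E) : ⟪(b - b') x, y⟫_ℂ = ⟪x, (b - b') y⟫_ℂ :=
    (h.b_selfAdjoint.sub h'.b_selfAdjoint).isSymmetric x y
  refine sub_eq_zero.1 (ContinuousLinearMap.ext fun w =>
    h.eq_zero_of_inner_eigenfunction_one_eq_zero hTm hTp ?_ fun lam c u u₁ hu => ?_)
  · exact DFunLike.congr_fun (show Tp * (b - b') = 0 by rw [mul_sub, hTb, hTb', sub_zero]) w
  obtain ⟨u', u₁', hu'⟩ := h'.exists_isRegularSLSolution hTm.isIdempotentElem lam c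
  have hu'_eig := hu.of_spectralData_eq h h' hTm.isIdempotentElem hdata hu'
  have h_eq := hu.eqOn_of_spectralData_eq hu' h h' hTm hTp hdata
  have h_deriv := hu.isSLSolution.eqOn_deriv hu'.isSLSolution h_eq
  have h_bdry := ((bdryPlus_eq_iff hTp_mul hTb _ _ (smul_zero _)).1 hu.bdryPlus_eq_zero).2
  have h_bdry' := ((bdryPlus_eq_iff hTp_mul hTb' _ _ (smul_zero _)).1 hu'_eig.bdryPlus_eq_zero).2
  rw [← h_eq unitInterval.one_mem, ← h_deriv unitInterval.one_mem, h_bdry, add_zero, add_zero,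
    neg_inj] at h_bdry'
  rw [h_symm, show (b - b') (u 1) = 0 from sub_eq_zero.2 h_bdry', inner_zero_right]

end Uniqueness

theorem mainTheorem1_general {E : Type*} [NormedAddCommGroup E] [InnerProductSpace ℂ E]
    [FiniteDimensional ℂ E] [CompleteSpace E] {Tm Tp : E →L[ℂ] E} {V V' : ℝ → E →L[ℂ] E}
    {a a' b b' : E →L[ℂ] E} (hTm : IsStarProjection Tm) (hTp : IsStarProjection Tp)
    (h : IsSLParam Tm Tp V a b) (h' : IsSLParam Tm Tp V' a' b')
    (hdata : spectralData Tm Tp V a b = spectralData Tm Tp V' a' b') :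
    V =ᵐ[unitMeasure] V' ∧ a = a' ∧ b = b' :=
  ⟨potential_ae_eq_of_spectralData_eq h h' hTm hTp hdata,
    bdryLeft_eq_of_spectralData_eq h h' hTm hTp hdata,
    bdryRight_eq_of_spectralData_eq h h' hTm hTp hdata⟩

theorem mainTheorem1 {N : ℕ}
    (Tm Tp : EuclideanSpace ℂ (Fin N) →L[ℂ] EuclideanSpace ℂ (Fin N))
    (hTm : IsStarProjection Tm) (hTp : IsStarProjection Tp)
    (V V' : ℝ → EuclideanSpace ℂ (Fin N) →L[ℂ] EuclideanSpace ℂ (Fin N))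
    (a a' b b' : EuclideanSpace ℂ (Fin N) →L[ℂ] EuclideanSpace ℂ (Fin N))
    (h : IsSLParam Tm Tp V a b) (h' : IsSLParam Tm Tp V' a' b')
    (hdata : spectralData Tm Tp V a b = spectralData Tm Tp V' a' b') :
    V =ᵐ[unitMeasure] V' ∧ a = a' ∧ b = b' :=
  mainTheorem1_general hTm hTp h h' hdata
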